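/- **Setting.** Let $P$ be a path with vertices $v_1,\dots,v_n$ from left to right and edges $e_i=(v_i,v_{i+1})$ of length $d(e_i)>0$; a point of $P$ is identified with its distance from $v_1$, and $d$ is the distance along $P$. All edges have capacity $c>0$, and $\tau>0$ is the transit time per unit distance. The weight of $v_i$ lies in $[\underline w(v_i),\overline w(v_i)]$ with $0<\underline w(v_i)\le\overline w(v_i)$. A scenario $s$ fixes weights $w^s(v_i)$. *Cost.* Consider the evacuees from vertices $u_0,u_1,\dots,u_{m-1}$ on one side of a point, numbered by increasing distance from it. They are grouped into clusters: $u_0$ is the front of the first cluster; if $u_a$ is the front of the cluster containing $u_i$, then $u_{i+1}$ belongs to the same cluster iff $d(u_a,u_{i+1})\,\tau\le \frac1c\sum_{j=a}^{i}w^s(u_j)$, and otherwise it is the front of a new cluster. The cost at $x$ of these evacuees is $\sum_C\big(d(x,u_C)\,\lambda(C)\,\tau+\lambda(C)^2/2c\big)$, summed over the clusters $C$ with front $u_C$ and total weight $\lambda(C)$. $\Phi^s(x)$ is the cost at $x$ of the vertices strictly to the left of $x$ plus that of the vertices strictly to the right of $x$. A sink $\mu^s$ is a point of $P$ minimizing $\Phi^s$,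 and the regret is $R^s(x)=\Phi^s(x)-\Phi^s(\mu^s)$. On each open edge $R^s$ is linear; it may jump at vertices. *Scenarios.* The L-pseudo-bipartite scenario with boundary index $b$ and weight $w$ has $w(v_b)=w$, weights $\overline w(v_i)$ for $i<b$ and $\underline w(v_i)$ for $i>b$; R-pseudo-bipartite scenarios have the roles of $i<b$ and $i>b$ exchanged. For type $T\in\{L,R\}$, a weight $w\in(\underline w(v_b),\overline w(v_b)]$ is critical if, as the weight of $v_b$ increases from $\underline w(v_b)$, two clusters (of the evacuees from $v_k,\dots,v_n$ going left over $e_{k-1}$ for some $2\le k\le n$, or from $v_1,\dots,v_k$ going right over $e_k$ for some $1\le k\le n-1$) are separate before $w$ and merged at $w$. $\mathcal S^*_{T,b}$ is the set of the scenarios of type $T$ with boundary index $b$ and critical weight; $\mathcal S^*_b=\mathcal S^*_{L,b}\cup\mathcal S^*_{R,b}$ and $\mathcal S^*=\bigcup_{b=1}^n\mathcal S^*_b$. *Segments.* A function on $[v_1,v_n]$ has at most $M$ line segments if $[v_1,v_n]$ can be divided into $M$ successive intervals on whose interiors it is affine (isolated values at the division points, such as the values at vertices, are allowed). *Machine model.*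 Real RAM with unit-cost real arithmetic, comparisons and array access. The critical weights are given as a list for each $T$ and $b$, in any order and without repetition, and the data $\Phi^s(x)$, for a point $x$ that has been computed, and $\mu^s$, $s\in\mathcal S^*$, are available at unit cost. *Algorithm 3* (input: type $T$, index $b$, the functions $R^s$, $s\in\mathcal S^*_{T,b}$). On $[v_b,v_n]$: order the functions by the weight of $v_b$; let $U$ be the first one and process the others in this order. For the next function $R^s$: if $R^s(v_b)\ge U(v_b)$, put $U=R^s$; otherwise, if $R^s(v_n)\le U(v_n)$, ignore it; otherwise find, by binary search over the crossing points stored for $U$ (first comparing $R^s$ with $U$ at the last one) and over the vertices, the point where $R^s$ crosses $U$ from below, and replace $U$ by $R^s$ to the right of this point. $[v_1,v_b]$ is treated symmetrically. The result is stored as the ordered list of crossing points together with the scenario in force between consecutive ones. **Claim.** All constants in $O(\cdot)$ are absolute. $\mathcal S^*$ is finite. For each $b\in\{1,\dots,n\}$: (a) If $\mathcal A$ is any of the sets $\mathcal S^*_b$, $\mathcal S^*_{L,b}$, $\mathcal S^*_{R,b}$ and is nonempty, the upper envelope $\max_{s\in\mathcal A}R^s(x)$ has $O(|\mathcal A|+n)$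 line segments. (b) For $T\in\{L,R\}$ with $\mathcal S^*_{T,b}\neq\emptyset$, Algorithm 3 computes $\max_{s\in\mathcal S^*_{T,b}}R^s(x)$ correctly, at every point $x$ of $P$, in $O(|\mathcal S^*_{T,b}|\log n)$ time. If $\mathcal S^*_b\ne\emptyset$, the envelope $\max_{s\in\mathcal S^*_b}R^s(x)$ over both types, written out as an explicit list of line segments on each edge and a value at each vertex, is obtained by Algorithm 3 for both types followed by a combination step, in $O((|\mathcal S^*_b|+n)\log n)$ time. (c) If $\mathcal S^*\neq\emptyset$, the upper envelope $\max_{s\in\mathcal S^*}R^s(x)$ has $O(n^2)$ line segments, and it can be computed, written out in the same explicit form, in $O(n^2\log n)$ time. -/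

import Mathlib

noncomputable section

namespace EvacPath

/-! ## Dynamic flow path networks -/

/-- A path `v_1, …, v_n` with positive edge lengths `len i = d(e_i)`, `e_i = (v_i, v_{i+1})`, uniform
edge capacity `cap`, transit time `tau` per unit distance, and bounds `0 < wlo i ≤ whi i` on the
weight of `v_i`.  Values at indices that name no vertex or edge are irrelevant. -/
structure PathNetwork where
  n : ℕ
  len : ℕ → ℝ
  cap : ℝ
  tau : ℝ
  wlo : ℕ → ℝ
  whi : ℕ → ℝ
  len_pos : ∀ i, 1 ≤ i → i < n → 0 < len i
  cap_pos : 0 < cap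
  tau_pos : 0 < tau
  wlo_pos : ∀ i, 1 ≤ i → i ≤ n → 0 < wlo i
  wlo_le_whi : ∀ i, 1 ≤ i → i ≤ n → wlo i ≤ whi i

/-! ### Clusters and cost of the evacuees that arrive from one side

The vertices on one side of the destination are numbered `0, 1, 2, …` by increasing distance from
it; `q i` is the distance (from the destination or from any other reference point on the far side
of vertex `0`) and `w i` the weight of the `i`-th one. -/

/-- The front vertex of the cluster that carries the evacuees of vertex `i`.  The evacuees of vertex
`i + 1` continue the current cluster without a gap iff the first of them can be at its front `u` by
the time at which the evacuees of `u, …, i`, which leave `u` at rate `c`, have left; otherwise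
`i + 1` is the front of a new cluster. -/
def front (c τ : ℝ) (q w : ℕ → ℝ) : ℕ → ℕ
  | 0 => 0
  | i + 1 =>
    if (q (i + 1) - q (front c τ q w i)) * τ ≤ (∑ m ∈ Finset.Icc (front c τ q w i) i, w m) / c then
      front c τ q w i
    else i + 1

/-- The total weight `λ(C)` of the cluster with front `u`, among the first `m` vertices. -/
def clusterWeight (c τ : ℝ) (q w : ℕ → ℝ) (m u : ℕ) : ℝ :=
  ∑ i ∈ (Finset.range m).filter (fun i => front c τ q w i = u), w i

/-- Sum over the clusters of extra cost (distance of the front times `λ(C) τ`) and intra cost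
(`λ(C)² / 2c`), for `m` vertices at distances `q i` from the destination. -/
def sideCost (c τ : ℝ) (q w : ℕ → ℝ) (m : ℕ) : ℝ :=
  ∑ u ∈ (Finset.range m).filter (fun u => front c τ q w u = u),
    (q u * clusterWeight c τ q w m u * τ + clusterWeight c τ q w m u ^ 2 / (2 * c))

/-- The two directions.  As the kind of a pseudo-bipartite scenario, `L` means that the vertices on
the left of the boundary vertex have maximum weight. -/
inductive Side where
  | L
  | R

namespace PathNetwork

variable (N : PathNetwork)

/-- Coordinate of `v_i`, the distance from `v_1`. -/
def pos (i : ℕ) : ℝ := ∑ j ∈ Finset.Ico 1 i, N.len j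

/-- The points of the path. -/
def path : Set ℝ := Set.Icc (N.pos 1) (N.pos N.n)

/-- `Φ_{L,k}(x)`: cost at `x` of the evacuees of `v_1, …, v_k`, all to the left of `x`. -/
def costL (w : ℕ → ℝ) (k : ℕ) (x : ℝ) : ℝ :=
  sideCost N.cap N.tau (fun i => x - N.pos (k - i)) (fun i => w (k - i)) k

/-- `Φ_{R,k}(x)`: cost at `x` of the evacuees of `v_k, …, v_n`, all to the right of `x`. -/
def costR (w : ℕ → ℝ) (k : ℕ) (x : ℝ) : ℝ :=
  sideCost N.cap N.tau (fun i => N.pos (k + i) - x) (fun i => w (k + i)) (N.n + 1 - k)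

/-- The number of vertices strictly to the left of `x`. -/
def numLT (x : ℝ) : ℕ := ((Finset.Icc 1 N.n).filter (fun i => N.pos i < x)).card

/-- The number of vertices at `x` or to the left of `x`. -/
def numLE (x : ℝ) : ℕ := ((Finset.Icc 1 N.n).filter (fun i => N.pos i ≤ x)).card

/-- `Φ(x)`: it is `Φ_{L,k}(x) + Φ_{R,k+1}(x)` strictly between `v_k` and `v_{k+1}`, and
`Φ_{L,k-1}(x) + Φ_{R,k+1}(x)` at `x = v_k`. -/
def cost (w : ℕ → ℝ) (x : ℝ) : ℝ := N.costL w (N.numLT x) x + N.costR w (N.numLE x + 1) x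

/-- `p` is an aggregate time sink under `w`. -/
def IsSink (w : ℕ → ℝ) (p : ℝ) : Prop := p ∈ N.path ∧ ∀ y ∈ N.path, N.cost w p ≤ N.cost w y

/-- `R^s(x) = Φ^s(x) - Φ^s(μ^s)`. -/
def regret (μ : (ℕ → ℝ) → ℝ) (s : ℕ → ℝ) (x : ℝ) : ℝ := N.cost s x - N.cost s (μ s)

/-! ### Critical pseudo-bipartite scenarios -/

/-- The pseudo-bipartite scenario of kind `T` with boundary vertex `v_b` of weight `w`
(extended by `0` to the indices that name no vertex). -/
def pseudo (T : Side) (b : ℕ) (w : ℝ) (i : ℕ) : ℝ :=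
  if 1 ≤ i ∧ i ≤ N.n then
    if i = b then w
    else
      match T with
      | Side.L => if i < b then N.whi i else N.wlo i
      | Side.R => if i < b then N.wlo i else N.whi i
  else 0

/-- Index of the front vertex of the `R`-cluster with respect to `e_{k-1}` that contains `v_j`,
`k ≤ j ≤ n`. -/
def frontR (w : ℕ → ℝ) (k j : ℕ) : ℕ :=
  k + front N.cap N.tau (fun i => N.pos (k + i) - N.pos k) (fun i => w (k + i)) (j - k)

/-- Index of the front vertex of the `L`-cluster with respect to `e_k` that contains `v_j`,
`1 ≤ j ≤ k`. -/
def frontL (w : ℕ → ℝ) (k j : ℕ) : ℕ :=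
  k - front N.cap N.tau (fun i => N.pos k - N.pos (k - i)) (fun i => w (k - i)) (k - j)

/-- The critical weights of `v_b` for scenarios of kind `T`: those at which the clusters of some
`v_i` and `v_j`, with respect to some edge, merge when the weight of `v_b` increases from its lower
bound. -/
def critWeights (T : Side) (b : ℕ) : Set ℝ :=
  {w | N.wlo b < w ∧ w ≤ N.whi b ∧
    ((∃ k i j, 2 ≤ k ∧ k ≤ i ∧ i < j ∧ j ≤ N.n ∧
        (∀ w', N.wlo b ≤ w' → w' < w →
          N.frontR (N.pseudo T b w') k i ≠ N.frontR (N.pseudo T b w') k j) ∧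
        N.frontR (N.pseudo T b w) k i = N.frontR (N.pseudo T b w) k j) ∨
     (∃ k i j, 1 ≤ i ∧ i < j ∧ j ≤ k ∧ k < N.n ∧
        (∀ w', N.wlo b ≤ w' → w' < w →
          N.frontL (N.pseudo T b w') k i ≠ N.frontL (N.pseudo T b w') k j) ∧
        N.frontL (N.pseudo T b w) k i = N.frontL (N.pseudo T b w) k j))}

/-- `S*_b ∩ S*_T`. -/
def starOf (T : Side) (b : ℕ) : Set (ℕ → ℝ) := N.pseudo T b '' N.critWeights T b

/-- `S*_b`. -/
def starAt (b : ℕ) : Set (ℕ → ℝ) := N.starOf Side.L b ∪ N.starOf Side.R b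

/-- `S*`. -/
def star : Set (ℕ → ℝ) := {s | ∃ b, 1 ≤ b ∧ b ≤ N.n ∧ s ∈ N.starAt b}

/-! ### Upper envelopes -/

/-- `y` is the maximum of `R^s(x)` over `s ∈ A`. -/
def IsMaxRegret (μ : (ℕ → ℝ) → ℝ) (A : Set (ℕ → ℝ)) (x y : ℝ) : Prop :=
  IsGreatest ((fun s => N.regret μ s x) '' A) y

/-- `U` is the upper envelope of the regret functions of the scenarios in `A`. -/
def IsUpperEnvelope (μ : (ℕ → ℝ) → ℝ) (A : Set (ℕ → ℝ)) (U : ℝ → ℝ) : Prop :=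
  ∀ x ∈ N.path, N.IsMaxRegret μ A x (U x)

end PathNetwork

/-- `f` consists on `[a, b]` of at most `M` line segments: it is affine on each of `M` successive
open intervals (it may have isolated values at their end points). -/
def HasSegments (f : ℝ → ℝ) (a b : ℝ) (M : ℕ) : Prop :=
  ∃ t : ℕ → ℝ, Monotone t ∧ t 0 = a ∧ t M = b ∧
    ∀ i < M, ∃ α β : ℝ, ∀ x ∈ Set.Ioo (t i) (t (i + 1)), f x = α * x + β

/-! ## Step-counted computations on a real random access machine -/

/-- The result of a computation together with the number of steps that it took. -/
structure Timed (α : Type) where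
  val : α
  time : ℕ

instance : Monad Timed where
  pure a := ⟨a, 0⟩
  bind x f := ⟨(f x.val).val, x.time + (f x.val).time⟩

/-- One step: `a` is obtained from values at hand by a bounded number of arithmetic operations,
comparisons, accesses to array cells or list heads, and requests for input data. -/
def op {α : Type} (a : α) : Timed α := ⟨a, 1⟩

/-- `k` steps without a result. -/
def charge (k : ℕ) : Timed Unit := ⟨(), k⟩

section Sorting

variable {ι : Type} (key : ι → ℝ)

def merge : List ι → List ι → Timed (List ι)
  | [], ys => op ys
  | x :: xs, [] => op (x :: xs)
  | x :: xs, y :: ys => do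
    let c ← op (decide (key x ≤ key y))
    if c then do
      let r ← merge xs (y :: ys)
      op (x :: r)
    else do
      let r ← merge (x :: xs) ys
      op (y :: r)
termination_by xs ys => xs.length + ys.length

/-- Merge sort; splitting a list in the middle costs its length. -/
def sort (l : List ι) : Timed (List ι) :=
  if h : l.length ≤ 1 then op l
  else do
    charge l.length
    let a ← sort (l.take (l.length / 2))
    let b ← sort (l.drop (l.length / 2))
    merge key a b
termination_by l.length
decreasing_by all_goals simp; omega

end Sorting

/-- An upper envelope over an interval, kept in an array: piece `i < len` consists of its left end
`(cell i).1` and the index `(cell i).2` of the function that attains the maximum on it. -/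
structure Env (ι : Type) where
  len : ℕ
  cell : ℕ → ℝ × ι

namespace Env

variable {ι : Type}

open Classical in
/-- The function that is in force at `t`: that of the last piece that starts before `t`, or that of
the first piece if there is none. -/
def active (U : Env ι) (t : ℝ) : ι :=
  (U.cell (Nat.findGreatest (fun i => i < U.len ∧ (U.cell i).1 < t) U.len)).2

/-- There is a piece, and the pieces are listed in order. -/
def Ordered (U : Env ι) : Prop :=
  0 < U.len ∧ ∀ i, i + 1 < U.len → (U.cell i).1 ≤ (U.cell (i + 1)).1

end Env

/-! ### The sweep that computes an upper envelope

`val s t` is the value of the function with index `s` at the point `t`; the functions are given on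
an interval that is divided at the points `p 0 < p 1 < … < p M`, between which they are affine.
They are ordered by `key`, and the difference of a later and an earlier one is nondecreasing. -/

section Sweep

variable {ι : Type} (val : ι → ℝ → ℝ) (p : ℕ → ℝ) (M : ℕ)

/-- Binary search for the last of the points `p lo, …, p (hi - 1)` at which `f` is at most `g`
(`lo` if there is none). -/
def bisectVertex (f g : ι) (lo hi : ℕ) : Timed ℕ :=
  if h : hi ≤ lo + 1 then op lo
  else do
    let c ← op (decide (val f (p ((lo + hi) / 2)) ≤ val g (p ((lo + hi) / 2))))
    if c then bisectVertex f g ((lo + hi) / 2) hi else bisectVertex f g lo ((lo + hi) / 2)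
termination_by hi - lo
decreasing_by all_goals omega

/-- The point where `f` crosses `g` from below: binary search for the subinterval
`[p j, p (j + 1)]` that contains it, and then the zero of the affine function that agrees with
`f - g` at the midpoint and at the right end of the subinterval, or `p j` if that zero is not in the
subinterval. -/
def crossing (f g : ι) : Timed ℝ := do
  let j ← bisectVertex val p f g 0 M
  let l ← op (p j)
  let r ← op (p (j + 1))
  let m ← op ((l + r) / 2)
  let dr ← op (val f r - val g r)
  let dm ← op (val f m - val g m)
  let c ← op (decide (dr ≤ dm))
  if c then op l else op (max l (r - dr * (r - m) / (dr - dm)))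

/-- The current crossing point `X`, that is, the left end of the last piece, or the right end of the
whole interval if there is only one piece; and the function that is in force at `X`. -/
def lastCrossing (U : Env ι) : ℝ × ι :=
  if U.len ≤ 1 then (p M, (U.cell 0).2)
  else ((U.cell (U.len - 1)).1, (U.cell (U.len - 2)).2)

/-- Binary search, among the pieces `lo, …, hi - 1` of `U`, for the last one at whose left end `s`
does not exceed `U` (`lo` if there is none). -/
def bisectPiece (U : Env ι) (s : ι) (lo hi : ℕ) : Timed ℕ :=
  if h : hi ≤ lo + 1 then op lo
  else do
    let c ← op (decide (val s (U.cell ((lo + hi) / 2)).1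
      ≤ val (U.cell ((lo + hi) / 2 - 1)).2 (U.cell ((lo + hi) / 2)).1))
    if c then bisectPiece U s ((lo + hi) / 2) hi else bisectPiece U s lo ((lo + hi) / 2)
termination_by hi - lo
decreasing_by all_goals omega

/-- Let `s` replace `U` to the right of the point where it crosses piece `lo` (dropping that piece
if nothing remains of it). -/
def insertAfter (U : Env ι) (s : ι) (lo : ℕ) : Timed (Env ι) := do
  let X ← crossing val p M s (U.cell lo).2
  let c ← op (decide (1 ≤ lo ∧ X ≤ (U.cell lo).1))
  if c then op ⟨lo + 1, Function.update U.cell lo ((U.cell lo).1, s)⟩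
  else op ⟨lo + 2, Function.update U.cell (lo + 1) (X, s)⟩

/-- Processing of the next function `s`. -/
def sweepStep (U : Env ι) (s : ι) : Timed (Env ι) := do
  let above ← op (decide (val (U.cell 0).2 (p 0) ≤ val s (p 0)))
  if above then op ⟨1, Function.update U.cell 0 (p 0, s)⟩
  else do
    let below ← op (decide (val s (p M) ≤ val (U.cell (U.len - 1)).2 (p M)))
    if below then op U
    else do
      let Xg ← op (lastCrossing p M U)
      let right ← op (decide (val s Xg.1 ≤ val Xg.2 Xg.1))
      if right then insertAfter val p M U s (U.len - 1)
      else do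
        let lo ← bisectPiece val U s 0 (U.len - 1)
        insertAfter val p M U s lo

def sweep : List ι → Env ι → Timed (Env ι)
  | [], U => op U
  | s :: rest, U => do
    let U' ← sweepStep val p M U s
    sweep rest U'

/-- Order the functions by `key`, let `U` be the smallest one, and process the others in order. -/
def upperEnvelope [Inhabited ι] (key : ι → ℝ) (l : List ι) : Timed (Env ι) := do
  let sorted ← sort key l
  match sorted with
  | [] => op ⟨0, fun _ => (0, default)⟩
  | f :: rest => sweep val p M rest ⟨1, fun _ => (p 0, f)⟩

end Sweep

/-! ### The upper envelope for one boundary vertex and one kind of scenarios -/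

section PhaseOne

variable (N : PathNetwork) (μ : (ℕ → ℝ) → ℝ)

/-- The point at distance `t` from `v_b` in direction `D`. -/
def place (b : ℕ) (D : Side) (t : ℝ) : ℝ :=
  match D with
  | Side.L => N.pos b - t
  | Side.R => N.pos b + t

/-- The index of the `j`-th vertex from `v_b` in direction `D`. -/
def outIdx (b : ℕ) (D : Side) (j : ℕ) : ℕ :=
  match D with
  | Side.L => b - j
  | Side.R => b + j

/-- The index of the `j`-th edge from `v_b` in direction `D`, where `e_i = (v_i, v_{i+1})`. -/
def outEdge (b : ℕ) (D : Side) (j : ℕ) : ℕ :=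
  match D with
  | Side.L => b - 1 - j
  | Side.R => b + j

/-- The number of edges from `v_b` to the end of the path in direction `D`. -/
def outLen (b : ℕ) (D : Side) : ℕ :=
  match D with
  | Side.L => b - 1
  | Side.R => N.n - b

/-- The distance of the `j`-th vertex from `v_b` in direction `D`. -/
def outDist (b : ℕ) (D : Side) (j : ℕ) : ℝ := |N.pos (outIdx b D j) - N.pos b|

/-- The upper envelope of the regret functions of the scenarios of kind `T` with boundary vertex
`v_b` and weights in `ws`, on the part of the path in direction `D` from `v_b`, as a function of the
distance from `v_b`.  The scenarios are ordered by the weight of `v_b`. -/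
def halfEnvelope (T : Side) (b : ℕ) (ws : List ℝ) (D : Side) : Timed (Env ℝ) :=
  upperEnvelope (fun w t => N.regret μ (N.pseudo T b w) (place N b D t))
    (outDist N b D) (outLen N b D) (fun w => w) ws

/-- The upper envelope on the left and on the right of `v_b`. -/
def algorithmThree (T : Side) (b : ℕ) (ws : List ℝ) : Timed (Env ℝ × Env ℝ) := do
  let l ← halfEnvelope N μ T b ws Side.L
  let r ← halfEnvelope N μ T b ws Side.R
  op (l, r)

/-- The function on the path that a result of `algorithmThree` describes. -/
def twoSided (T : Side) (b : ℕ) (E : Env ℝ × Env ℝ) (x : ℝ) : ℝ :=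
  if x < N.pos b then N.regret μ (N.pseudo T b (E.1.active (N.pos b - x))) x
  else N.regret μ (N.pseudo T b (E.2.active (x - N.pos b))) x

end PhaseOne

/-! ### Combination of the envelopes of several boundary vertices and kinds -/

section PhaseTwo

variable (N : PathNetwork) (μ : (ℕ → ℝ) → ℝ)

/-- Kind, boundary vertex and its weight: the data that specify a pseudo-bipartite scenario. -/
abbrev Tag : Type := Side × ℕ × ℝ

def tagRegret (z : Tag) (x : ℝ) : ℝ := N.regret μ (N.pseudo z.1 z.2.1 z.2.2) x

/-- For each edge and for each vertex, a list of scenarios. -/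
structure Buckets where
  edge : ℕ → List Tag
  vert : ℕ → List Tag

def Buckets.pushEdge (B : Buckets) (k : ℕ) (z : Tag) : Buckets :=
  ⟨Function.update B.edge k (z :: B.edge k), B.vert⟩

def Buckets.pushVert (B : Buckets) (k : ℕ) (z : Tag) : Buckets :=
  ⟨B.edge, Function.update B.vert k (z :: B.vert k)⟩

/-- Walk along the pieces of `U` (from piece `i`) and the edges in direction `D` from `v_b` (from
the `j`-th), and enter the scenario of each piece at the edges and vertices where it is in force. -/
def walk (T : Side) (b : ℕ) (D : Side) (U : Env ℝ) (i j : ℕ) (B : Buckets) : Timed Buckets :=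
  if hj : outLen N b D ≤ j then op B
  else do
    let B₁ ← op (B.pushEdge (outEdge b D j) (T, b, (U.cell i).2))
    if hi : i + 1 < U.len then do
      let c ← op (decide ((U.cell (i + 1)).1 < outDist N b D (j + 1)))
      if c then walk T b D U (i + 1) j B₁
      else do
        let B₂ ← op (B₁.pushVert (outIdx b D (j + 1)) (T, b, (U.cell i).2))
        walk T b D U i (j + 1) B₂
    else do
      let B₂ ← op (B₁.pushVert (outIdx b D (j + 1)) (T, b, (U.cell i).2))
      walk T b D U i (j + 1) B₂
termination_by (U.len - i) + (outLen N b D - j)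
decreasing_by all_goals omega

def enter (T : Side) (b : ℕ) (D : Side) (U : Env ℝ) (B : Buckets) : Timed Buckets :=
  if U.len = 0 then op B
  else do
    let B₁ ← op (B.pushVert b (T, b, (U.cell 0).2))
    walk N T b D U 0 0 B₁

/-- Run `algorithmThree` on each family and enter the pieces of the results. -/
def collect : List (Side × ℕ × List ℝ) → Buckets → Timed Buckets
  | [], B => op B
  | (T, b, ws) :: rest, B => do
    let E ← algorithmThree N μ T b ws
    let B₁ ← enter N T b Side.L E.1 B
    let B₂ ← enter N T b Side.R E.2 B₁
    collect rest B₂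

structure Line where
  slope : ℝ
  icept : ℝ

instance : Inhabited Line := ⟨⟨0, 0⟩⟩

def Line.value (l : Line) (t : ℝ) : ℝ := l.icept + l.slope * t

/-- The line along which the regret of `z` runs on the (open) edge `e_k`, as a function of the
distance from `v_k`, from its values at two points of the edge. -/
def edgeLine (k : ℕ) (z : Tag) : Line :=
  let y₁ := tagRegret N μ z (N.pos k + N.len k / 3)
  let y₂ := tagRegret N μ z (N.pos k + 2 * N.len k / 3)
  ⟨(y₂ - y₁) / (N.len k / 3), 2 * y₁ - y₂⟩

def edgeLines (k : ℕ) : List Tag → Timed (List Line)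
  | [] => op []
  | z :: rest => do
    let ls ← edgeLines k rest
    op (edgeLine N μ k z :: ls)

/-- The largest regret at `v_k` among the scenarios in a list. -/
def vertexMax (k : ℕ) : List Tag → Timed ℝ
  | [] => op 0
  | [z] => op (tagRegret N μ z (N.pos k))
  | z :: z' :: rest => do
    let y ← vertexMax k (z' :: rest)
    op (max (tagRegret N μ z (N.pos k)) y)

/-- An explicit upper envelope on the path: a sequence of line segments for each edge, and the value
at each vertex. -/
structure Envelope where
  edge : ℕ → Env Line
  vert : ℕ → ℝ

/-- Treat the vertices `v_1, …, v_m` and the edges to the right of them: take the maximum at the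
vertex, and the upper envelope of the lines on the edge, ordered by slope. -/
def finish (B : Buckets) : ℕ → Timed Envelope
  | 0 => op ⟨fun _ => ⟨0, fun _ => (0, default)⟩, fun _ => 0⟩
  | k + 1 => do
    let out ← finish B k
    let y ← vertexMax N μ (k + 1) (B.vert (k + 1))
    let ls ← edgeLines N μ (k + 1) (B.edge (k + 1))
    let E ← upperEnvelope Line.value (fun j => j * N.len (k + 1)) 1 Line.slope ls
    op ⟨Function.update out.edge (k + 1) E, Function.update out.vert (k + 1) y⟩

/-- The upper envelope of all regret functions of the given families. -/
def totalEnvelope (fams : List (Side × ℕ × List ℝ)) : Timed Envelope := do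
  let B ← collect N μ fams ⟨fun _ => [], fun _ => []⟩
  finish N μ B N.n

/-- The explicit envelope `E` is the upper envelope of the regret functions of the scenarios in `A`,
at every vertex and at every inner point of every edge. -/
def Envelope.Describes (E : Envelope) (A : Set (ℕ → ℝ)) : Prop :=
  (∀ k, 1 ≤ k → k ≤ N.n → N.IsMaxRegret μ A (N.pos k) (E.vert k)) ∧
  ∀ k, 1 ≤ k → k < N.n → (E.edge k).Ordered ∧
    ∀ x ∈ Set.Ioo (N.pos k) (N.pos (k + 1)),
      N.IsMaxRegret μ A x (((E.edge k).active (x - N.pos k)).value (x - N.pos k))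

/-- The families of both kinds for one boundary vertex. -/
def familiesAt (crit : Side → ℕ → List ℝ) (b : ℕ) : List (Side × ℕ × List ℝ) :=
  [(Side.L, b, crit Side.L b), (Side.R, b, crit Side.R b)]

/-- The families of both kinds for all boundary vertices. -/
def allFamilies (crit : Side → ℕ → List ℝ) : List (Side × ℕ × List ℝ) :=
  (List.range N.n).flatMap (fun i => familiesAt crit (i + 1))

/-- `crit T b` lists, in any order and without repetition, the critical weights of `v_b` for
scenarios of kind `T`. -/
def IsListing (crit : Side → ℕ → List ℝ) : Prop :=
  ∀ T b, 1 ≤ b → b ≤ N.n → (crit T b).Nodup ∧ ∀ w, w ∈ crit T b ↔ w ∈ N.critWeights T b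

end PhaseTwo

end EvacPath

end

open EvacPath

/-!
Why the bounds hold.

*Cost of one side.* Let `q i` be the distance and `S i` the weight in front of the `i`-th vertex on
one side of the destination.  Vertex `i` is the front of a cluster iff `q i * τ - S i / c`
(`offset`) exceeds all earlier values, so the cost is `∑ w i * max_{j ≤ i} offset j + W² / 2c`
(`sideCost_eq`).  If a further vertex is added in front, then the cost grows by an amount that is
nondecreasing in the weights of the others (`sideCost_tail_mono`).

*Differences of regrets.* Consider two scenarios of the same kind that differ only in the weight of
`v_b`.  Away from `v_b`, the cost of the evacuees from ahead is the same for both, and the previous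
fact, applied at each vertex that is passed, shows that the difference of the regrets does not
decrease with the distance from `v_b`; between vertices it is affine, and it is continuous from the
side of `v_b` (`rising_regret`).  Hence, when the functions are processed by increasing weight of
`v_b`, the set where the next one exceeds the current envelope is an interval that extends to the end
of the path.  This is the invariant of the sweep (`IsEnv.upperEnvelope`), each of whose steps adds at
most one piece and takes two binary searches.

*Number of scenarios.* A vertex that is not the front of a cluster stays so if weights increase
(`front_ne_mono`).  All scenarios of kind `L` with boundary vertex `v_b` have at most the weights of
those with boundary vertex `v_{b+1}`, and conversely for kind `R`.  So, while the critical weights of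
all vertices are passed in this order, a given vertex ceases to be a front among the vertices from
`v_k` on, for a given direction, at most once; there are at most `2 n²` such combinations, and every
critical weight accounts for one of them (`exists_lostAt`, `lostAt_unique`).  There are thus at most
`2 n²` critical weights of each kind, and logarithms of their number are `O(log n)`.

*Combination.* The envelopes of the families have `O(m + n)` pieces for `m` scenarios, which are
distributed to the edges and vertices (`walk_spec`).  On an edge the regrets are lines, and the sweep,
with the slope as the key, produces at most as many segments as there are entries
(`totalEnvelope_describes`, `totalEnvelope_time_le`, `hasSegments_upperEnvelope`).
-/

noncomputable section

namespace EvacPath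

open Finset

/-! ### The cost of one side in terms of running maxima -/

section SideCost

variable {c τ : ℝ} {q w : ℕ → ℝ}

/-- The arrival time of the first evacuee of vertex `i` at the reference point, reduced by the time
that the evacuees of the nearer vertices need to pass.  Vertex `i` is the front of a cluster iff this
number exceeds all earlier ones. -/
def offset (c τ : ℝ) (q w : ℕ → ℝ) (i : ℕ) : ℝ := q i * τ - (∑ m ∈ range i, w m) / c

lemma front_le (i : ℕ) : front c τ q w i ≤ i := by
  induction i with
  | zero => simp [front]
  | succ i ih =>
    rw [front]
    split_ifs <;> omega

lemma le_sum_Icc_iff {u i : ℕ} (hu : u ≤ i) :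
    (q (i + 1) - q u) * τ ≤ (∑ m ∈ Icc u i, w m) / c ↔
      offset c τ q w (i + 1) ≤ offset c τ q w u := by
  have h : ∑ m ∈ range (i + 1), w m = ∑ m ∈ range u, w m + ∑ m ∈ Icc u i, w m := by
    rw [← sum_range_add_sum_Ico w (show u ≤ i + 1 by omega)]
    rfl
  unfold offset
  rw [h, add_div]
  constructor <;> intro h <;> linarith

lemma offset_front (i : ℕ) :
    offset c τ q w (front c τ q w i) = partialSups (offset c τ q w) i := by
  induction i with
  | zero => simp [front]
  | succ i ih =>
    rw [partialSups_add_one, ← ih, front]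
    have h := le_sum_Icc_iff (c := c) (τ := τ) (q := q) (w := w) (front_le (c := c) (τ := τ) (q := q) (w := w) i)
    split_ifs with h1
    · exact (max_eq_left (h.1 h1)).symm
    · exact (max_eq_right (le_of_not_ge fun h2 => h1 (h.2 h2))).symm

/-- A vertex is not the front of a cluster iff it merges into the queue of some nearer vertex. -/
lemma front_succ_ne_iff (i : ℕ) :
    front c τ q w (i + 1) ≠ i + 1 ↔
      ∃ u ≤ i, (q (i + 1) - q u) * τ ≤ (∑ m ∈ Icc u i, w m) / c := by
  have hle := front_le (c := c) (τ := τ) (q := q) (w := w) i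
  rw [front]
  split_ifs with h
  · simp only [ne_eq, show front c τ q w i ≠ i + 1 by omega, not_false_eq_true, true_iff]
    exact ⟨_, hle, h⟩
  · simp only [ne_eq, not_true_eq_false, false_iff, not_exists, not_and]
    intro u hu h2
    apply h
    rw [le_sum_Icc_iff hle]
    rw [le_sum_Icc_iff hu] at h2
    rw [offset_front]
    exact h2.trans (le_partialSups_of_le _ hu)

lemma front_eq_of_between {u i : ℕ} (hu : front c τ q w i = u) :
    ∀ j, u ≤ j → j ≤ i → front c τ q w j = u := by
  induction i with
  | zero =>
    intro j _ hj
    obtain rfl : j = 0 := by omega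
    exact hu
  | succ i ih =>
    intro j h1 h2
    rcases Nat.lt_or_ge i j with h | h
    · obtain rfl : j = i + 1 := by omega
      exact hu
    · rw [front] at hu
      split_ifs at hu with h3
      · exact ih hu j h1 h
      · omega

lemma front_front (i : ℕ) : front c τ q w (front c τ q w i) = front c τ q w i :=
  front_eq_of_between rfl _ le_rfl (front_le i)

lemma clusterWeight_front (m : ℕ) :
    clusterWeight c τ q w m (front c τ q w m) = ∑ i ∈ Ico (front c τ q w m) m, w i := by
  unfold clusterWeight
  congr 1
  ext i
  simp only [mem_filter, mem_range, mem_Ico]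
  constructor
  · rintro ⟨h1, h2⟩
    exact ⟨h2 ▸ front_le i, h1⟩
  · rintro ⟨h1, h2⟩
    exact ⟨h2, front_eq_of_between rfl i h1 h2.le⟩

lemma clusterWeight_succ (m u : ℕ) :
    clusterWeight c τ q w (m + 1) u =
      clusterWeight c τ q w m u + if front c τ q w m = u then w m else 0 := by
  unfold clusterWeight
  rw [range_add_one, filter_insert]
  split_ifs
  · rw [sum_insert (by simp), add_comm]
  · simp

lemma clusterWeight_self (m : ℕ) : clusterWeight c τ q w m m = 0 := by
  unfold clusterWeight
  rw [filter_eq_empty_iff.2, sum_empty]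
  intro i hi h
  have := front_le (c := c) (τ := τ) (q := q) (w := w) i
  rw [mem_range] at hi
  omega

/-- The evacuees of the next vertex join the queue of the last cluster, or form a new one. -/
lemma sideCost_succ (m : ℕ) :
    sideCost c τ q w (m + 1) = sideCost c τ q w m +
      (w m * partialSups (offset c τ q w) m + (2 * (∑ i ∈ range m, w i) * w m + w m ^ 2) / (2 * c)) := by
  set F := front c τ q w m with hF
  have hFm : F ≤ m := front_le m
  have h1 : sideCost c τ q w m = ∑ u ∈ (range (m + 1)).filter (fun u => front c τ q w u = u),
      (q u * clusterWeight c τ q w m u * τ + clusterWeight c τ q w m u ^ 2 / (2 * c)) := by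
    unfold sideCost
    apply sum_subset (filter_subset_filter _ (range_mono (Nat.le_succ m)))
    intro u hu hu'
    simp only [mem_filter, mem_range] at hu hu'
    obtain rfl : u = m := by
      by_contra h
      exact hu' ⟨by omega, hu.2⟩
    simp [clusterWeight_self]
  have h2 : ∀ u, (q u * clusterWeight c τ q w (m + 1) u * τ
        + clusterWeight c τ q w (m + 1) u ^ 2 / (2 * c)) =
      (q u * clusterWeight c τ q w m u * τ + clusterWeight c τ q w m u ^ 2 / (2 * c)) +
      if F = u then (w m * (q F * τ) + (2 * (∑ i ∈ Ico F m, w i) * w m + w m ^ 2) / (2 * c))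
        else 0 := by
    intro u
    rw [clusterWeight_succ]
    split_ifs with h
    · subst h
      rw [clusterWeight_front, ← hF]
      ring
    · simp
  rw [h1]
  conv_lhs => unfold sideCost
  rw [sum_congr rfl (fun u _ => h2 u), sum_add_distrib, sum_ite_eq, if_pos]
  · congr 1
    rw [← offset_front, ← hF, offset, ← sum_range_add_sum_Ico w hFm]
    ring
  · rw [mem_filter, mem_range]
    exact ⟨by omega, front_front m⟩

/-- The cost of one side: every evacuee waits for the running maximum of the offsets, and all of
them pass the destination one after the other. -/
lemma sideCost_eq (m : ℕ) :
    sideCost c τ q w m = ∑ i ∈ range m, w i * partialSups (offset c τ q w) i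
      + (∑ i ∈ range m, w i) ^ 2 / (2 * c) := by
  induction m with
  | zero => simp [sideCost]
  | succ m ih =>
    rw [sideCost_succ, ih, sum_range_succ, sum_range_succ]
    ring

lemma sideCost_congr {w' : ℕ → ℝ} {m : ℕ} (h : ∀ i < m, w i = w' i) :
    sideCost c τ q w m = sideCost c τ q w' m := by
  have h0 : ∀ i < m, offset c τ q w i = offset c τ q w' i := by
    intro i hi
    unfold offset
    rw [sum_congr rfl fun j hj => h j ((mem_range.1 hj).trans hi)]
  have h1 : ∀ i < m, partialSups (offset c τ q w) i = partialSups (offset c τ q w') i := by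
    intro i
    induction i with
    | zero => intro hi; simpa using h0 0 hi
    | succ i ih => intro hi; rw [partialSups_add_one, partialSups_add_one, ih (by omega), h0 _ hi]
  rw [sideCost_eq, sideCost_eq, sum_congr rfl fun j hj => h j (mem_range.1 hj)]
  congr 1
  refine sum_congr rfl fun j hj => ?_
  rw [h j (mem_range.1 hj), h1 j (mem_range.1 hj)]

lemma partialSups_add_const (f : ℕ → ℝ) (a : ℝ) (i : ℕ) :
    partialSups (fun j => f j + a) i = partialSups f i + a := by
  induction i with
  | zero => simp
  | succ i ih => rw [partialSups_add_one, partialSups_add_one, ih, max_add_add_right]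

lemma partialSups_succ_eq_max (f : ℕ → ℝ) (i : ℕ) :
    partialSups f (i + 1) = max (f 0) (partialSups (fun j => f (j + 1)) i) := by
  induction i with
  | zero => rw [partialSups_add_one]; simp
  | succ i ih => rw [partialSups_add_one, ih, partialSups_add_one, max_assoc]

/-- Moving the destination by `t` changes the cost by `t τ` for each unit of weight. -/
lemma sideCost_shift (m : ℕ) (t : ℝ) :
    sideCost c τ (fun i => q i + t) w m = sideCost c τ q w m + (∑ i ∈ range m, w i) * τ * t := by
  have h : offset c τ (fun i => q i + t) w = fun i => offset c τ q w i + t * τ := by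
    funext i
    unfold offset
    ring
  rw [sideCost_eq, sideCost_eq, h]
  simp only [partialSups_add_const, mul_add, sum_add_distrib]
  rw [← sum_mul]
  ring

/-- The extra cost that is caused by the vertex nearest to the destination. -/
lemma sideCost_succ_eq_tail (m : ℕ) :
    sideCost c τ q w (m + 1) =
      sideCost c τ (fun i => q (i + 1)) (fun i => w (i + 1)) m
      + ∑ i ∈ range m, w (i + 1) * max (q 0 * τ + w 0 / c -
          partialSups (offset c τ (fun i => q (i + 1)) (fun i => w (i + 1))) i) 0
      + w 0 * (q 0 * τ) + w 0 ^ 2 / (2 * c) := by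
  have h : (fun i => offset c τ q w (i + 1)) =
      fun i => offset c τ (fun i => q (i + 1)) (fun i => w (i + 1)) i + -(w 0 / c) := by
    funext i
    unfold offset
    rw [sum_range_succ']
    ring
  have h0 : partialSups (offset c τ q w) 0 = q 0 * τ := by simp [offset]
  have h1 : ∀ i, partialSups (offset c τ q w) (i + 1) =
      partialSups (offset c τ (fun i => q (i + 1)) (fun i => w (i + 1))) i - w 0 / c
      + max (q 0 * τ + w 0 / c -
          partialSups (offset c τ (fun i => q (i + 1)) (fun i => w (i + 1))) i) 0 := by
    intro i
    rw [partialSups_succ_eq_max, h, partialSups_add_const, ← max_add_add_left]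
    congr 1
    · simp [offset]
    · ring
  rw [sideCost_eq, sideCost_eq, sum_range_succ', sum_range_succ', h0]
  simp only [h1, mul_add, mul_sub, sum_add_distrib, sum_sub_distrib]
  rw [← sum_mul]
  ring

lemma partialSups_offset_anti (hc : 0 < c) {w' : ℕ → ℝ} {m : ℕ} (h : ∀ i < m, w i ≤ w' i)
    {i : ℕ} (hi : i ≤ m) :
    partialSups (offset c τ q w') i ≤ partialSups (offset c τ q w) i := by
  have h0 : ∀ i ≤ m, offset c τ q w' i ≤ offset c τ q w i := by
    intro i hi
    unfold offset
    have : ∑ j ∈ range i, w j ≤ ∑ j ∈ range i, w' j :=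
      sum_le_sum fun j hj => h j (lt_of_lt_of_le (mem_range.1 hj) hi)
    gcongr
  induction i with
  | zero => simpa using h0 0 hi
  | succ i ih =>
    rw [partialSups_add_one, partialSups_add_one]
    exact max_le_max (ih (by omega)) (h0 _ hi)

/-- The extra cost that is caused by the vertex nearest to the destination grows with the weights of
the other vertices. -/
lemma sideCost_tail_mono (hc : 0 < c) {w' : ℕ → ℝ} {m : ℕ} (h0 : w 0 = w' 0)
    (hw : ∀ i < m, 0 ≤ w (i + 1)) (h : ∀ i < m, w (i + 1) ≤ w' (i + 1)) :
    sideCost c τ (fun i => q (i + 1)) (fun i => w' (i + 1)) m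
        - sideCost c τ (fun i => q (i + 1)) (fun i => w (i + 1)) m ≤
      sideCost c τ q w' (m + 1) - sideCost c τ q w (m + 1) := by
  rw [sideCost_succ_eq_tail (w := w), sideCost_succ_eq_tail (w := w'), ← h0]
  have : ∑ i ∈ range m, w (i + 1) * max (q 0 * τ + w 0 / c -
          partialSups (offset c τ (fun i => q (i + 1)) (fun i => w (i + 1))) i) 0 ≤
      ∑ i ∈ range m, w' (i + 1) * max (q 0 * τ + w 0 / c -
          partialSups (offset c τ (fun i => q (i + 1)) (fun i => w' (i + 1))) i) 0 := by
    refine sum_le_sum fun i hi => ?_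
    rw [mem_range] at hi
    have := partialSups_offset_anti (τ := τ) (q := fun i => q (i + 1)) (w := fun i => w (i + 1))
      (w' := fun i => w' (i + 1)) hc h hi.le
    refine mul_le_mul (h i hi) (max_le_max (by linarith) le_rfl) (le_max_right _ _) ?_
    exact (hw i hi).trans (h i hi)
  linarith

/-- The cost grows with the weight of the vertex nearest to the destination. -/
lemma sideCost_head_mono (hc : 0 < c) (hτ : 0 ≤ τ) {w' : ℕ → ℝ} {m : ℕ} (hq : 0 ≤ q 0)
    (hw0 : 0 ≤ w 0) (h0 : w 0 ≤ w' 0) (hw : ∀ i < m, 0 ≤ w (i + 1))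
    (h : ∀ i < m, w (i + 1) = w' (i + 1)) :
    sideCost c τ q w (m + 1) ≤ sideCost c τ q w' (m + 1) := by
  rw [sideCost_succ_eq_tail (w := w), sideCost_succ_eq_tail (w := w'),
    sideCost_congr (w := fun i => w (i + 1)) (w' := fun i => w' (i + 1)) h]
  have h1 : ∑ i ∈ range m, w (i + 1) * max (q 0 * τ + w 0 / c -
          partialSups (offset c τ (fun i => q (i + 1)) (fun i => w (i + 1))) i) 0 ≤
      ∑ i ∈ range m, w' (i + 1) * max (q 0 * τ + w' 0 / c -
          partialSups (offset c τ (fun i => q (i + 1)) (fun i => w' (i + 1))) i) 0 := by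
    refine sum_le_sum fun i hi => ?_
    rw [mem_range] at hi
    have h2 := partialSups_offset_anti (τ := τ) (q := fun i => q (i + 1))
      (w := fun i => w (i + 1)) (w' := fun i => w' (i + 1)) hc (fun i hi => (h i hi).le) hi.le
    have h3 : w 0 / c ≤ w' 0 / c := by gcongr
    exact mul_le_mul (h i hi).le (max_le_max (by linarith) le_rfl) (le_max_right _ _)
      (h i hi ▸ hw i hi)
  gcongr

end SideCost

end EvacPath

namespace EvacPath

open Finset

/-! ### Positions and numbers of vertices on either side of a point -/

namespace PathNetwork

variable (N : PathNetwork)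

lemma pos_succ {k : ℕ} (hk : 1 ≤ k) : N.pos (k + 1) = N.pos k + N.len k := by
  unfold pos
  rw [sum_Ico_succ_top hk]

lemma pos_lt {i j : ℕ} (hi : 1 ≤ i) (hij : i < j) (hj : j ≤ N.n) : N.pos i < N.pos j := by
  induction j, hij using Nat.le_induction with
  | base => rw [N.pos_succ hi]; linarith [N.len_pos i hi (by omega)]
  | succ j h ih =>
    rw [N.pos_succ (by omega)]
    linarith [N.len_pos j (by omega) (by omega), ih (by omega)]

lemma pos_le {i j : ℕ} (hi : 1 ≤ i) (hij : i ≤ j) (hj : j ≤ N.n) : N.pos i ≤ N.pos j := by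
  rcases hij.eq_or_lt with rfl | h
  · exact le_rfl
  · exact (N.pos_lt hi h hj).le

lemma numLT_eq {k : ℕ} {x : ℝ} (hk : k ≤ N.n) (h1 : 1 ≤ k → N.pos k < x)
    (h2 : k < N.n → x ≤ N.pos (k + 1)) : N.numLT x = k := by
  have : (Icc 1 N.n).filter (fun i => N.pos i < x) = Icc 1 k := by
    ext i
    simp only [mem_filter, mem_Icc]
    constructor
    · rintro ⟨⟨hi, hi'⟩, h⟩
      refine ⟨hi, ?_⟩
      by_contra hki
      have := N.pos_le (show 1 ≤ k + 1 by omega) (show k + 1 ≤ i by omega) hi'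
      linarith [h2 (by omega)]
    · rintro ⟨hi, hi'⟩
      exact ⟨⟨hi, hi'.trans hk⟩, (N.pos_le hi hi' hk).trans_lt (h1 (hi.trans hi'))⟩
  rw [numLT, this, Nat.card_Icc]
  omega

lemma numLE_eq {k : ℕ} {x : ℝ} (hk : k ≤ N.n) (h1 : 1 ≤ k → N.pos k ≤ x)
    (h2 : k < N.n → x < N.pos (k + 1)) : N.numLE x = k := by
  have : (Icc 1 N.n).filter (fun i => N.pos i ≤ x) = Icc 1 k := by
    ext i
    simp only [mem_filter, mem_Icc]
    constructor
    · rintro ⟨⟨hi, hi'⟩, h⟩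
      refine ⟨hi, ?_⟩
      by_contra hki
      have := N.pos_le (show 1 ≤ k + 1 by omega) (show k + 1 ≤ i by omega) hi'
      linarith [h2 (by omega)]
    · rintro ⟨hi, hi'⟩
      exact ⟨⟨hi, hi'.trans hk⟩, (N.pos_le hi hi' hk).trans (h1 (hi.trans hi'))⟩
  rw [numLE, this, Nat.card_Icc]
  omega

/-! ### Costs are affine on the edges -/

lemma costL_eq (s : ℕ → ℝ) (k : ℕ) (x : ℝ) :
    N.costL s k x = N.costL s k 0 + (∑ i ∈ range k, s (k - i)) * N.tau * x := by
  unfold costL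
  rw [← sideCost_shift]
  congr 1
  funext i
  ring

lemma costR_eq (s : ℕ → ℝ) (k : ℕ) (x : ℝ) :
    N.costR s k x =
      N.costR s k 0 - (∑ i ∈ range (N.n + 1 - k), s (k + i)) * N.tau * x := by
  unfold costR
  rw [sub_eq_add_neg, ← mul_neg, ← sideCost_shift]
  congr 1
  funext i
  ring

lemma regret_affine_on_edge (μ : (ℕ → ℝ) → ℝ) (s : ℕ → ℝ) {k : ℕ} (hkn : k < N.n) :
    ∃ α β : ℝ, ∀ x ∈ Set.Ioo (N.pos k) (N.pos (k + 1)), N.regret μ s x = α * x + β := by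
  refine ⟨(∑ i ∈ range k, s (k - i)) * N.tau -
      (∑ i ∈ range (N.n + 1 - (k + 1)), s (k + 1 + i)) * N.tau,
    N.costL s k 0 + N.costR s (k + 1) 0 - N.cost s (μ s), ?_⟩
  intro x hx
  unfold regret
  conv_lhs => enter [1]; unfold cost
  rw [N.numLT_eq hkn.le (fun _ => hx.1) (fun _ => hx.2.le),
    N.numLE_eq hkn.le (fun _ => hx.1.le) (fun _ => hx.2), costL_eq, costR_eq]
  ring

/-! ### Pseudo-bipartite scenarios that differ in the weight of the boundary vertex -/

variable {N} {T : Side} {b : ℕ} {w w' : ℝ}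

lemma pseudo_nonneg (hw : 0 ≤ w) (i : ℕ) : 0 ≤ N.pseudo T b w i := by
  unfold pseudo
  by_cases h1 : 1 ≤ i ∧ i ≤ N.n
  · have h3 := (N.wlo_pos i h1.1 h1.2).le
    have h4 := h3.trans (N.wlo_le_whi i h1.1 h1.2)
    cases T <;> simp only <;> split_ifs <;> assumption
  · rw [if_neg h1]

lemma pseudo_of_ne {i : ℕ} (hi : i ≠ b) : N.pseudo T b w i = N.pseudo T b w' i := by
  unfold pseudo
  simp [hi]

lemma pseudo_self (hb : 1 ≤ b) (hbn : b ≤ N.n) : N.pseudo T b w b = w := by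
  simp [pseudo, hb, hbn]

lemma pseudo_mono (h : w ≤ w') (i : ℕ) : N.pseudo T b w i ≤ N.pseudo T b w' i := by
  by_cases hi : i = b
  · unfold pseudo
    split_ifs <;> first | exact h | exact le_rfl
  · exact (pseudo_of_ne hi).le

variable (N T b w w') in
/-- Difference of the costs, at the point at distance `t` from `v_b` in direction `D`, of those
vertices that the two scenarios may treat differently, if the point is on the `j`-th edge from
`v_b`. -/
def outDiff (D : Side) (j : ℕ) (t : ℝ) : ℝ :=
  match D with
  | Side.L => N.costR (N.pseudo T b w') (b - j) (N.pos b - t)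
      - N.costR (N.pseudo T b w) (b - j) (N.pos b - t)
  | Side.R => N.costL (N.pseudo T b w') (b + j) (N.pos b + t)
      - N.costL (N.pseudo T b w) (b + j) (N.pos b + t)

lemma outDiff_affine (hw : w ≤ w') (D : Side) (j : ℕ) :
    ∃ α β : ℝ, 0 ≤ α ∧ ∀ t, outDiff N T b w w' D j t = α * t + β := by
  cases D with
  | L =>
    refine ⟨(∑ i ∈ range (N.n + 1 - (b - j)), N.pseudo T b w' (b - j + i)) * N.tau -
      (∑ i ∈ range (N.n + 1 - (b - j)), N.pseudo T b w (b - j + i)) * N.tau,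
      outDiff N T b w w' Side.L j 0, ?_, ?_⟩
    · rw [← sub_mul]
      refine mul_nonneg (sub_nonneg.2 (sum_le_sum fun i _ => pseudo_mono hw _)) N.tau_pos.le
    · intro t
      simp only [outDiff]
      rw [costR_eq, costR_eq N _ _ (N.pos b - t), costR_eq N _ _ (N.pos b - 0),
        costR_eq N _ _ (N.pos b - 0)]
      ring
  | R =>
    refine ⟨(∑ i ∈ range (b + j), N.pseudo T b w' (b + j - i)) * N.tau -
      (∑ i ∈ range (b + j), N.pseudo T b w (b + j - i)) * N.tau,
      outDiff N T b w w' Side.R j 0, ?_, ?_⟩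
    · rw [← sub_mul]
      refine mul_nonneg (sub_nonneg.2 (sum_le_sum fun i _ => pseudo_mono hw _)) N.tau_pos.le
    · intro t
      simp only [outDiff]
      rw [costL_eq, costL_eq N _ _ (N.pos b + t), costL_eq N _ _ (N.pos b + 0),
        costL_eq N _ _ (N.pos b + 0)]
      ring

lemma outDiff_succ (hw0 : 0 ≤ w) (hw : w ≤ w') (hb : 1 ≤ b) (hbn : b ≤ N.n) (D : Side) {j : ℕ}
    (hj : j + 1 < outLen N b D) (t : ℝ) :
    outDiff N T b w w' D j t ≤ outDiff N T b w w' D (j + 1) t := by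
  cases D with
  | L =>
    simp only [outLen] at hj
    simp only [outDiff, costR]
    obtain ⟨k, hk⟩ : ∃ k, b - (j + 1) = k := ⟨_, rfl⟩
    obtain ⟨m, hm⟩ : ∃ m, N.n + 1 - (b - j) = m := ⟨_, rfl⟩
    have h := sideCost_tail_mono (c := N.cap) (τ := N.tau) (m := m)
      (q := fun i => N.pos (k + i) - (N.pos b - t))
      (w := fun i => N.pseudo T b w (k + i)) (w' := fun i => N.pseudo T b w' (k + i)) N.cap_pos
      (pseudo_of_ne (by omega)) (fun _ _ => pseudo_nonneg hw0 _) (fun _ _ => pseudo_mono hw _)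
    rw [hk, hm, show N.n + 1 - k = m + 1 by omega, show b - j = k + 1 by omega]
    simpa only [add_assoc, add_comm 1] using h
  | R =>
    simp only [outLen] at hj
    simp only [outDiff, costL]
    have h := sideCost_tail_mono (c := N.cap) (τ := N.tau) (m := b + j)
      (q := fun i => N.pos b + t - N.pos (b + j + 1 - i))
      (w := fun i => N.pseudo T b w (b + j + 1 - i))
      (w' := fun i => N.pseudo T b w' (b + j + 1 - i)) N.cap_pos
      (pseudo_of_ne (by omega)) (fun _ _ => pseudo_nonneg hw0 _) (fun _ _ => pseudo_mono hw _)
    simp only [Nat.add_sub_add_right] at h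
    exact h

lemma outDiff_zero_nonneg (hw0 : 0 ≤ w) (hw : w ≤ w') (hb : 1 ≤ b) (hbn : b ≤ N.n) (D : Side)
    {t : ℝ} (ht : 0 ≤ t) : 0 ≤ outDiff N T b w w' D 0 t := by
  cases D with
  | L =>
    simp only [outDiff, costR, sub_nonneg]
    rw [show N.n + 1 - (b - 0) = (N.n - b) + 1 by omega]
    apply sideCost_head_mono N.cap_pos N.tau_pos.le
    · simp [ht]
    · exact pseudo_nonneg hw0 _
    · exact pseudo_mono hw _
    · exact fun _ _ => pseudo_nonneg hw0 _
    · exact fun _ _ => pseudo_of_ne (by omega)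
  | R =>
    simp only [outDiff, costL, sub_nonneg]
    rw [show b + 0 = (b - 1) + 1 by omega]
    apply sideCost_head_mono N.cap_pos N.tau_pos.le
    · simp [ht, Nat.sub_add_cancel hb]
    · exact pseudo_nonneg hw0 _
    · exact pseudo_mono hw _
    · exact fun _ _ => pseudo_nonneg hw0 _
    · exact fun _ _ => pseudo_of_ne (by omega)

lemma outDist_zero (N : PathNetwork) (b : ℕ) (D : Side) : outDist N b D 0 = 0 := by
  cases D <;> simp [outDist, outIdx]

lemma outDist_L (hbn : b ≤ N.n) {j : ℕ} (hj : j < b) :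
    outDist N b Side.L j = N.pos b - N.pos (b - j) := by
  simp only [outDist, outIdx]
  rw [abs_sub_comm, abs_of_nonneg]
  linarith [N.pos_le (show 1 ≤ b - j by omega) (show b - j ≤ b by omega) hbn]

lemma outDist_R (hb : 1 ≤ b) {j : ℕ} (hj : b + j ≤ N.n) :
    outDist N b Side.R j = N.pos (b + j) - N.pos b := by
  simp only [outDist, outIdx]
  rw [abs_of_nonneg]
  linarith [N.pos_le hb (show b ≤ b + j by omega) hj]

lemma outDist_lt (hb : 1 ≤ b) (hbn : b ≤ N.n) (D : Side) {j : ℕ} (hj : j < outLen N b D) :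
    outDist N b D j < outDist N b D (j + 1) := by
  cases D with
  | L =>
    simp only [outLen] at hj
    rw [outDist_L hbn (by omega), outDist_L hbn (by omega)]
    linarith [N.pos_lt (show 1 ≤ b - (j + 1) by omega) (show b - (j + 1) < b - j by omega)
      (by omega)]
  | R =>
    simp only [outLen] at hj
    rw [outDist_R hb (by omega), outDist_R hb (by omega)]
    linarith [N.pos_lt (show 1 ≤ b + j by omega) (show b + j < b + (j + 1) by omega) (by omega)]

lemma costL_pseudo_of_lt {k : ℕ} (hk : k < b) (x : ℝ) :
    N.costL (N.pseudo T b w) k x = N.costL (N.pseudo T b w') k x :=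
  sideCost_congr fun _ _ => pseudo_of_ne (by omega)

lemma costR_pseudo_of_lt {k : ℕ} (hk : b < k) (x : ℝ) :
    N.costR (N.pseudo T b w) k x = N.costR (N.pseudo T b w') k x :=
  sideCost_congr fun _ _ => pseudo_of_ne (by omega)

lemma cost_pseudo_at (hb : 1 ≤ b) (hbn : b ≤ N.n) :
    N.cost (N.pseudo T b w') (N.pos b) = N.cost (N.pseudo T b w) (N.pos b) := by
  have h1 : N.numLT (N.pos b) = b - 1 := by
    refine N.numLT_eq (by omega) (fun h => N.pos_lt h (by omega) hbn) fun _ => ?_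
    rw [Nat.sub_add_cancel hb]
  have h2 : N.numLE (N.pos b) = b :=
    N.numLE_eq hbn (fun _ => le_rfl) fun h => N.pos_lt hb (by omega) (by omega)
  rw [cost, cost, h1, h2, costL_pseudo_of_lt (w' := w) (by omega),
    costR_pseudo_of_lt (w' := w) (by omega)]

lemma cost_sub_eq_outDiff (hb : 1 ≤ b) (hbn : b ≤ N.n) (D : Side) {j : ℕ}
    (hj : j < outLen N b D) {t : ℝ}
    (ht : t ∈ Set.Ioc (outDist N b D j) (outDist N b D (j + 1))) :
    N.cost (N.pseudo T b w') (place N b D t) - N.cost (N.pseudo T b w) (place N b D t) =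
      outDiff N T b w w' D j t := by
  cases D with
  | L =>
    simp only [outLen] at hj
    rw [outDist_L hbn (by omega), outDist_L hbn (by omega)] at ht
    simp only [place, outDiff]
    set x := N.pos b - t
    have hx1 : N.pos (b - (j + 1)) ≤ x := by simp only [x]; linarith [ht.2]
    have hx2 : x < N.pos (b - j) := by simp only [x]; linarith [ht.1]
    have h2 : N.numLE x = b - (j + 1) := by
      refine N.numLE_eq (by omega) (fun _ => hx1) fun _ => ?_
      rwa [show b - (j + 1) + 1 = b - j by omega]
    have h1 : N.numLT x < b := by
      have : N.numLT x ≤ N.numLE x :=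
        card_le_card (monotone_filter_right _ fun _ _ h => le_of_lt h)
      omega
    rw [cost, cost, h2, costL_pseudo_of_lt (w' := w) h1,
      show b - (j + 1) + 1 = b - j by omega]
    ring
  | R =>
    simp only [outLen] at hj
    rw [outDist_R hb (by omega), outDist_R hb (by omega)] at ht
    simp only [place, outDiff]
    set x := N.pos b + t
    have hx1 : N.pos (b + j) < x := by simp only [x]; linarith [ht.1]
    have hx2 : x ≤ N.pos (b + j + 1) := by
      simp only [x]; rw [add_assoc]; linarith [ht.2]
    have h2 : N.numLT x = b + j := N.numLT_eq (by omega) (fun _ => hx1) fun _ => hx2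
    have h1 : b < N.numLE x + 1 := by
      have : N.numLT x ≤ N.numLE x :=
        card_le_card (monotone_filter_right _ fun _ _ h => le_of_lt h)
      omega
    rw [cost, cost, h2, costR_pseudo_of_lt (w' := w) h1]
    ring

end PathNetwork

/-! ### Rising differences -/

/-- `δ` is nondecreasing on `[p 0, p M]`, and affine and continuous from the left on the half-open
intervals between successive division points. -/
structure Rising (p : ℕ → ℝ) (M : ℕ) (δ : ℝ → ℝ) : Prop where
  mono : MonotoneOn δ (Set.Icc (p 0) (p M))
  affine : ∀ j < M, ∃ α β : ℝ, ∀ t ∈ Set.Ioc (p j) (p (j + 1)), δ t = α * t + β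

lemma exists_mem_Ioc_succ {p : ℕ → ℝ} {M : ℕ} {t : ℝ} (h0 : p 0 < t) (hM : t ≤ p M) :
    ∃ j < M, t ∈ Set.Ioc (p j) (p (j + 1)) := by
  induction M with
  | zero => linarith
  | succ M ih =>
    rcases le_or_gt t (p M) with h | h
    · obtain ⟨j, hj, hj'⟩ := ih h
      exact ⟨j, by omega, hj'⟩
    · exact ⟨M, by omega, h, hM⟩

lemma le_of_succ_lt {p : ℕ → ℝ} {M : ℕ} (hp : ∀ j < M, p j < p (j + 1)) {i j : ℕ} (hij : i ≤ j)
    (hj : j ≤ M) : p i ≤ p j := by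
  induction j, hij using Nat.le_induction with
  | base => exact le_rfl
  | succ j h ih => exact (ih (by omega)).trans (hp j (by omega)).le

/-- A function that follows nondecreasing affine functions `Δ 0 ≤ Δ 1 ≤ …` on successive intervals is
rising. -/
lemma Rising.of_pieces {p : ℕ → ℝ} {M : ℕ} {δ : ℝ → ℝ} {Δ : ℕ → ℝ → ℝ}
    (hp : ∀ j < M, p j < p (j + 1)) (h0 : ∀ t, p 0 ≤ t → δ (p 0) ≤ Δ 0 t)
    (hΔ : ∀ j, j + 1 < M → ∀ t, Δ j t ≤ Δ (j + 1) t)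
    (haff : ∀ j, ∃ α β : ℝ, 0 ≤ α ∧ ∀ t, Δ j t = α * t + β)
    (hδ : ∀ j < M, ∀ t ∈ Set.Ioc (p j) (p (j + 1)), δ t = Δ j t) : Rising p M δ := by
  have hle : ∀ i j, i ≤ j → j < M → ∀ t, Δ i t ≤ Δ j t := by
    intro i j hij
    induction j, hij using Nat.le_induction with
    | base => exact fun _ _ => le_rfl
    | succ j h ih => exact fun hj t => (ih (by omega) t).trans (hΔ j hj t)
  have hmono : ∀ j, Monotone (Δ j) := by
    intro j s t hst
    obtain ⟨α, β, hα, h⟩ := haff j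
    rw [h, h]
    gcongr
  constructor
  · intro s hs t ht hst
    rcases hst.eq_or_lt with rfl | hst'
    · exact le_rfl
    obtain ⟨j, hj, htj⟩ := exists_mem_Ioc_succ (hs.1.trans_lt hst') ht.2
    rw [hδ j hj t htj]
    rcases hs.1.eq_or_lt with h | h
    · rw [← h]
      exact (h0 t ht.1).trans (hle 0 j (by omega) hj t)
    · obtain ⟨i, hi, hsi⟩ := exists_mem_Ioc_succ h hs.2
      rw [hδ i hi s hsi]
      have hij : i ≤ j := by
        by_contra hij
        have := le_of_succ_lt hp (show j + 1 ≤ i by omega) (by omega)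
        linarith [hsi.1, htj.2]
      exact (hle i j hij hj s).trans (hmono j hst)
  · intro j hj
    obtain ⟨α, β, _, h⟩ := haff j
    exact ⟨α, β, fun t ht => by rw [hδ j hj t ht, h]⟩

open PathNetwork in
/-- Away from the boundary vertex, the regret grows faster if the boundary vertex has more weight:
all of its evacuees come from behind, and they delay those who join them. -/
lemma rising_regret {N : PathNetwork} (μ : (ℕ → ℝ) → ℝ) {T : Side} {b : ℕ} {w w' : ℝ}
    (hw0 : 0 ≤ w) (hw : w ≤ w') (hb : 1 ≤ b) (hbn : b ≤ N.n) (D : Side) :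
    Rising (outDist N b D) (outLen N b D) (fun t =>
      N.regret μ (N.pseudo T b w') (place N b D t)
        - N.regret μ (N.pseudo T b w) (place N b D t)) := by
  set κ := N.cost (N.pseudo T b w) (μ (N.pseudo T b w))
    - N.cost (N.pseudo T b w') (μ (N.pseudo T b w'))
  refine Rising.of_pieces (Δ := fun j t => outDiff N T b w w' D j t + κ)
    (fun j hj => outDist_lt hb hbn D hj) ?_ ?_ ?_ ?_
  · intro t ht
    rw [outDist_zero] at ht ⊢
    have h1 : place N b D 0 = N.pos b := by cases D <;> simp [place]
    have h2 := outDiff_zero_nonneg (T := T) hw0 hw hb hbn D ht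
    simp only [h1, regret, cost_pseudo_at (w' := w') (w := w) (T := T) hb hbn, κ]
    linarith
  · intro j hj t
    have := outDiff_succ (T := T) hw0 hw hb hbn D hj t
    linarith
  · intro j
    obtain ⟨α, β, hα, h⟩ := outDiff_affine (N := N) (T := T) (b := b) hw D j
    exact ⟨α, β + κ, hα, fun t => by simp only [h]; ring⟩
  · intro j hj t ht
    simp only [← cost_sub_eq_outDiff (T := T) (w := w) (w' := w') hb hbn D hj ht, regret, κ]
    ring

end EvacPath

namespace EvacPath

open Finset

/-! ### The number of critical weights -/

section Fronts

variable {c τ : ℝ} {q w : ℕ → ℝ}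

lemma front_ne_front_iff {i j : ℕ} (hij : i < j) :
    front c τ q w i ≠ front c τ q w j ↔ ∃ k, i < k ∧ k ≤ j ∧ front c τ q w k = k := by
  constructor
  · intro h
    refine ⟨front c τ q w j, ?_, front_le j, front_front j⟩
    by_contra h'
    exact h (front_eq_of_between rfl i (not_lt.1 h') hij.le)
  · rintro ⟨k, hik, hkj, hk⟩ h
    have h1 := front_le (c := c) (τ := τ) (q := q) (w := w) i
    have h2 := front_eq_of_between h.symm k (by omega) hkj
    omega

/-- If more evacuees start, then no vertex becomes the front of a cluster. -/
lemma front_ne_mono (hc : 0 < c) {w' : ℕ → ℝ} (hw : ∀ i, w i ≤ w' i) {i : ℕ}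
    (h : front c τ q w i ≠ i) : front c τ q w' i ≠ i := by
  cases i with
  | zero => exact absurd rfl h
  | succ i =>
    rw [front_succ_ne_iff] at h ⊢
    obtain ⟨u, hu, h⟩ := h
    refine ⟨u, hu, h.trans ?_⟩
    gcongr
    exact hw _

/-- If two clusters merge at weight `w`, then there is a single vertex that is the front of a
cluster up to `w` and not any more at `w`. -/
lemma exists_lost_front {F : ℝ → ℕ → ℕ} {lo w : ℝ} (hlo : lo < w) {i j : ℕ}
    (hF : ∀ v v', v ≤ v' → ∀ k, F v k ≠ k → F v' k ≠ k)
    (hne : ∀ v, lo ≤ v → v < w → ∃ k, i < k ∧ k ≤ j ∧ F v k = k)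
    (heq : ¬ ∃ k, i < k ∧ k ≤ j ∧ F w k = k) :
    ∃ k ≤ j, (∀ v, lo ≤ v → v < w → F v k = k) ∧ F w k ≠ k := by
  by_contra! h
  have h1 : ∀ k ∈ Ioc i j, ∃ v, lo ≤ v ∧ v < w ∧ F v k ≠ k := by
    intro k hk
    rw [mem_Ioc] at hk
    by_contra! h2
    exact heq ⟨k, hk.1, hk.2, h k hk.2 h2⟩
  choose! f hf1 hf2 hf3 using h1
  have hne' : (Ioc i j).Nonempty := by
    obtain ⟨k, h1, h2, -⟩ := hne lo le_rfl hlo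
    exact ⟨k, mem_Ioc.2 ⟨h1, h2⟩⟩
  obtain ⟨m, hm, hm'⟩ := exists_max_image (Ioc i j) f hne'
  obtain ⟨k, h1, h2, h3⟩ := hne (f m) (hf1 m hm) (hf2 m hm)
  have hk := mem_Ioc.2 ⟨h1, h2⟩
  exact hF _ _ (hm' k hk) k (hf3 k hk) h3

end Fronts

namespace PathNetwork

variable {N : PathNetwork} {T : Side} {b : ℕ} {w : ℝ}

/-- Number of the front vertex of the cluster of the `i`-th vertex, both counted from `v_k`; the
evacuees move to the left if `fromRight` is true, and to the right otherwise. -/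
def frontFrom (N : PathNetwork) (fromRight : Bool) (s : ℕ → ℝ) (k i : ℕ) : ℕ :=
  if fromRight then
    front N.cap N.tau (fun i => N.pos (k + i) - N.pos k) (fun i => s (k + i)) i
  else
    front N.cap N.tau (fun i => N.pos k - N.pos (k - i)) (fun i => s (k - i)) i

lemma frontFrom_ne_mono {D : Bool} {s s' : ℕ → ℝ} (hs : ∀ i, s i ≤ s' i) {k i : ℕ}
    (h : N.frontFrom D s k i ≠ i) : N.frontFrom D s' k i ≠ i := by
  cases D
  · exact front_ne_mono N.cap_pos (fun i => hs (k - i)) h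
  · exact front_ne_mono N.cap_pos (fun i => hs (k + i)) h

/-- `v_i` (counted from `v_k`) ceases to be a front when the weight of `v_b` reaches `w`. -/
def LostAt (N : PathNetwork) (T : Side) (b : ℕ) (w : ℝ) (z : Bool × ℕ × ℕ) : Prop :=
  (∀ v, N.wlo b ≤ v → v < w → N.frontFrom z.1 (N.pseudo T b v) z.2.1 z.2.2 = z.2.2) ∧
    N.frontFrom z.1 (N.pseudo T b w) z.2.1 z.2.2 ≠ z.2.2

/-- Two clusters that merge at `w` contain a front that is lost at `w`. -/
lemma exists_lostAt (hw : w ∈ N.critWeights T b) :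
    ∃ z ∈ (univ : Finset Bool) ×ˢ Icc 1 N.n ×ˢ range N.n, N.LostAt T b w z := by
  have key : ∀ D k i j, 1 ≤ k → k ≤ N.n → i < j → j < N.n →
      (∀ v, N.wlo b ≤ v → v < w →
        N.frontFrom D (N.pseudo T b v) k i ≠ N.frontFrom D (N.pseudo T b v) k j) →
      N.frontFrom D (N.pseudo T b w) k i = N.frontFrom D (N.pseudo T b w) k j →
      ∃ z ∈ (univ : Finset Bool) ×ˢ Icc 1 N.n ×ˢ range N.n, N.LostAt T b w z := by
    intro D k i j hk hkn hij hj h1 h2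
    have h3 : ∀ s, N.frontFrom D s k i ≠ N.frontFrom D s k j ↔
        ∃ m, i < m ∧ m ≤ j ∧ N.frontFrom D s k m = m := by
      intro s
      cases D
      · exact front_ne_front_iff hij
      · exact front_ne_front_iff hij
    obtain ⟨m, hm, h4, h5⟩ := exists_lost_front (F := fun v => N.frontFrom D (N.pseudo T b v) k)
      hw.1 (fun v v' hv k h => frontFrom_ne_mono (pseudo_mono hv) h)
      (fun v hv hv' => (h3 _).1 (h1 v hv hv')) (fun h => (h3 _).2 h h2)
    refine ⟨(D, k, m), ?_, h4, h5⟩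
    simp only [mem_product, mem_univ, mem_Icc, mem_range, true_and]
    omega
  obtain ⟨-, -, ⟨k, i, j, h1, h2, h3, h4, h5, h6⟩ | ⟨k, i, j, h1, h2, h3, h4, h5, h6⟩⟩ := hw
  · refine key true k (i - k) (j - k) (by omega) (by omega) (by omega) (by omega) ?_ ?_
    · intro v hv hv' h
      refine h5 v hv hv' ?_
      simp only [frontFrom, if_true] at h
      simp only [frontR, h]
    · simp only [frontFrom, if_true]
      simp only [frontR] at h6
      omega
  · have h7 : ∀ s, N.frontL s k i = N.frontL s k j ↔
        N.frontFrom false s k (k - j) = N.frontFrom false s k (k - i) := by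
      intro s
      simp only [frontFrom, frontL, Bool.false_eq_true, if_false]
      have h8 := front_le (c := N.cap) (τ := N.tau) (q := fun i => N.pos k - N.pos (k - i))
        (w := fun i => s (k - i)) (k - i)
      have h9 := front_le (c := N.cap) (τ := N.tau) (q := fun i => N.pos k - N.pos (k - i))
        (w := fun i => s (k - i)) (k - j)
      omega
    refine key false k (k - j) (k - i) (by omega) (by omega) (by omega) (by omega) ?_ ?_
    · exact fun v hv hv' h => h5 v hv hv' ((h7 _).2 h)
    · exact (h7 _).1 h6

/-- The order of the boundary vertices along which the weights of the scenarios of kind `T`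
increase. -/
def Precedes (T : Side) (b b' : ℕ) : Prop :=
  match T with
  | Side.L => b < b'
  | Side.R => b' < b

lemma pseudo_le_of_precedes {b b' : ℕ} {w w' : ℝ} (hw : w ≤ N.whi b) (hw' : N.wlo b' ≤ w')
    (h : Precedes T b b') (i : ℕ) : N.pseudo T b w i ≤ N.pseudo T b' w' i := by
  unfold pseudo
  unfold Precedes at h
  by_cases hi : 1 ≤ i ∧ i ≤ N.n
  · have h1 := N.wlo_le_whi i hi.1 hi.2
    rw [if_pos hi, if_pos hi]
    cases T <;> simp only at h ⊢ <;> split_ifs <;> try omega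
    all_goals first | exact le_rfl | subst i
    all_goals assumption
  · rw [if_neg hi, if_neg hi]

/-- No vertex ceases to be a front twice: for kind `L`, all scenarios with boundary vertex `v_b` have
at most the weights of those with boundary vertex `v_{b + 1}`, and conversely for kind `R`. -/
lemma lostAt_unique {b b' : ℕ} {w w' : ℝ} {z : Bool × ℕ × ℕ} (hw : w ∈ N.critWeights T b)
    (hw' : w' ∈ N.critWeights T b') (h : N.LostAt T b w z) (h' : N.LostAt T b' w' z) :
    b = b' ∧ w = w' := by
  have key : ∀ {b b' : ℕ} {w w' : ℝ}, w ∈ N.critWeights T b → w' ∈ N.critWeights T b' →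
      N.LostAt T b w z → N.LostAt T b' w' z → ¬ Precedes T b b' := by
    intro b b' w w' hw hw' h h' hlt
    exact frontFrom_ne_mono (pseudo_le_of_precedes hw.2.1 le_rfl hlt) h.2
      (h'.1 _ le_rfl hw'.1)
  have hb : b = b' := by
    have h1 := key hw hw' h h'
    have h2 := key hw' hw h' h
    cases T <;> simp only [Precedes] at h1 h2 <;> omega
  subst hb
  refine ⟨rfl, ?_⟩
  rcases lt_trichotomy w w' with h1 | h1 | h1
  · exact absurd (h'.1 w hw.1.le h1) h.2
  · exact h1
  · exact absurd (h.1 w' hw'.1.le h1) h'.2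

lemma critPairs_finite_and_ncard_le (N : PathNetwork) (T : Side) :
    {z : ℕ × ℝ | z.2 ∈ N.critWeights T z.1}.Finite ∧
      {z : ℕ × ℝ | z.2 ∈ N.critWeights T z.1}.ncard ≤ 2 * N.n ^ 2 := by
  set S := {z : ℕ × ℝ | z.2 ∈ N.critWeights T z.1}
  have h : ∀ z ∈ S, ∃ y ∈ (univ : Finset Bool) ×ˢ Icc 1 N.n ×ˢ range N.n, N.LostAt T z.1 z.2 y :=
    fun z hz => exists_lostAt hz
  choose! f hf1 hf2 using h
  have hinj : Set.InjOn f S := by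
    intro x hx y hy hxy
    have := lostAt_unique hx hy (hf2 x hx) (hxy ▸ hf2 y hy)
    exact Prod.ext this.1 this.2
  refine ⟨Set.Finite.of_injOn (t := ↑((univ : Finset Bool) ×ˢ Icc 1 N.n ×ˢ range N.n))
    (fun x hx => hf1 x hx) hinj (finite_toSet _), ?_⟩
  have := Set.ncard_le_ncard_of_injOn (t := ↑((univ : Finset Bool) ×ˢ Icc 1 N.n ×ˢ range N.n)) f
    (fun x hx => hf1 x hx) hinj (finite_toSet _)
  rw [Set.ncard_coe_finset] at this
  simpa [pow_two] using this

lemma critWeights_finite (N : PathNetwork) (T : Side) (b : ℕ) : (N.critWeights T b).Finite := by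
  refine Set.Finite.of_injOn (f := fun w => (b, w)) (t := {z : ℕ × ℝ | z.2 ∈ N.critWeights T z.1})
    (fun w hw => hw) (fun x _ y _ h => ?_) (N.critPairs_finite_and_ncard_le T).1
  simpa using h

lemma star_finite (N : PathNetwork) : N.star.Finite := by
  have h : N.star ⊆ ⋃ b ∈ Icc 1 N.n, N.starAt b := by
    rintro s ⟨b, h1, h2, h3⟩
    simp only [Set.mem_iUnion]
    exact ⟨b, mem_Icc.2 ⟨h1, h2⟩, h3⟩
  refine Set.Finite.subset (Set.Finite.biUnion (finite_toSet _) fun b _ => ?_) h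
  exact ((N.critWeights_finite _ _).image _).union ((N.critWeights_finite _ _).image _)

/-- The number of critical weights is quadratic in total; a single vertex may account for a fixed
fraction of this bound. -/
lemma sum_length_crit_le {crit : Side → ℕ → List ℝ} (hcrit : IsListing N crit) (T : Side) :
    ∑ b ∈ Icc 1 N.n, (crit T b).length ≤ 2 * N.n ^ 2 := by
  obtain ⟨h1, h2⟩ := N.critPairs_finite_and_ncard_le T
  refine le_trans ?_ h2
  have h3 : ∀ b ∈ Icc 1 N.n, (crit T b).length = (crit T b).toFinset.card := fun b hb =>
    (List.toFinset_card_of_nodup (hcrit T b (mem_Icc.1 hb).1 (mem_Icc.1 hb).2).1).symm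
  rw [sum_congr rfl h3, ← card_sigma]
  rw [← Set.ncard_coe_finset]
  refine Set.ncard_le_ncard_of_injOn (fun z => (z.1, z.2)) ?_ ?_ h1
  · rintro ⟨b, w⟩ hz
    simp only [coe_sigma, Set.mem_sigma_iff, mem_coe, mem_Icc, List.mem_toFinset] at hz
    exact ((hcrit T b hz.1.1 hz.1.2).2 w).1 hz.2
  · rintro ⟨b, w⟩ _ ⟨b', w'⟩ _ h
    simp only [Prod.mk.injEq] at h
    obtain ⟨rfl, rfl⟩ := h
    rfl

lemma ncard_starOf {crit : Side → ℕ → List ℝ} (hcrit : IsListing N crit) (T : Side) {b : ℕ}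
    (hb : 1 ≤ b) (hbn : b ≤ N.n) : (N.starOf T b).ncard = (crit T b).length := by
  have h1 : N.critWeights T b = ↑(crit T b).toFinset := by
    ext w
    simp [(hcrit T b hb hbn).2 w]
  rw [starOf, Set.ncard_image_of_injective, h1, Set.ncard_coe_finset,
    List.toFinset_card_of_nodup (hcrit T b hb hbn).1]
  intro w w' h
  have := congrFun h b
  rwa [pseudo_self hb hbn, pseudo_self hb hbn] at this

end PathNetwork

end EvacPath

namespace EvacPath

/-! ### Step counts and sorting -/

section TimedLemmas

variable {α β : Type}

@[simp] lemma val_bind (x : Timed α) (f : α → Timed β) : (x >>= f).val = (f x.val).val := rfl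

@[simp] lemma time_bind (x : Timed α) (f : α → Timed β) :
    (x >>= f).time = x.time + (f x.val).time := rfl

-- The proof is not `rfl`: `simp` would then rewrite by definitional unfolding, which leaves the
-- decidability instances of later comparisons behind.
@[simp] lemma val_op (a : α) : (op a).val = a := by rw [op]

@[simp] lemma time_op (a : α) : (op a).time = 1 := by rw [op]

@[simp] lemma time_charge (k : ℕ) : (charge k).time = k := by rw [charge]

end TimedLemmas

lemma clog_two_half {m : ℕ} (hm : 2 ≤ m) : Nat.clog 2 m = Nat.clog 2 (m - m / 2) + 1 := by
  rw [Nat.clog_of_two_le one_lt_two hm]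
  congr 2
  omega

section Sorting

variable {ι : Type} (key : ι → ℝ)

lemma merge_perm (xs ys : List ι) : (merge key xs ys).val.Perm (xs ++ ys) := by
  induction xs, ys using merge.induct with
  | case1 ys => simp [merge]
  | case2 x xs => simp [merge]
  | case3 x xs y ys ih1 ih2 =>
    rw [merge]
    simp only [val_bind, val_op, decide_eq_true_eq]
    split_ifs
    · simp only [val_bind, val_op, List.cons_append]
      exact ih1.cons x
    · simp only [val_bind, val_op]
      exact (ih2.cons y).trans List.perm_middle.symm

lemma merge_sorted (xs ys : List ι) (hx : xs.Pairwise (fun a b => key a ≤ key b))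
    (hy : ys.Pairwise (fun a b => key a ≤ key b)) :
    (merge key xs ys).val.Pairwise (fun a b => key a ≤ key b) := by
  induction xs, ys using merge.induct with
  | case1 ys => simpa [merge] using hy
  | case2 x xs => simpa [merge] using hx
  | case3 x xs y ys ih1 ih2 =>
    rw [merge]
    rw [List.pairwise_cons] at hx hy
    simp only [val_bind, val_op, decide_eq_true_eq]
    split_ifs with h
    · simp only [val_bind, val_op, List.pairwise_cons]
      refine ⟨fun a ha => ?_, ih1 hx.2 (List.pairwise_cons.2 hy)⟩
      have := (merge_perm key _ _).mem_iff.1 ha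
      simp only [List.mem_append, List.mem_cons] at this
      rcases this with h1 | rfl | h1
      · exact hx.1 a h1
      · exact h
      · exact h.trans (hy.1 a h1)
    · simp only [val_bind, val_op, List.pairwise_cons]
      refine ⟨fun a ha => ?_, ih2 (List.pairwise_cons.2 hx) hy.2⟩
      have := (merge_perm key _ _).mem_iff.1 ha
      simp only [List.mem_append, List.mem_cons] at this
      have h' := (not_le.1 h).le
      rcases this with (rfl | h1) | h1
      · exact h'
      · exact h'.trans (hx.1 a h1)
      · exact hy.1 a h1

lemma merge_time (xs ys : List ι) :
    (merge key xs ys).time ≤ 2 * (xs.length + ys.length) + 1 := by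
  induction xs, ys using merge.induct with
  | case1 ys => simp [merge]
  | case2 x xs => simp [merge]
  | case3 x xs y ys ih1 ih2 =>
    rw [merge]
    simp only [time_bind, val_op, time_op, decide_eq_true_eq]
    simp only [List.length_cons] at ih1 ih2 ⊢
    split_ifs <;> simp only [time_bind, time_op] <;> omega

lemma sort_perm (l : List ι) : (sort key l).val.Perm l := by
  induction l using sort.induct with
  | case1 l h => rw [sort]; simp [h]
  | case2 l h ih1 ih2 =>
    rw [sort]
    simp only [h, dite_false, val_bind]
    refine (merge_perm key _ _).trans ?_
    refine (ih1.append ih2).trans ?_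
    rw [List.take_append_drop]

lemma sort_sorted (l : List ι) : (sort key l).val.Pairwise (fun a b => key a ≤ key b) := by
  induction l using sort.induct with
  | case1 l h =>
    rw [sort]
    simp only [h, dite_true, val_op]
    match l, h with
    | [], _ => exact List.Pairwise.nil
    | [a], _ => exact List.pairwise_singleton _ _
  | case2 l h ih1 ih2 =>
    rw [sort]
    simp only [h, dite_false, val_bind]
    exact merge_sorted key _ _ ih1 ih2

lemma sort_time (l : List ι) :
    (sort key l).time ≤ 5 * (l.length * Nat.clog 2 l.length) + 2 * l.length + 1 := by
  induction l using sort.induct with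
  | case1 l h => rw [sort]; simp [h]
  | case2 l h ih1 ih2 =>
    rw [sort]
    simp only [h, dite_false, time_bind, time_charge]
    have h1 := merge_time key (sort key (l.take (l.length / 2))).val
      (sort key (l.drop (l.length / 2))).val
    rw [(sort_perm key _).length_eq, (sort_perm key _).length_eq] at h1
    rw [List.length_take] at ih1 h1
    rw [List.length_drop] at ih2 h1
    generalize l.length = m at *
    rw [min_eq_left (Nat.div_le_self m 2)] at ih1 h1
    have h2 := clog_two_half (m := m) (by omega)
    have h3 : Nat.clog 2 (m / 2) ≤ Nat.clog 2 (m - m / 2) := Nat.clog_mono_right 2 (by omega)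
    rw [h2]
    generalize Nat.clog 2 (m - m / 2) = L at *
    have h4 : m / 2 * Nat.clog 2 (m / 2) ≤ m / 2 * L := Nat.mul_le_mul le_rfl h3
    have h5 : m / 2 * L + (m - m / 2) * L = m * L := by
      rw [← add_mul]; congr 1; omega
    have h6 : m * (L + 1) = m * L + m := by ring
    omega

end Sorting

/-! ### Pieces of an envelope -/

section Pieces

variable {ι : Type}

/-- The point `t` belongs to the piece `i`: it lies to the right of the left end of this piece, unless
this is the first one, and not to the right of the left end of the next piece. -/
def InPiece (U : Env ι) (i : ℕ) (t : ℝ) : Prop :=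
  i < U.len ∧ (1 ≤ i → (U.cell i).1 < t) ∧ (i + 1 < U.len → t ≤ (U.cell (i + 1)).1)

lemma Env.Ordered.cell_le {U : Env ι} (hU : U.Ordered) {i j : ℕ} (hij : i ≤ j) (hj : j < U.len) :
    (U.cell i).1 ≤ (U.cell j).1 := by
  induction j, hij using Nat.le_induction with
  | base => exact le_rfl
  | succ j h ih => exact (ih (by omega)).trans (hU.2 j hj)

lemma exists_inPiece {U : Env ι} (hU : 0 < U.len) (t : ℝ) :
    ∃ i, InPiece U i t ∧ U.active t = (U.cell i).2 := by
  classical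
  refine ⟨_, ?_, rfl⟩
  obtain ⟨h1, h2, h3⟩ := (Nat.findGreatest_eq_iff
    (P := fun i => i < U.len ∧ (U.cell i).1 < t) (k := U.len)).1 rfl
  set i := Nat.findGreatest (fun i => i < U.len ∧ (U.cell i).1 < t) U.len
  have hi : i < U.len := by
    by_cases h : i = 0
    · omega
    · exact (h2 h).1
  refine ⟨hi, fun h => (h2 (by omega)).2, fun h => ?_⟩
  by_contra h'
  exact h3 (Nat.lt_succ_self i) h.le ⟨h, not_le.1 h'⟩

lemma active_eq {U : Env ι} (hU : U.Ordered) {i : ℕ} {t : ℝ} (h : InPiece U i t) :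
    U.active t = (U.cell i).2 := by
  obtain ⟨j, hj, hj'⟩ := exists_inPiece hU.1 t
  rcases lt_trichotomy i j with h1 | rfl | h1
  · have h2 := hU.cell_le (show i + 1 ≤ j by omega) hj.1
    linarith [h.2.2 (by have := hj.1; omega), hj.2.1 (by omega)]
  · exact hj'
  · have h2 := hU.cell_le (show j + 1 ≤ i by omega) h.1
    linarith [hj.2.2 (by have := h.1; omega), h.2.1 (by omega)]

end Pieces

/-! ### Correctness of the sweep -/

section Sweep

variable {ι : Type} {val : ι → ℝ → ℝ} {p : ℕ → ℝ} {M : ℕ}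

/-- The search ends between two consecutive points with opposite signs of `f - g`, as far as the ends
of the range allow. -/
lemma bisectVertex_spec (f g : ι) (lo hi : ℕ) (h : lo < hi) :
    lo ≤ (bisectVertex val p f g lo hi).val ∧ (bisectVertex val p f g lo hi).val < hi ∧
    ((bisectVertex val p f g lo hi).val = lo ∨
      val f (p (bisectVertex val p f g lo hi).val) ≤
        val g (p (bisectVertex val p f g lo hi).val)) ∧
    ((bisectVertex val p f g lo hi).val + 1 = hi ∨
      val g (p ((bisectVertex val p f g lo hi).val + 1)) <
        val f (p ((bisectVertex val p f g lo hi).val + 1))) := by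
  induction lo, hi using bisectVertex.induct with
  | case1 lo hi h1 =>
    rw [bisectVertex]
    simp only [h1, dite_true, val_op]
    exact ⟨le_rfl, h, Or.inl trivial, Or.inl (by omega)⟩
  | case2 lo hi h1 ih1 ih2 =>
    rw [bisectVertex]
    simp only [h1, dite_false, val_bind, val_op, decide_eq_true_eq]
    split_ifs with h2
    · obtain ⟨h3, h4, h5, h6⟩ := ih1 (by omega)
      refine ⟨by omega, h4, Or.inr ?_, h6⟩
      rcases h5 with h5 | h5
      · rw [h5]; exact h2
      · exact h5
    · obtain ⟨h3, h4, h5, h6⟩ := ih2 (by omega)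
      refine ⟨h3, by omega, h5, Or.inr ?_⟩
      rcases h6 with h6 | h6
      · rw [h6]; exact not_le.1 h2
      · exact h6

lemma bisectPiece_spec (U : Env ι) (s : ι) (lo hi : ℕ) (h : lo < hi) :
    lo ≤ (bisectPiece val U s lo hi).val ∧ (bisectPiece val U s lo hi).val < hi ∧
    ((bisectPiece val U s lo hi).val = lo ∨
      val s (U.cell (bisectPiece val U s lo hi).val).1 ≤
        val (U.cell ((bisectPiece val U s lo hi).val - 1)).2
          (U.cell (bisectPiece val U s lo hi).val).1) ∧
    ((bisectPiece val U s lo hi).val + 1 = hi ∨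
      val (U.cell ((bisectPiece val U s lo hi).val)).2
          (U.cell ((bisectPiece val U s lo hi).val + 1)).1 <
        val s (U.cell ((bisectPiece val U s lo hi).val + 1)).1) := by
  induction lo, hi using bisectPiece.induct with
  | case1 lo hi h1 =>
    rw [bisectPiece]
    simp only [h1, dite_true, val_op]
    exact ⟨le_rfl, h, Or.inl trivial, Or.inl (by omega)⟩
  | case2 lo hi h1 ih1 ih2 =>
    rw [bisectPiece]
    simp only [h1, dite_false, val_bind, val_op, decide_eq_true_eq]
    split_ifs with h2
    · obtain ⟨h3, h4, h5, h6⟩ := ih1 (by omega)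
      refine ⟨by omega, h4, Or.inr ?_, h6⟩
      rcases h5 with h5 | h5
      · rw [h5]; exact h2
      · exact h5
    · obtain ⟨h3, h4, h5, h6⟩ := ih2 (by omega)
      refine ⟨h3, by omega, h5, Or.inr ?_⟩
      rcases h6 with h6 | h6
      · rw [← h6] at h2
        exact not_le.1 h2
      · exact h6

/-- The point found separates the points where `f ≤ g` from those where `f ≥ g`.  At `p 0` nothing is
claimed, since a rising difference may jump to the right of `p 0`. -/
lemma crossing_spec (hp : ∀ j < M, p j < p (j + 1)) (hM : 0 < M) {f g : ι}
    (hfg : Rising p M (fun t => val f t - val g t)) (hlast : val g (p M) < val f (p M)) :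
    p 0 ≤ (crossing val p M f g).val ∧ (crossing val p M f g).val < p M ∧
    (p 0 < (crossing val p M f g).val →
      val f (crossing val p M f g).val ≤ val g (crossing val p M f g).val) ∧
    ∀ t, (crossing val p M f g).val < t → t ≤ p M → val g t ≤ val f t := by
  obtain ⟨-, hj, h1, h2⟩ := bisectVertex_spec (val := val) (p := p) f g 0 M hM
  have hX : (crossing val p M f g).val =
      let j := (bisectVertex val p f g 0 M).val
      let m := (p j + p (j + 1)) / 2
      let dr := val f (p (j + 1)) - val g (p (j + 1))
      let dm := val f m - val g m
      if dr ≤ dm then p j else max (p j) (p (j + 1) - dr * (p (j + 1) - m) / (dr - dm)) := by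
    simp only [crossing, val_bind, val_op, decide_eq_true_eq]
    split_ifs <;> rw [val_op]
  simp only at hX
  generalize (bisectVertex val p f g 0 M).val = j at *
  generalize (crossing val p M f g).val = X at *
  obtain ⟨α, β, hd⟩ := hfg.affine j hj
  have hlr := hp j hj
  have h0l : p 0 ≤ p j := le_of_succ_lt hp (Nat.zero_le j) hj.le
  have hrM : p (j + 1) ≤ p M := le_of_succ_lt hp hj le_rfl
  set l := p j
  set r := p (j + 1)
  have hr : val f r - val g r = α * r + β := hd r ⟨hlr, le_rfl⟩
  have hm : val f ((l + r) / 2) - val g ((l + r) / 2) = α * ((l + r) / 2) + β :=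
    hd _ ⟨by linarith, by linarith⟩
  have hpos : 0 < α * r + β := by
    rw [← hr]
    rcases h2 with h2 | h2
    · simp only [r, h2]; linarith
    · linarith
  have hright : ∀ t, r ≤ t → t ≤ p M → val g t ≤ val f t := by
    intro t h3 h4
    have := hfg.mono (show r ∈ Set.Icc (p 0) (p M) from ⟨by linarith, hrM⟩)
      (show t ∈ Set.Icc (p 0) (p M) from ⟨by linarith, h4⟩) h3
    linarith
  have hleft : p 0 < l → val f l ≤ val g l := by
    intro h
    rcases h1 with h1 | h1
    · simp [l, h1] at h
    · exact h1
  rw [hr, hm] at hX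
  split_ifs at hX with hc
  · subst hX
    refine ⟨h0l, by linarith, hleft, fun t ht htM => ?_⟩
    rcases le_total r t with h | h
    · exact hright t h htM
    · have := hd t ⟨ht, h⟩
      nlinarith
  · have hα : 0 < α := by nlinarith
    obtain ⟨z, hz⟩ : ∃ z, z = r - (α * r + β) / α := ⟨_, rfl⟩
    have hz0 : α * z + β = 0 := by rw [hz]; field_simp; ring
    have hz' : r - (α * r + β) * (r - (l + r) / 2) / (α * r + β - (α * ((l + r) / 2) + β)) = z := by
      rw [hz]
      have : r - l ≠ 0 := by linarith
      have h3 : α * r + β - (α * ((l + r) / 2) + β) = α * (r - (l + r) / 2) := by ring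
      have h4 : r - (l + r) / 2 ≠ 0 := by
        intro h; apply this; linarith
      rw [h3, mul_div_mul_right _ _ h4]
    rw [hz'] at hX
    have hzr : z < r := by
      by_contra h
      nlinarith
    have hXr : X < r := by rw [hX]; exact max_lt hlr hzr
    refine ⟨by rw [hX]; exact h0l.trans (le_max_left _ _), by linarith, ?_, fun t ht htM => ?_⟩
    · intro h
      rcases le_total z l with h3 | h3
      · rw [max_eq_left h3] at hX
        rw [hX] at h ⊢
        exact hleft h
      · rcases h3.eq_or_lt with h4 | h4
        · rw [← h4, max_self] at hX
          rw [hX] at h ⊢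
          exact hleft h
        · rw [max_eq_right h3] at hX
          rw [hX]
          have := hd z ⟨h4, hzr.le⟩
          linarith
    · rcases le_total r t with h | h
      · exact hright t h htM
      · rw [hX, max_lt_iff] at ht
        have := hd t ⟨ht.1, h⟩
        nlinarith [ht.2]

variable (val p M) in
/-- `U` is the upper envelope on `[p 0, p M]` of the functions in `A`; except that the first piece may
consist of the point `p 0` only, no piece is empty. -/
structure IsEnv (U : Env ι) (A : Set ι) : Prop where
  len_pos : 0 < U.len
  first : (U.cell 0).1 = p 0
  strict : ∀ i, 1 ≤ i → i + 1 < U.len → (U.cell i).1 < (U.cell (i + 1)).1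
  bounds : ∀ i, 1 ≤ i → i < U.len → p 0 ≤ (U.cell i).1 ∧ (U.cell i).1 < p M
  mem : ∀ i < U.len, (U.cell i).2 ∈ A
  max : ∀ i t, t ∈ Set.Icc (p 0) (p M) → InPiece U i t →
    ∀ f ∈ A, val f t ≤ val (U.cell i).2 t

namespace IsEnv

variable {U : Env ι} {A : Set ι} {s : ι}

lemma ordered (hU : IsEnv val p M U A) : U.Ordered := by
  refine ⟨hU.len_pos, fun i hi => ?_⟩
  rcases Nat.eq_zero_or_pos i with rfl | h
  · rw [hU.first]
    exact (hU.bounds 1 le_rfl hi).1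
  · exact (hU.strict i h hi).le

lemma inPiece_zero (hU : IsEnv val p M U A) : InPiece U 0 (p 0) :=
  ⟨hU.len_pos, fun h => absurd h (by omega), fun h => (hU.bounds 1 le_rfl h).1⟩

lemma inPiece_last (hU : IsEnv val p M U A) : InPiece U (U.len - 1) (p M) := by
  have := hU.len_pos
  exact ⟨by omega, fun h => (hU.bounds _ h (by omega)).2, fun h => by omega⟩

/-- Pieces contain their right ends. -/
lemma inPiece_right_end (hU : IsEnv val p M U A) {i : ℕ} (hi : i + 1 < U.len) :
    InPiece U i (U.cell (i + 1)).1 :=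
  ⟨by omega, fun h => hU.strict i h hi, fun _ => le_rfl⟩

lemma cell_mem_Icc (hU : IsEnv val p M U A) {i : ℕ} (h1 : 1 ≤ i) (hi : i < U.len) :
    (U.cell i).1 ∈ Set.Icc (p 0) (p M) :=
  ⟨(hU.bounds i h1 hi).1, (hU.bounds i h1 hi).2.le⟩

/-- If `s` does not exceed the envelope at `t₀`, then neither does it to the left of `t₀`. -/
lemma le_of_le_right (hU : IsEnv val p M U A)
    (hs : ∀ f ∈ A, Rising p M (fun t => val s t - val f t)) {i k : ℕ} {t₀ t : ℝ}
    (h₀ : t₀ ∈ Set.Icc (p 0) (p M)) (hi : i < U.len) (hle : val s t₀ ≤ val (U.cell i).2 t₀)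
    (ht : t ∈ Set.Icc (p 0) (p M)) (htt : t ≤ t₀) (hk : InPiece U k t) :
    val s t ≤ val (U.cell k).2 t := by
  have h1 := (hs _ (hU.mem i hi)).mono ht h₀ htt
  have h2 := hU.max k t ht hk _ (hU.mem i hi)
  linarith

/-- If `s` reaches the envelope at `t₀`, then it dominates everything to the right of `t₀`. -/
lemma le_of_le_left (hU : IsEnv val p M U A)
    (hs : ∀ f ∈ A, Rising p M (fun t => val s t - val f t)) {i : ℕ} {t₀ t : ℝ}
    (h₀ : t₀ ∈ Set.Icc (p 0) (p M)) (hi : InPiece U i t₀) (hle : val (U.cell i).2 t₀ ≤ val s t₀)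
    (ht : t ∈ Set.Icc (p 0) (p M)) (htt : t₀ ≤ t) : ∀ f ∈ A, val f t ≤ val s t := by
  intro f hf
  have h1 := (hs f hf).mono h₀ ht htt
  have h2 := hU.max i t₀ h₀ hi f hf
  linarith

/-- Since `s - f` is rising for all `f ∈ A`, it suffices that `s` does not exceed `U` at the left end of
the piece `lo` but does so at its right end. -/
lemma insertAfter (hU : IsEnv val p M U A) (hp : ∀ j < M, p j < p (j + 1)) (hM : 0 < M)
    (hs : ∀ f ∈ A, Rising p M (fun t => val s t - val f t)) {lo : ℕ} (hlo : lo < U.len)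
    (h0 : lo = 0 → val s (p 0) < val (U.cell 0).2 (p 0))
    (h1 : 1 ≤ lo → val s (U.cell lo).1 ≤ val (U.cell (lo - 1)).2 (U.cell lo).1)
    (h2 : lo + 1 < U.len → val (U.cell lo).2 (U.cell (lo + 1)).1 < val s (U.cell (lo + 1)).1)
    (h3 : lo + 1 = U.len → val (U.cell lo).2 (p M) < val s (p M)) :
    IsEnv val p M (insertAfter val p M U s lo).val (insert s A) := by
  have h0M : p 0 ≤ p M := le_of_succ_lt hp (Nat.zero_le M) le_rfl
  have hlast : val (U.cell lo).2 (p M) < val s (p M) := by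
    rcases Nat.lt_or_ge (lo + 1) U.len with h | h
    · have h4 := hU.cell_mem_Icc (show 1 ≤ lo + 1 by omega) h
      have := (hs _ (hU.mem lo hlo)).mono h4 ⟨h0M, le_rfl⟩ h4.2
      linarith [h2 h]
    · exact h3 (by omega)
  obtain ⟨hX0, hXM, hXle, hXge⟩ := crossing_spec hp hM (hs _ (hU.mem lo hlo)) hlast
  have hval : (EvacPath.insertAfter val p M U s lo).val =
      if 1 ≤ lo ∧ (crossing val p M s (U.cell lo).2).val ≤ (U.cell lo).1 then
        ⟨lo + 1, Function.update U.cell lo ((U.cell lo).1, s)⟩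
      else ⟨lo + 2, Function.update U.cell (lo + 1) ((crossing val p M s (U.cell lo).2).val, s)⟩ := by
    simp only [EvacPath.insertAfter, val_bind, val_op, decide_eq_true_eq]
    split_ifs <;> rw [val_op]
  rw [hval]
  clear hval
  generalize (crossing val p M s (U.cell lo).2).val = X at *
  have hright : ∀ t ∈ Set.Icc (p 0) (p M), X < t → (1 ≤ lo → (U.cell lo).1 < t) →
      ∀ f ∈ insert s A, val f t ≤ val s t := by
    rintro t ht htX htlo f (rfl | hf)
    · exact le_rfl
    by_cases h : lo + 1 < U.len ∧ (U.cell (lo + 1)).1 < t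
    · exact hU.le_of_le_left hs (hU.cell_mem_Icc (by omega) h.1) (hU.inPiece_right_end h.1)
        (h2 h.1).le ht h.2.le f hf
    · refine (hU.max lo t ht ⟨hlo, htlo, fun h' => ?_⟩ f hf).trans (hXge t htX ht.2)
      by_contra h''
      exact h ⟨h', not_le.1 h''⟩
  split_ifs with hc
  · obtain ⟨hc1, hc2⟩ := hc
    have hcell : ∀ i, i ≠ lo → Function.update U.cell lo ((U.cell lo).1, s) i = U.cell i :=
      fun i hi => Function.update_of_ne hi _ _
    have hfst : ∀ i, (Function.update U.cell lo ((U.cell lo).1, s) i).1 = (U.cell i).1 := by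
      intro i
      by_cases hi : i = lo
      · subst hi; simp
      · rw [hcell i hi]
    refine ⟨Nat.succ_pos _, ?_, ?_, ?_, ?_, ?_⟩
    · rw [hfst]; exact hU.first
    · intro i hi hi'
      simp only at hi'
      simp only [hfst]
      exact hU.strict i hi (by omega)
    · intro i hi hi'
      simp only at hi'
      simp only [hfst]
      exact hU.bounds i hi (by omega)
    · intro i hi
      simp only at hi
      by_cases h : i = lo
      · subst h; simp
      · simp only [hcell i h]
        exact Or.inr (hU.mem i (by omega))
    · intro i t ht hit
      obtain ⟨h4, h5, h6⟩ := hit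
      simp only [hfst] at h4 h5 h6
      by_cases h : i = lo
      · subst h
        simp only [Function.update_self]
        exact hright t ht (hc2.trans_lt (h5 hc1)) h5
      · simp only [hcell i h]
        have hi : InPiece U i t := ⟨by omega, h5, fun _ => h6 (by omega)⟩
        rintro f (rfl | hf)
        · refine hU.le_of_le_right hs (hU.cell_mem_Icc hc1 hlo) (show lo - 1 < U.len by omega)
            (h1 hc1) ht ?_ hi
          exact (h6 (by omega)).trans (hU.ordered.cell_le (show i + 1 ≤ lo by omega) hlo)
        · exact hU.max i t ht hi f hf
  · have hc' : 1 ≤ lo → (U.cell lo).1 < X := fun h => by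
      by_contra h'
      exact hc ⟨h, not_lt.1 h'⟩
    have hXp : X = p 0 → lo = 0 := by
      intro h
      by_contra h'
      have h4 := hU.bounds lo (by omega) hlo
      linarith [hc' (by omega), h4.1]
    have hcell : ∀ i, i ≤ lo → Function.update U.cell (lo + 1) (X, s) i = U.cell i :=
      fun i hi => Function.update_of_ne (by omega) _ _
    have hXnext : lo + 1 < U.len → X ≤ (U.cell (lo + 1)).1 := by
      intro h
      by_contra h'
      rw [not_le] at h'
      have h4 := hU.cell_mem_Icc (show 1 ≤ lo + 1 by omega) h
      have := (hs _ (hU.mem lo hlo)).mono h4 ⟨hX0, hXM.le⟩ h'.le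
      linarith [h2 h, hXle (h4.1.trans_lt h')]
    have hleft : ∀ i t, t ∈ Set.Icc (p 0) (p M) → t ≤ X → InPiece U i t →
        val s t ≤ val (U.cell i).2 t := by
      intro i t ht htX hi
      rcases hX0.eq_or_lt with h | h
      · obtain rfl := hXp h.symm
        exact hU.le_of_le_right hs ⟨le_rfl, h0M⟩ hlo (h0 rfl).le ht (htX.trans h.ge) hi
      · exact hU.le_of_le_right hs ⟨hX0, hXM.le⟩ hlo (hXle h) ht htX hi
    refine ⟨Nat.succ_pos _, ?_, ?_, ?_, ?_, ?_⟩
    · simp only [hcell 0 (Nat.zero_le _)]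
      exact hU.first
    · intro i hi hi'
      simp only at hi'
      simp only [hcell i (by omega)]
      by_cases h : i = lo
      · subst h
        simpa using hc' hi
      · rw [hcell _ (by omega)]
        exact hU.strict i hi (by omega)
    · intro i hi hi'
      simp only at hi'
      by_cases h : i = lo + 1
      · subst h
        simpa using ⟨hX0, hXM⟩
      · simp only [hcell i (by omega)]
        exact hU.bounds i hi (by omega)
    · intro i hi
      simp only at hi
      by_cases h : i = lo + 1
      · subst h; simp
      · simp only [hcell i (by omega)]
        exact Or.inr (hU.mem i (by omega))
    · intro i t ht hit
      obtain ⟨h4, h5, h6⟩ := hit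
      simp only at h4 h5 h6
      by_cases h : i = lo + 1
      · subst h
        simp only [Function.update_self] at h5 ⊢
        exact hright t ht (h5 (by omega)) fun h => (hc' h).trans (h5 (by omega))
      · rw [hcell i (by omega)] at h5
        simp only [hcell i (by omega)]
        have htX : t ≤ X ∧ InPiece U i t := by
          by_cases h' : i = lo
          · subst h'
            have h7 := h6 (by omega)
            simp only [Function.update_self] at h7
            exact ⟨h7, hlo, h5, fun h => h7.trans (hXnext h)⟩
          · have h7 := h6 (by omega)
            rw [hcell _ (by omega)] at h7
            refine ⟨h7.trans ((hU.ordered.cell_le (show i + 1 ≤ lo by omega) hlo).trans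
              (hc' (by omega)).le), by omega, h5, fun _ => h7⟩
        rintro f (rfl | hf)
        · exact hleft i t ht htX.1 htX.2
        · exact hU.max i t ht htX.2 f hf

lemma sweepStep (hU : IsEnv val p M U A) (hp : ∀ j < M, p j < p (j + 1))
    (hs : ∀ f ∈ A, Rising p M (fun t => val s t - val f t)) :
    IsEnv val p M (sweepStep val p M U s).val (insert s A) := by
  have h0M : p 0 ≤ p M := le_of_succ_lt hp (Nat.zero_le M) le_rfl
  have hlen := hU.len_pos
  simp only [EvacPath.sweepStep, val_bind, val_op, decide_eq_true_eq, apply_ite Timed.val]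
  split_ifs with h1 h2 h3
  · refine ⟨Nat.one_pos, by simp, fun i _ h => by simp only at h; omega,
      fun i _ h => by simp only at h; omega, fun i h => ?_, fun i t ht hi => ?_⟩
    · simp only [Nat.lt_one_iff] at h
      subst h
      simp
    · have h4 := hi.1
      simp only [Nat.lt_one_iff] at h4
      subst h4
      simp only [Function.update_self]
      rintro f (rfl | hf)
      · exact le_rfl
      · exact hU.le_of_le_left hs ⟨le_rfl, h0M⟩ hU.inPiece_zero h1 ht ht.1 f hf
  · refine ⟨hU.len_pos, hU.first, hU.strict, hU.bounds, fun i hi => Or.inr (hU.mem i hi),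
      fun i t ht hi => ?_⟩
    rintro f (rfl | hf)
    · exact hU.le_of_le_right hs ⟨h0M, le_rfl⟩ hU.inPiece_last.1 h2 ht ht.2 hi
    · exact hU.max i t ht hi f hf
  all_goals
    rw [not_le] at h1 h2
    have hM : 0 < M := by
      rw [Nat.pos_iff_ne_zero]
      rintro rfl
      have h4 := hU.max _ _ ⟨le_rfl, le_rfl⟩ hU.inPiece_last _ (hU.mem 0 hlen)
      linarith
  · have h5 : ¬ U.len ≤ 1 := by
      intro h
      simp only [lastCrossing, h, if_true] at h3
      rw [show U.len - 1 = 0 by omega] at h2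
      linarith
    simp only [lastCrossing, h5, if_false] at h3
    refine hU.insertAfter hp hM hs (by omega) (fun h => by omega) (fun _ => ?_)
      (fun h => by omega) (fun _ => h2)
    rw [show U.len - 1 - 1 = U.len - 2 by omega]
    exact h3
  · by_cases h5 : U.len ≤ 1
    · have h6 : (bisectPiece val U s 0 (U.len - 1)).val = 0 := by
        rw [bisectPiece]
        simp [show U.len - 1 ≤ 0 + 1 by omega]
      rw [h6]
      rw [show U.len - 1 = 0 by omega] at h2
      exact hU.insertAfter hp hM hs hlen (fun _ => h1) (fun h => by omega) (fun h => by omega)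
        (fun _ => h2)
    · simp only [lastCrossing, h5, if_false, not_le] at h3
      obtain ⟨-, h6, h7, h8⟩ :=
        bisectPiece_spec (val := val) U s 0 (U.len - 1) (by omega)
      generalize (bisectPiece val U s 0 (U.len - 1)).val = lo at *
      refine hU.insertAfter hp hM hs (by omega) (fun _ => h1)
        (fun h => h7.resolve_left (by omega)) (fun h => ?_) (fun h => by omega)
      rcases h8 with h8 | h8
      · rw [h8]
        rw [show U.len - 2 = lo by omega] at h3
        exact h3
      · exact h8

lemma sweep (hp : ∀ j < M, p j < p (j + 1)) (l : List ι) :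
    ∀ (U : Env ι) (A : Set ι), IsEnv val p M U A →
      (∀ s ∈ l, ∀ f ∈ A, Rising p M (fun t => val s t - val f t)) →
      l.Pairwise (fun f s => Rising p M (fun t => val s t - val f t)) →
      IsEnv val p M (sweep val p M l U).val (A ∪ {s | s ∈ l}) := by
  induction l with
  | nil => intro U A hU _ _; simpa [EvacPath.sweep] using hU
  | cons s rest ih =>
    intro U A hU h1 h2
    rw [List.pairwise_cons] at h2
    have h3 := hU.sweepStep hp (h1 s List.mem_cons_self)
    have h4 := ih _ _ h3 (fun r hr f hf => by
      rcases hf with rfl | hf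
      · exact h2.1 r hr
      · exact h1 r (List.mem_cons_of_mem _ hr) f hf) h2.2
    have h5 : A ∪ {r | r ∈ s :: rest} = insert s A ∪ {r | r ∈ rest} := by
      ext r
      simp only [Set.mem_union, Set.mem_insert_iff, Set.mem_ofPred_eq, List.mem_cons]
      tauto
    rw [h5]
    exact h4

/-- The sweep computes the upper envelope, as later functions rise against earlier ones: where the
next function exceeds the current envelope is an interval that extends to the right end. -/
lemma upperEnvelope [Inhabited ι] {key : ι → ℝ} {l : List ι} (hp : ∀ j < M, p j < p (j + 1))
    (hl : l ≠ [])
    (hkey : ∀ f ∈ l, ∀ s ∈ l, key f ≤ key s → Rising p M (fun t => val s t - val f t)) :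
    IsEnv val p M (upperEnvelope val p M key l).val {s | s ∈ l} := by
  have h1 := sort_perm key l
  have h2 := sort_sorted key l
  have h3 : (EvacPath.upperEnvelope val p M key l).val = (match (sort key l).val with
      | [] => op ⟨0, fun _ => (0, default)⟩
      | f :: rest => EvacPath.sweep val p M rest ⟨1, fun _ => (p 0, f)⟩ : Timed (Env ι)).val := rfl
  rw [h3]
  have h4 : {s | s ∈ l} = {s | s ∈ (sort key l).val} := by
    ext s
    exact h1.mem_iff.symm
  have h5 : (sort key l).val.Pairwise (fun f s => Rising p M (fun t => val s t - val f t)) :=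
    h2.imp_of_mem fun ha hb h => hkey _ (h1.mem_iff.1 ha) _ (h1.mem_iff.1 hb) h
  have h6 : (sort key l).val ≠ [] := fun h => hl (by
    rw [h] at h1
    exact h1.nil_eq.symm)
  rw [h4]
  generalize (sort key l).val = l' at *
  cases l' with
  | nil => exact absurd rfl h6
  | cons f rest =>
    rw [List.pairwise_cons] at h5
    have h7 : IsEnv val p M (⟨1, fun _ => (p 0, f)⟩ : Env ι) {f} := by
      refine ⟨Nat.one_pos, rfl, fun i _ h => by simp only at h; omega,
        fun i _ h => by simp only at h; omega, fun i h => rfl, fun i t ht hi => ?_⟩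
      rintro g rfl
      exact le_rfl
    have h8 := IsEnv.sweep hp rest _ _ h7 (fun s hs g hg => by
      rw [Set.mem_singleton_iff] at hg
      exact hg ▸ h5.1 s hs) h5.2
    have h9 : {s | s ∈ f :: rest} = {f} ∪ {s | s ∈ rest} := by
      ext s
      simp
    rw [h9]
    exact h8

end IsEnv

/-! ### Running time of the sweep -/

lemma bisectVertex_time (f g : ι) (lo hi : ℕ) :
    (bisectVertex val p f g lo hi).time ≤ Nat.clog 2 (hi - lo) + 1 := by
  induction lo, hi using bisectVertex.induct with
  | case1 lo hi h1 => rw [bisectVertex]; simp [h1]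
  | case2 lo hi h1 ih1 ih2 =>
    rw [bisectVertex]
    simp only [h1, dite_false, time_bind, time_op, val_op, decide_eq_true_eq]
    rw [clog_two_half (show 2 ≤ hi - lo by omega)]
    have h2 := Nat.clog_mono_right 2
      (show hi - (lo + hi) / 2 ≤ hi - lo - (hi - lo) / 2 by omega)
    have h3 := Nat.clog_mono_right 2
      (show (lo + hi) / 2 - lo ≤ hi - lo - (hi - lo) / 2 by omega)
    split_ifs <;> omega

lemma bisectPiece_time (U : Env ι) (s : ι) (lo hi : ℕ) :
    (bisectPiece val U s lo hi).time ≤ Nat.clog 2 (hi - lo) + 1 := by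
  induction lo, hi using bisectPiece.induct with
  | case1 lo hi h1 => rw [bisectPiece]; simp [h1]
  | case2 lo hi h1 ih1 ih2 =>
    rw [bisectPiece]
    simp only [h1, dite_false, time_bind, time_op, val_op, decide_eq_true_eq]
    rw [clog_two_half (show 2 ≤ hi - lo by omega)]
    have h2 := Nat.clog_mono_right 2
      (show hi - (lo + hi) / 2 ≤ hi - lo - (hi - lo) / 2 by omega)
    have h3 := Nat.clog_mono_right 2
      (show (lo + hi) / 2 - lo ≤ hi - lo - (hi - lo) / 2 by omega)
    split_ifs <;> omega

lemma crossing_time (f g : ι) : (crossing val p M f g).time ≤ Nat.clog 2 M + 8 := by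
  have h := bisectVertex_time (val := val) (p := p) f g 0 M
  rw [Nat.sub_zero] at h
  simp only [crossing, time_bind, time_op, val_op]
  split_ifs <;> simp only [time_op] <;> omega

lemma insertAfter_time (U : Env ι) (s : ι) (lo : ℕ) :
    (insertAfter val p M U s lo).time ≤ Nat.clog 2 M + 10 := by
  have h := crossing_time (val := val) (p := p) (M := M) s (U.cell lo).2
  simp only [insertAfter, time_bind, time_op, val_op]
  split_ifs <;> simp only [time_op] <;> omega

lemma insertAfter_len (U : Env ι) (s : ι) {lo : ℕ} (hlo : lo < U.len) :
    (insertAfter val p M U s lo).val.len ≤ U.len + 1 := by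
  simp only [insertAfter, val_bind, val_op]
  split_ifs <;> simp only [val_op] <;> omega

lemma sweepStep_time (U : Env ι) (s : ι) :
    (sweepStep val p M U s).time ≤ Nat.clog 2 U.len + Nat.clog 2 M + 15 := by
  have h1 := bisectPiece_time (val := val) U s 0 (U.len - 1)
  have h2 := Nat.clog_mono_right 2 (show U.len - 1 - 0 ≤ U.len by omega)
  have h3 := insertAfter_time (val := val) (p := p) (M := M) U s (U.len - 1)
  have h4 := insertAfter_time (val := val) (p := p) (M := M) U s
    (bisectPiece val U s 0 (U.len - 1)).val
  simp only [sweepStep, time_bind, time_op, val_op, apply_ite Timed.time]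
  split_ifs <;> omega

lemma sweepStep_len (U : Env ι) (hU : 0 < U.len) (s : ι) :
    0 < (sweepStep val p M U s).val.len ∧ (sweepStep val p M U s).val.len ≤ U.len + 1 := by
  have hpos : ∀ lo, 0 < (insertAfter val p M U s lo).val.len := by
    intro lo
    simp only [insertAfter, val_bind, val_op]
    split_ifs <;> simp only [val_op] <;> omega
  have hlo : (bisectPiece val U s 0 (U.len - 1)).val < U.len := by
    rcases Nat.eq_zero_or_pos (U.len - 1) with h | h
    · rw [h, bisectPiece]
      simpa using hU
    · have := (bisectPiece_spec (val := val) U s 0 (U.len - 1) h).2.1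
      omega
  simp only [sweepStep, val_bind, val_op, apply_ite Timed.val]
  split_ifs
  · simp
  · exact ⟨hU, Nat.le_succ _⟩
  · exact ⟨hpos _, insertAfter_len U s (by omega)⟩
  · exact ⟨hpos _, insertAfter_len U s hlo⟩

lemma sweep_time (K : ℕ) (l : List ι) :
    ∀ U : Env ι, 0 < U.len → U.len + l.length ≤ K →
      (sweep val p M l U).val.len ≤ U.len + l.length ∧
      (sweep val p M l U).time ≤ l.length * (Nat.clog 2 K + Nat.clog 2 M + 15) + 1 := by
  induction l with
  | nil => intro U _ _; simp [sweep]
  | cons s rest ih =>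
    intro U hU hK
    rw [List.length_cons] at hK ⊢
    obtain ⟨h1, h2⟩ := sweepStep_len (val := val) (p := p) (M := M) U hU s
    have h3 := sweepStep_time (val := val) (p := p) (M := M) U s
    have h4 := Nat.clog_mono_right 2 (show U.len ≤ K by omega)
    obtain ⟨h5, h6⟩ := ih _ h1 (by omega)
    simp only [sweep, val_bind, time_bind]
    refine ⟨by omega, ?_⟩
    rw [add_mul]
    omega

lemma upperEnvelope_time [Inhabited ι] (key : ι → ℝ) (l : List ι) :
    (upperEnvelope val p M key l).val.len ≤ l.length ∧
    (upperEnvelope val p M key l).time ≤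
      20 * (l.length * (Nat.clog 2 l.length + Nat.clog 2 M + 1)) + 2 := by
  have h1 := sort_time key l
  have h2 := (sort_perm key l).length_eq
  have h3 : upperEnvelope val p M key l = ((sort key l) >>= fun l' => match l' with
      | [] => op ⟨0, fun _ => (0, default)⟩
      | f :: rest => sweep val p M rest ⟨1, fun _ => (p 0, f)⟩) := rfl
  rw [h3, val_bind, time_bind]
  generalize (sort key l).val = l' at *
  rw [← h2] at h1 ⊢
  clear h2 h3
  cases l' with
  | nil =>
    simp only [val_op, time_op, List.length_nil] at h1 ⊢
    omega
  | cons f rest =>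
    obtain ⟨h4, h5⟩ := sweep_time (val := val) (p := p) (M := M) (rest.length + 1) rest
      ⟨1, fun _ => (p 0, f)⟩ Nat.one_pos (by simp only; omega)
    simp only [List.length_cons] at h1 ⊢
    simp only at h4
    refine ⟨by omega, ?_⟩
    set L := Nat.clog 2 (rest.length + 1)
    set m := rest.length
    have h6 : 20 * ((m + 1) * (L + Nat.clog 2 M + 1)) + 2 =
      5 * ((m + 1) * L) + 2 * (m + 1) + 1 + (m * (L + Nat.clog 2 M + 15) + 1)
        + (14 * (m * L) + 15 * L + 19 * (m * Nat.clog 2 M) + 20 * Nat.clog 2 M + 3 * m + 18) := by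
      ring
    omega

end Sweep

end EvacPath

namespace EvacPath

open Finset PathNetwork

/-! ### The envelope for one boundary vertex and one kind -/

section PhaseOneLemmas

variable {N : PathNetwork} {μ : (ℕ → ℝ) → ℝ} {T : Side} {b : ℕ} {ws : List ℝ}

lemma place_outDist (hb : 1 ≤ b) (hbn : b ≤ N.n) (D : Side) {j : ℕ} (hj : j ≤ outLen N b D) :
    place N b D (outDist N b D j) = N.pos (outIdx b D j) := by
  cases D with
  | L =>
    simp only [outLen] at hj
    rw [outDist_L hbn (by omega)]
    simp [place, outIdx]
  | R =>
    simp only [outLen] at hj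
    rw [outDist_R hb (by omega)]
    simp [place, outIdx]

lemma isEnv_halfEnvelope (hb : 1 ≤ b) (hbn : b ≤ N.n) (hws : ∀ w ∈ ws, 0 ≤ w) (hne : ws ≠ [])
    (D : Side) :
    IsEnv (fun w t => N.regret μ (N.pseudo T b w) (place N b D t)) (outDist N b D)
      (outLen N b D) (halfEnvelope N μ T b ws D).val {w | w ∈ ws} :=
  IsEnv.upperEnvelope (fun _ hj => outDist_lt hb hbn D hj) hne
    fun f hf _ _ h => rising_regret μ (hws f hf) h hb hbn D

lemma halfEnvelope_time (hbn : b ≤ N.n) (D : Side) :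
    (halfEnvelope N μ T b ws D).val.len ≤ ws.length ∧
    (halfEnvelope N μ T b ws D).time ≤
      20 * (ws.length * (Nat.clog 2 ws.length + Nat.clog 2 N.n + 1)) + 2 := by
  have hM : outLen N b D ≤ N.n := by cases D <;> simp only [outLen] <;> omega
  obtain ⟨h1, h2⟩ := upperEnvelope_time
    (val := fun w t => N.regret μ (N.pseudo T b w) (place N b D t)) (p := outDist N b D)
    (M := outLen N b D) (fun w => w) ws
  refine ⟨h1, h2.trans ?_⟩
  gcongr

lemma algorithmThree_time (hbn : b ≤ N.n) :
    (algorithmThree N μ T b ws).time ≤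
      40 * (ws.length * (Nat.clog 2 ws.length + Nat.clog 2 N.n + 1)) + 5 := by
  have h1 := (halfEnvelope_time (μ := μ) (T := T) (ws := ws) hbn Side.L).2
  have h2 := (halfEnvelope_time (μ := μ) (T := T) (ws := ws) hbn Side.R).2
  simp only [algorithmThree, time_bind, time_op]
  omega

lemma algorithmThree_val :
    (algorithmThree N μ T b ws).val =
      ((halfEnvelope N μ T b ws Side.L).val, (halfEnvelope N μ T b ws Side.R).val) := by
  simp only [algorithmThree, val_bind, val_op]

lemma isMaxRegret_halfEnvelope (hb : 1 ≤ b) (hbn : b ≤ N.n) (hws : ∀ w ∈ ws, 0 ≤ w)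
    (hne : ws ≠ []) (D : Side) {t : ℝ} (ht : t ∈ Set.Icc 0 (outDist N b D (outLen N b D))) :
    N.IsMaxRegret μ (N.pseudo T b '' {w | w ∈ ws}) (place N b D t)
      (N.regret μ (N.pseudo T b ((halfEnvelope N μ T b ws D).val.active t)) (place N b D t)) := by
  have hE := isEnv_halfEnvelope (μ := μ) (T := T) hb hbn hws hne D
  rw [← outDist_zero N b D] at ht
  obtain ⟨i, hi, hi'⟩ := exists_inPiece hE.len_pos t
  rw [hi']
  constructor
  · exact ⟨_, ⟨_, hE.mem i hi.1, rfl⟩, rfl⟩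
  · rintro y ⟨_, ⟨w, hw, rfl⟩, rfl⟩
    exact hE.max i t ht hi w hw

lemma isUpperEnvelope_twoSided (hb : 1 ≤ b) (hbn : b ≤ N.n) (hws : ∀ w ∈ ws, 0 ≤ w)
    (hne : ws ≠ []) :
    N.IsUpperEnvelope μ (N.pseudo T b '' {w | w ∈ ws})
      (twoSided N μ T b (algorithmThree N μ T b ws).val) := by
  intro x hx
  rw [algorithmThree_val, twoSided]
  have key := fun D t ht => isMaxRegret_halfEnvelope (μ := μ) (T := T) (t := t) hb hbn hws hne D ht
  split_ifs with h
  · have h1 := key Side.L (N.pos b - x) ⟨by linarith, by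
      simp only [outLen]
      rw [outDist_L hbn (by omega), show b - (b - 1) = 1 by omega]
      linarith [hx.1]⟩
    simpa only [place, sub_sub_cancel] using h1
  · have h1 := key Side.R (x - N.pos b) ⟨by linarith, by
      simp only [outLen]
      rw [outDist_R hb (by omega), show b + (N.n - b) = N.n by omega]
      linarith [hx.2]⟩
    simpa only [place, add_sub_cancel] using h1

end PhaseOneLemmas

/-! ### Distribution of the pieces to edges and vertices -/

section Collect

namespace Buckets

/-- Every entry of `B` is an entry of `B'`. -/
def Sub (B B' : Buckets) : Prop :=
  (∀ k, ∀ z ∈ B.edge k, z ∈ B'.edge k) ∧ ∀ k, ∀ z ∈ B.vert k, z ∈ B'.vert k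

/-- Every entry of `B` belongs to `Z`. -/
def Within (B : Buckets) (Z : Set Tag) : Prop :=
  (∀ k, ∀ z ∈ B.edge k, z ∈ Z) ∧ ∀ k, ∀ z ∈ B.vert k, z ∈ Z

/-- The number of entries for the vertices `v_1, …, v_n` and the edges to the right of them. -/
def size (n : ℕ) (B : Buckets) : ℕ :=
  ∑ k ∈ Icc 1 n, ((B.edge k).length + (B.vert k).length)

variable {B B' B'' : Buckets}

lemma Sub.refl (B : Buckets) : B.Sub B := ⟨fun _ _ h => h, fun _ _ h => h⟩

lemma Sub.trans (h : B.Sub B') (h' : B'.Sub B'') : B.Sub B'' :=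
  ⟨fun k z hz => h'.1 k z (h.1 k z hz), fun k z hz => h'.2 k z (h.2 k z hz)⟩

lemma sub_pushEdge (B : Buckets) (k : ℕ) (z : Tag) : B.Sub (B.pushEdge k z) := by
  refine ⟨fun j y hy => ?_, fun j y hy => hy⟩
  simp only [pushEdge]
  rcases eq_or_ne j k with rfl | h
  · simp [hy]
  · rwa [Function.update_of_ne h]

lemma sub_pushVert (B : Buckets) (k : ℕ) (z : Tag) : B.Sub (B.pushVert k z) := by
  refine ⟨fun j y hy => hy, fun j y hy => ?_⟩
  simp only [pushVert]
  rcases eq_or_ne j k with rfl | h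
  · simp [hy]
  · rwa [Function.update_of_ne h]

lemma mem_pushEdge (B : Buckets) (k : ℕ) (z : Tag) : z ∈ (B.pushEdge k z).edge k := by
  simp [pushEdge]

lemma mem_pushVert (B : Buckets) (k : ℕ) (z : Tag) : z ∈ (B.pushVert k z).vert k := by
  simp [pushVert]

lemma Within.pushEdge {Z : Set Tag} (h : B.Within Z) (k : ℕ) {z : Tag} (hz : z ∈ Z) :
    (B.pushEdge k z).Within Z := by
  refine ⟨fun j y hy => ?_, h.2⟩
  simp only [Buckets.pushEdge] at hy
  rcases eq_or_ne j k with rfl | hj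
  · rw [Function.update_self, List.mem_cons] at hy
    rcases hy with rfl | hy
    · exact hz
    · exact h.1 _ _ hy
  · rw [Function.update_of_ne hj] at hy
    exact h.1 _ _ hy

lemma Within.pushVert {Z : Set Tag} (h : B.Within Z) (k : ℕ) {z : Tag} (hz : z ∈ Z) :
    (B.pushVert k z).Within Z := by
  refine ⟨h.1, fun j y hy => ?_⟩
  simp only [Buckets.pushVert] at hy
  rcases eq_or_ne j k with rfl | hj
  · rw [Function.update_self, List.mem_cons] at hy
    rcases hy with rfl | hy
    · exact hz
    · exact h.2 _ _ hy
  · rw [Function.update_of_ne hj] at hy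
    exact h.2 _ _ hy

lemma sum_length_update_le (s : Finset ℕ) (f : ℕ → List Tag) (k : ℕ) (z : Tag) :
    ∑ j ∈ s, (Function.update f k (z :: f k) j).length ≤ ∑ j ∈ s, (f j).length + 1 := by
  have h : ∀ j, (Function.update f k (z :: f k) j).length =
      (f j).length + if j = k then 1 else 0 := by
    intro j
    rcases eq_or_ne j k with rfl | hj
    · simp
    · simp [hj]
  rw [sum_congr rfl fun j _ => h j, sum_add_distrib, sum_ite_eq']
  split_ifs <;> omega

lemma size_pushEdge_le (n : ℕ) (B : Buckets) (k : ℕ) (z : Tag) :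
    (B.pushEdge k z).size n ≤ B.size n + 1 := by
  have := sum_length_update_le (Icc 1 n) B.edge k z
  simp only [size, pushEdge, sum_add_distrib]
  omega

lemma size_pushVert_le (n : ℕ) (B : Buckets) (k : ℕ) (z : Tag) :
    (B.pushVert k z).size n ≤ B.size n + 1 := by
  have := sum_length_update_le (Icc 1 n) B.vert k z
  simp only [size, pushVert, sum_add_distrib]
  omega

end Buckets

variable {N : PathNetwork} {T : Side} {b : ℕ} {D : Side} {U : Env ℝ}

lemma walk_cost (n i j : ℕ) (B : Buckets) :
    (walk N T b D U i j B).time ≤ 3 * ((U.len - i) + (outLen N b D - j)) + 1 ∧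
    (walk N T b D U i j B).val.size n ≤ B.size n + 2 * ((U.len - i) + (outLen N b D - j)) := by
  induction hm : (U.len - i) + (outLen N b D - j) using Nat.strong_induction_on
    generalizing i j B with
  | _ m ih =>
    rw [walk]
    by_cases hj : outLen N b D ≤ j
    · simp [hj]
    have hB₁ := B.size_pushEdge_le n (outEdge b D j) (T, b, (U.cell i).2)
    set B₁ := B.pushEdge (outEdge b D j) (T, b, (U.cell i).2)
    have hB₂ := B₁.size_pushVert_le n (outIdx b D (j + 1)) (T, b, (U.cell i).2)
    have h2 := ih ((U.len - i) + (outLen N b D - (j + 1))) (by omega) i (j + 1)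
      (B₁.pushVert (outIdx b D (j + 1)) (T, b, (U.cell i).2)) rfl
    by_cases hi : i + 1 < U.len
    · have h1 := ih ((U.len - (i + 1)) + (outLen N b D - j)) (by omega) (i + 1) j B₁ rfl
      simp only [hj, hi, dite_true, dite_false, val_bind, time_bind, val_op, time_op,
        apply_ite Timed.val, apply_ite Timed.time]
      split_ifs <;> constructor <;> omega
    · simp only [hj, hi, dite_false, val_bind, time_bind, val_op, time_op]
      constructor <;> omega

/-- The walk enters each piece wherever it is in force, and nothing else. -/
lemma walk_spec (hU : U.Ordered) (hp : ∀ j < outLen N b D, outDist N b D j < outDist N b D (j + 1))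
    {Z : Set Tag} (hZ : ∀ i < U.len, (T, b, (U.cell i).2) ∈ Z) {i j : ℕ} {B : Buckets}
    (hi : i < U.len) (hij : 1 ≤ i → j < outLen N b D → (U.cell i).1 < outDist N b D (j + 1))
    (hB : B.Within Z) :
    B.Sub (walk N T b D U i j B).val ∧ (walk N T b D U i j B).val.Within Z ∧
    ∀ j', j ≤ j' → j' < outLen N b D →
      (∀ t ∈ Set.Ioc (outDist N b D j') (outDist N b D (j' + 1)), ∀ i', i ≤ i' → InPiece U i' t →
        (T, b, (U.cell i').2) ∈ (walk N T b D U i j B).val.edge (outEdge b D j')) ∧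
      ∀ i', InPiece U i' (outDist N b D (j' + 1)) →
        (T, b, (U.cell i').2) ∈ (walk N T b D U i j B).val.vert (outIdx b D (j' + 1)) := by
  induction hm : (U.len - i) + (outLen N b D - j) using Nat.strong_induction_on
    generalizing i j B with
  | _ m ih =>
    rw [walk]
    by_cases hj : outLen N b D ≤ j
    · simp only [hj, dite_true, val_op]
      exact ⟨Buckets.Sub.refl B, hB, fun j' h1 h2 => by omega⟩
    have hB₁ := B.sub_pushEdge (outEdge b D j) (T, b, (U.cell i).2)
    have hm₁ := B.mem_pushEdge (outEdge b D j) (T, b, (U.cell i).2)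
    have hw₁ := hB.pushEdge (outEdge b D j) (hZ i hi)
    set B₁ := B.pushEdge (outEdge b D j) (T, b, (U.cell i).2)
    have hB₂ := B₁.sub_pushVert (outIdx b D (j + 1)) (T, b, (U.cell i).2)
    have hm₂ := B₁.mem_pushVert (outIdx b D (j + 1)) (T, b, (U.cell i).2)
    have hw₂ := hw₁.pushVert (outIdx b D (j + 1)) (hZ i hi)
    set B₂ := B₁.pushVert (outIdx b D (j + 1)) (T, b, (U.cell i).2)
    -- the walk moves on to the next edge if the next piece does not begin on this one
    have next : (i + 1 < U.len → outDist N b D (j + 1) ≤ (U.cell (i + 1)).1) →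
        B.Sub (walk N T b D U i (j + 1) B₂).val ∧
        (walk N T b D U i (j + 1) B₂).val.Within Z ∧
        ∀ j', j ≤ j' → j' < outLen N b D →
          (∀ t ∈ Set.Ioc (outDist N b D j') (outDist N b D (j' + 1)), ∀ i', i ≤ i' →
            InPiece U i' t →
            (T, b, (U.cell i').2) ∈ (walk N T b D U i (j + 1) B₂).val.edge (outEdge b D j')) ∧
          ∀ i', InPiece U i' (outDist N b D (j' + 1)) →
            (T, b, (U.cell i').2) ∈
              (walk N T b D U i (j + 1) B₂).val.vert (outIdx b D (j' + 1)) := by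
      intro hnext
      obtain ⟨h1, h2, h3⟩ := ih ((U.len - i) + (outLen N b D - (j + 1))) (by omega) hi
        (fun h h' => (hij h (by omega)).trans (hp _ h')) hw₂ rfl
      refine ⟨hB₁.trans (hB₂.trans h1), h2, fun j' hjj hj' => ?_⟩
      rcases hjj.eq_or_lt with rfl | hjj
      · have hlast : ∀ t ≤ outDist N b D (j + 1), ∀ i', i ≤ i' → InPiece U i' t → i' = i := by
          intro t ht i' hii hi'
          by_contra hne
          have h4 := hU.cell_le (show i + 1 ≤ i' by omega) hi'.1
          have h5 := hi'.1
          linarith [hi'.2.1 (by omega), hnext (by omega)]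
        refine ⟨fun t ht i' hii hi' => ?_, fun i' hi' => ?_⟩
        · rw [hlast t ht.2 i' hii hi']
          exact h1.1 _ _ (hB₂.1 _ _ hm₁)
        · have hii : i ≤ i' := by
            by_contra hlt
            have h4 := hU.cell_le (show i' + 1 ≤ i by omega) hi
            linarith [hi'.2.2 (by omega), hij (by omega) (by omega)]
          rw [hlast _ le_rfl i' hii hi']
          exact h1.2 _ _ hm₂
      · exact h3 j' hjj hj'
    by_cases hi1 : i + 1 < U.len
    · simp only [hj, hi1, dite_true, dite_false, val_bind, val_op, apply_ite Timed.val,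
        decide_eq_true_eq]
      split_ifs with hc
      · obtain ⟨h1, h2, h3⟩ := ih ((U.len - (i + 1)) + (outLen N b D - j)) (by omega) hi1
          (fun _ _ => hc) hw₁ rfl
        refine ⟨hB₁.trans h1, h2, fun j' hjj hj' => ⟨fun t ht i' hii hi' => ?_, (h3 j' hjj hj').2⟩⟩
        rcases hii.eq_or_lt with rfl | hii
        · rcases hjj.eq_or_lt with rfl | hjj
          · exact h1.1 _ _ hm₁
          · -- the piece `i` has ended before the edge `j'`
            have h4 := le_of_succ_lt hp (show j + 1 ≤ j' by omega) hj'.le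
            linarith [hi'.2.2 hi1, ht.1]
        · exact (h3 j' hjj hj').1 t ht i' hii hi'
      · exact next fun _ => not_lt.1 hc
    · simp only [hj, hi1, dite_false, val_bind, val_op]
      exact next fun h => absurd h hi1

lemma enter_cost (n : ℕ) (B : Buckets) :
    (enter N T b D U B).time ≤ 3 * (U.len + outLen N b D) + 2 ∧
    (enter N T b D U B).val.size n ≤ B.size n + 2 * (U.len + outLen N b D) + 1 := by
  rw [enter]
  split_ifs
  · simp only [time_op, val_op]
    omega
  · have h1 := walk_cost (N := N) (T := T) (D := D) (b := b) (U := U) n 0 0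
      (B.pushVert b (T, b, (U.cell 0).2))
    have h2 := B.size_pushVert_le n b (T, b, (U.cell 0).2)
    simp only [time_bind, time_op, val_bind, val_op]
    omega

variable {μ : (ℕ → ℝ) → ℝ} {ws : List ℝ}

/-- The entries of `B` reach the regret of the scenario `z` everywhere on the path. -/
def Buckets.Covers (N : PathNetwork) (μ : (ℕ → ℝ) → ℝ) (B : Buckets) (z : Tag) : Prop :=
  (∀ k, 1 ≤ k → k ≤ N.n → ∃ y ∈ B.vert k,
    tagRegret N μ z (N.pos k) ≤ tagRegret N μ y (N.pos k)) ∧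
  ∀ k, 1 ≤ k → k < N.n → ∀ x ∈ Set.Ioo (N.pos k) (N.pos (k + 1)), ∃ y ∈ B.edge k,
    tagRegret N μ z x ≤ tagRegret N μ y x

lemma Buckets.Covers.mono {B B' : Buckets} {z : Tag} (h : B.Covers N μ z) (hB : B.Sub B') :
    B'.Covers N μ z := by
  refine ⟨fun k h1 h2 => ?_, fun k h1 h2 x hx => ?_⟩
  · obtain ⟨y, hy, h3⟩ := h.1 k h1 h2
    exact ⟨y, hB.2 _ _ hy, h3⟩
  · obtain ⟨y, hy, h3⟩ := h.2 k h1 h2 x hx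
    exact ⟨y, hB.1 _ _ hy, h3⟩

/-- The entries for one direction reach the regrets of the family on that side of `v_b`.  The set of
weights may be empty, and then there is nothing to enter. -/
lemma enter_spec (hb : 1 ≤ b) (hbn : b ≤ N.n) (hws : ∀ w ∈ ws, 0 ≤ w) (D : Side)
    {Z : Set Tag} (hZ : ∀ w ∈ ws, (T, b, w) ∈ Z) {B : Buckets} (hB : B.Within Z) :
    B.Sub (enter N T b D (halfEnvelope N μ T b ws D).val B).val ∧
    (enter N T b D (halfEnvelope N μ T b ws D).val B).val.Within Z ∧
    ∀ w ∈ ws,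
      (∀ j, j ≤ outLen N b D →
        ∃ y ∈ (enter N T b D (halfEnvelope N μ T b ws D).val B).val.vert (outIdx b D j),
          tagRegret N μ (T, b, w) (place N b D (outDist N b D j)) ≤
            tagRegret N μ y (place N b D (outDist N b D j))) ∧
      ∀ j, j < outLen N b D → ∀ t ∈ Set.Ioc (outDist N b D j) (outDist N b D (j + 1)),
        ∃ y ∈ (enter N T b D (halfEnvelope N μ T b ws D).val B).val.edge (outEdge b D j),
          tagRegret N μ (T, b, w) (place N b D t) ≤ tagRegret N μ y (place N b D t) := by
  have hp : ∀ j < outLen N b D, outDist N b D j < outDist N b D (j + 1) :=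
    fun j hj => outDist_lt hb hbn D hj
  rw [enter]
  split_ifs with hlen
  · have hnil : ws = [] := by
      by_contra hne
      have := (isEnv_halfEnvelope (μ := μ) (T := T) hb hbn hws hne D).len_pos
      omega
    subst hnil
    simp only [val_op]
    exact ⟨Buckets.Sub.refl B, hB, fun w hw => by simp at hw⟩
  · have hne : ws ≠ [] := by
      rintro rfl
      have := (halfEnvelope_time (μ := μ) (T := T) (ws := []) hbn D).1
      simp only [List.length_nil] at this
      omega
    have hE := isEnv_halfEnvelope (μ := μ) (T := T) hb hbn hws hne D
    set U := (halfEnvelope N μ T b ws D).val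
    simp only [val_bind, val_op]
    have hZ' : ∀ i < U.len, (T, b, (U.cell i).2) ∈ Z := fun i hi => hZ _ (hE.mem i hi)
    have hs := B.sub_pushVert b (T, b, (U.cell 0).2)
    obtain ⟨h1, h2, h3⟩ := walk_spec (i := 0) (j := 0) hE.ordered hp hZ' hE.len_pos
      (fun h => absurd h (by omega)) (hB.pushVert b (hZ' 0 hE.len_pos))
    refine ⟨hs.trans h1, h2, fun w hw => ⟨fun j hj => ?_, fun j hj t ht => ?_⟩⟩
    · have hmem : outDist N b D j ∈
          Set.Icc (outDist N b D 0) (outDist N b D (outLen N b D)) :=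
        ⟨le_of_succ_lt hp (Nat.zero_le j) hj, le_of_succ_lt hp hj le_rfl⟩
      cases j with
      | zero =>
        refine ⟨(T, b, (U.cell 0).2), h1.2 _ _ ?_, hE.max 0 _ hmem hE.inPiece_zero w hw⟩
        have : outIdx b D 0 = b := by cases D <;> simp [outIdx]
        rw [this]
        exact B.mem_pushVert _ _
      | succ j =>
        obtain ⟨i, hi, -⟩ := exists_inPiece hE.len_pos (outDist N b D (j + 1))
        exact ⟨_, (h3 j (Nat.zero_le j) hj).2 i hi, hE.max i _ hmem hi w hw⟩
    · obtain ⟨i, hi, -⟩ := exists_inPiece hE.len_pos t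
      refine ⟨_, (h3 j (Nat.zero_le j) hj).1 t ht i (Nat.zero_le i) hi, hE.max i t ?_ hi w hw⟩
      exact ⟨(le_of_succ_lt hp (Nat.zero_le j) hj.le).trans ht.1.le,
        ht.2.trans (le_of_succ_lt hp hj le_rfl)⟩

lemma enter_both_spec (hb : 1 ≤ b) (hbn : b ≤ N.n) (hws : ∀ w ∈ ws, 0 ≤ w)
    {Z : Set Tag} (hZ : ∀ w ∈ ws, (T, b, w) ∈ Z) {B B' : Buckets} (hB : B.Within Z)
    (hB' : B' = (enter N T b Side.R (halfEnvelope N μ T b ws Side.R).val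
      (enter N T b Side.L (halfEnvelope N μ T b ws Side.L).val B).val).val) :
    B.Sub B' ∧ B'.Within Z ∧ ∀ w ∈ ws, B'.Covers N μ (T, b, w) := by
  obtain ⟨h1, h2, h3⟩ := enter_spec (μ := μ) hb hbn hws Side.L hZ hB
  obtain ⟨h4, h5, h6⟩ := enter_spec (μ := μ) hb hbn hws Side.R hZ h2
  rw [← hB'] at h4 h5 h6
  refine ⟨h1.trans h4, h5, fun w hw => ⟨fun k hk hkn => ?_, fun k hk hkn x hx => ?_⟩⟩
  · rcases Nat.lt_or_ge k b with hkb | hkb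
    · have hj : b - k ≤ outLen N b Side.L := by simp only [outLen]; omega
      obtain ⟨y, hy, h7⟩ := (h3 w hw).1 (b - k) hj
      have hidx : outIdx b Side.L (b - k) = k := by simp only [outIdx]; omega
      rw [place_outDist hb hbn Side.L hj] at h7
      rw [hidx] at hy h7
      exact ⟨y, h4.2 _ _ hy, h7⟩
    · have hj : k - b ≤ outLen N b Side.R := by simp only [outLen]; omega
      obtain ⟨y, hy, h7⟩ := (h6 w hw).1 (k - b) hj
      have hidx : outIdx b Side.R (k - b) = k := by simp only [outIdx]; omega
      rw [place_outDist hb hbn Side.R hj] at h7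
      rw [hidx] at hy h7
      exact ⟨y, hy, h7⟩
  · rcases Nat.lt_or_ge k b with hkb | hkb
    · have hj : b - 1 - k < outLen N b Side.L := by simp only [outLen]; omega
      obtain ⟨y, hy, h7⟩ := (h3 w hw).2 (b - 1 - k) hj (N.pos b - x) (by
        rw [outDist_L hbn (by omega), outDist_L hbn (by omega),
          show b - (b - 1 - k) = k + 1 by omega, show b - (b - 1 - k + 1) = k by omega]
        constructor <;> linarith [hx.1, hx.2])
      have hidx : outEdge b Side.L (b - 1 - k) = k := by simp only [outEdge]; omega
      rw [hidx] at hy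
      simp only [place, sub_sub_cancel] at h7
      exact ⟨y, h4.1 _ _ hy, h7⟩
    · have hj : k - b < outLen N b Side.R := by simp only [outLen]; omega
      obtain ⟨y, hy, h7⟩ := (h6 w hw).2 (k - b) hj (x - N.pos b) (by
        rw [outDist_R hb (by omega), outDist_R hb (by omega),
          show b + (k - b) = k by omega, show b + (k - b + 1) = k + 1 by omega]
        constructor <;> linarith [hx.1, hx.2])
      have hidx : outEdge b Side.R (k - b) = k := by simp only [outEdge]; omega
      rw [hidx] at hy
      simp only [place, add_sub_cancel] at h7
      exact ⟨y, hy, h7⟩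

/-- The scenarios of a list of families, as tags. -/
def tagsOf (fams : List (Side × ℕ × List ℝ)) : Set Tag :=
  {z | ∃ f ∈ fams, z.1 = f.1 ∧ z.2.1 = f.2.1 ∧ z.2.2 ∈ f.2.2}

/-- The number of scenarios in a list of families. -/
def numTags (fams : List (Side × ℕ × List ℝ)) : ℕ := (fams.map fun f => f.2.2.length).sum

/-- The boundary vertices are vertices of the path, and their weights are nonnegative. -/
def Admissible (N : PathNetwork) (fams : List (Side × ℕ × List ℝ)) : Prop :=
  ∀ f ∈ fams, 1 ≤ f.2.1 ∧ f.2.1 ≤ N.n ∧ ∀ w ∈ f.2.2, 0 ≤ w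

lemma collect_spec {Z : Set Tag} (fams : List (Side × ℕ × List ℝ)) :
    ∀ B : Buckets, Admissible N fams → tagsOf fams ⊆ Z → B.Within Z →
      B.Sub (collect N μ fams B).val ∧ (collect N μ fams B).val.Within Z ∧
      ∀ z ∈ tagsOf fams, (collect N μ fams B).val.Covers N μ z := by
  induction fams with
  | nil =>
    intro B _ _ hB
    simp only [collect, val_op]
    exact ⟨Buckets.Sub.refl B, hB, fun z ⟨f, hf, _⟩ => by simp at hf⟩
  | cons f rest ih =>
    intro B hadm hZ hB
    obtain ⟨T, b, ws⟩ := f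
    obtain ⟨hb, hbn, hws⟩ := hadm _ List.mem_cons_self
    simp only at hb hbn hws
    simp only [collect, val_bind, algorithmThree_val]
    obtain ⟨h1, h2, h3⟩ := enter_both_spec (T := T) (μ := μ) hb hbn hws
      (fun w hw => hZ ⟨_, List.mem_cons_self, rfl, rfl, hw⟩) hB rfl
    obtain ⟨h4, h5, h6⟩ := ih _ (fun f hf => hadm f (List.mem_cons_of_mem _ hf))
      (fun z ⟨f, hf, h⟩ => hZ ⟨f, List.mem_cons_of_mem _ hf, h⟩) h2
    refine ⟨h1.trans h4, h5, ?_⟩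
    rintro ⟨T', b', w⟩ ⟨f, hf, hT, hb', hw⟩
    rw [List.mem_cons] at hf
    rcases hf with rfl | hf
    · simp only at hT hb' hw
      subst hT hb'
      exact (h3 w hw).mono h4
    · exact h6 _ ⟨f, hf, hT, hb', hw⟩

lemma collect_cost (K : ℕ) (fams : List (Side × ℕ × List ℝ)) :
    ∀ B : Buckets, Admissible N fams → numTags fams ≤ K →
      (collect N μ fams B).time ≤
        46 * (numTags fams * (Nat.clog 2 K + Nat.clog 2 N.n + 1))
          + fams.length * (6 * N.n + 9) + 1 ∧
      (collect N μ fams B).val.size N.n ≤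
        B.size N.n + 4 * numTags fams + fams.length * (4 * N.n + 2) := by
  induction fams with
  | nil => intro B _ _; simp [collect]
  | cons f rest ih =>
    intro B hadm hK
    obtain ⟨T, b, ws⟩ := f
    obtain ⟨hb, hbn, hws⟩ := hadm _ List.mem_cons_self
    simp only at hb hbn hws
    have hnum : numTags ((T, b, ws) :: rest) = ws.length + numTags rest := by
      simp [numTags]
    rw [hnum] at hK ⊢
    rw [List.length_cons]
    simp only [collect, val_bind, time_bind, algorithmThree_val]
    have h0 := algorithmThree_time (μ := μ) (T := T) (ws := ws) hbn
    have h1 := (halfEnvelope_time (μ := μ) (T := T) (ws := ws) hbn Side.L).1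
    have h2 := (halfEnvelope_time (μ := μ) (T := T) (ws := ws) hbn Side.R).1
    have h3 := enter_cost (N := N) (T := T) (b := b) (D := Side.L)
      (U := (halfEnvelope N μ T b ws Side.L).val) N.n B
    set B₁ := (enter N T b Side.L (halfEnvelope N μ T b ws Side.L).val B).val
    have h4 := enter_cost (N := N) (T := T) (b := b) (D := Side.R)
      (U := (halfEnvelope N μ T b ws Side.R).val) N.n B₁
    have h5 := ih (enter N T b Side.R (halfEnvelope N μ T b ws Side.R).val B₁).val
      (fun f hf => hadm f (List.mem_cons_of_mem _ hf)) (by omega)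
    have h6 : outLen N b Side.L + outLen N b Side.R + 1 = N.n := by
      simp only [outLen]; omega
    have h7 : ws.length * (Nat.clog 2 ws.length + Nat.clog 2 N.n + 1) ≤
        ws.length * (Nat.clog 2 K + Nat.clog 2 N.n + 1) := by
      gcongr
      omega
    have h8 : ws.length ≤ ws.length * (Nat.clog 2 K + Nat.clog 2 N.n + 1) :=
      Nat.le_mul_of_pos_right _ (Nat.succ_pos _)
    rw [add_mul, add_mul, add_mul, one_mul, one_mul]
    constructor <;> omega

end Collect

end EvacPath

namespace EvacPath

open Finset PathNetwork

/-! ### The explicit envelope -/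

section Finish

variable {N : PathNetwork} {μ : (ℕ → ℝ) → ℝ}

lemma vertexMax_spec (k : ℕ) {l : List Tag} (hl : l ≠ []) :
    (∃ z ∈ l, (vertexMax N μ k l).val = tagRegret N μ z (N.pos k)) ∧
      ∀ z ∈ l, tagRegret N μ z (N.pos k) ≤ (vertexMax N μ k l).val := by
  induction l with
  | nil => exact absurd rfl hl
  | cons z l ih =>
    cases l with
    | nil => simp [vertexMax]
    | cons z' rest =>
      obtain ⟨⟨y, hy, h1⟩, h2⟩ := ih (List.cons_ne_nil _ _)
      simp only [vertexMax, val_bind, val_op]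
      constructor
      · rcases max_choice (tagRegret N μ z (N.pos k)) (vertexMax N μ k (z' :: rest)).val with h | h
        · exact ⟨z, List.mem_cons_self, h⟩
        · exact ⟨y, List.mem_cons_of_mem _ hy, h.trans h1⟩
      · intro x hx
        rw [List.mem_cons] at hx
        rcases hx with rfl | hx
        · exact le_max_left _ _
        · exact (h2 x hx).trans (le_max_right _ _)

lemma vertexMax_time (k : ℕ) (l : List Tag) : (vertexMax N μ k l).time ≤ l.length + 1 := by
  induction l with
  | nil => simp [vertexMax]
  | cons z l ih =>
    cases l with
    | nil => simp [vertexMax]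
    | cons z' rest =>
      simp only [vertexMax, time_bind, time_op, List.length_cons] at ih ⊢
      omega

lemma edgeLines_val (k : ℕ) (l : List Tag) :
    (edgeLines N μ k l).val = l.map (edgeLine N μ k) := by
  induction l with
  | nil => simp [edgeLines]
  | cons z l ih => simp [edgeLines, ih]

lemma edgeLines_time (k : ℕ) (l : List Tag) : (edgeLines N μ k l).time = l.length + 1 := by
  induction l with
  | nil => simp [edgeLines]
  | cons z l ih => simp [edgeLines, ih]

lemma edgeLine_value {k : ℕ} (hk : 1 ≤ k) (hkn : k < N.n) (z : Tag) {x : ℝ}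
    (hx : x ∈ Set.Ioo (N.pos k) (N.pos (k + 1))) :
    (edgeLine N μ k z).value (x - N.pos k) = tagRegret N μ z x := by
  obtain ⟨α, β, h⟩ := N.regret_affine_on_edge μ (N.pseudo z.1 z.2.1 z.2.2) hkn
  have hlen := N.len_pos k hk hkn
  have h1 := h x hx
  rw [N.pos_succ hk] at h
  have h2 := h (N.pos k + N.len k / 3) ⟨by linarith, by linarith⟩
  have h3 := h (N.pos k + 2 * N.len k / 3) ⟨by linarith, by linarith⟩
  simp only [edgeLine, Line.value, tagRegret, h1, h2, h3]
  field_simp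
  ring

/-- The lines of the entries for the edge `e_k`. -/
def bucketLines (N : PathNetwork) (μ : (ℕ → ℝ) → ℝ) (B : Buckets) (k : ℕ) : List Line :=
  (B.edge k).map (edgeLine N μ k)

/-- The upper envelope of the entries for the edge `e_k`. -/
def bucketEnv (N : PathNetwork) (μ : (ℕ → ℝ) → ℝ) (B : Buckets) (k : ℕ) : Timed (Env Line) :=
  upperEnvelope Line.value (fun j => j * N.len k) 1 Line.slope (bucketLines N μ B k)

lemma finish_val (B : Buckets) (m : ℕ) {k : ℕ} (hk : 1 ≤ k) (hkm : k ≤ m) :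
    (finish N μ B m).val.edge k = (bucketEnv N μ B k).val ∧
    (finish N μ B m).val.vert k = (vertexMax N μ k (B.vert k)).val := by
  induction m with
  | zero => omega
  | succ m ih =>
    simp only [finish, val_bind, val_op, edgeLines_val]
    rcases eq_or_ne k (m + 1) with rfl | h
    · simp [bucketEnv, bucketLines]
    · simp only [Function.update_of_ne h]
      exact ih (by omega)

lemma finish_time (K : ℕ) (B : Buckets) (m : ℕ)
    (hK : ∀ k, 1 ≤ k → k ≤ m → (B.edge k).length ≤ K) :
    (finish N μ B m).time ≤
      ∑ k ∈ Icc 1 m, ((B.edge k).length + (B.vert k).length) * (20 * (Nat.clog 2 K + 1) + 1)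
        + 5 * m + 1 := by
  induction m with
  | zero => simp [finish]
  | succ m ih =>
    have h0 := ih fun k h1 h2 => hK k h1 (by omega)
    rw [sum_Icc_succ_top (by omega)]
    simp only [finish, time_bind, time_op]
    have h1 := vertexMax_time (N := N) (μ := μ) (m + 1) (B.vert (m + 1))
    have h2 := edgeLines_time (N := N) (μ := μ) (m + 1) (B.edge (m + 1))
    have h3 := (upperEnvelope_time (val := Line.value) (p := fun j => j * N.len (m + 1)) (M := 1)
      Line.slope (edgeLines N μ (m + 1) (B.edge (m + 1))).val).2
    have h4 : (edgeLines N μ (m + 1) (B.edge (m + 1))).val.length = (B.edge (m + 1)).length := by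
      rw [edgeLines_val, List.length_map]
    rw [h4, Nat.clog_one_right, add_zero] at h3
    have h5 : (B.edge (m + 1)).length * (Nat.clog 2 (B.edge (m + 1)).length + 1) ≤
        (B.edge (m + 1)).length * (Nat.clog 2 K + 1) := by
      gcongr
      exact hK _ (by omega) le_rfl
    have h6 : (B.vert (m + 1)).length ≤
        (B.vert (m + 1)).length * (20 * (Nat.clog 2 K + 1) + 1) :=
      Nat.le_mul_of_pos_right _ (Nat.succ_pos _)
    have h7 : (B.edge (m + 1)).length * (20 * (Nat.clog 2 K + 1) + 1) =
      20 * ((B.edge (m + 1)).length * (Nat.clog 2 K + 1)) + (B.edge (m + 1)).length := by ring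
    rw [add_mul (B.edge (m + 1)).length]
    omega

lemma isEnv_bucketEnv {B : Buckets} {k : ℕ} (hk : 1 ≤ k) (hkn : k < N.n) (hB : B.edge k ≠ []) :
    IsEnv Line.value (fun j => j * N.len k) 1 (bucketEnv N μ B k).val
      {l | l ∈ bucketLines N μ B k} := by
  refine IsEnv.upperEnvelope ?_ ?_ ?_
  · intro j hj
    have := N.len_pos k hk hkn
    push_cast
    linarith
  · simpa [bucketLines] using hB
  · intro f _ s _ h
    have h1 : ∀ t, s.value t - f.value t = (s.slope - f.slope) * t + (s.icept - f.icept) := by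
      intro t
      simp only [Line.value]
      ring
    refine ⟨fun t _ t' _ htt => ?_, fun j _ => ⟨_, _, fun t _ => h1 t⟩⟩
    simp only [h1]
    have := sub_nonneg.2 h
    gcongr

/-- The scenarios of a list of families. -/
def scenariosOf (N : PathNetwork) (fams : List (Side × ℕ × List ℝ)) : Set (ℕ → ℝ) :=
  (fun z : Tag => N.pseudo z.1 z.2.1 z.2.2) '' tagsOf fams

variable {fams : List (Side × ℕ × List ℝ)}

lemma bucket_ne_nil {B : Buckets} {z : Tag} (hB : B.Covers N μ z) :
    (∀ k, 1 ≤ k → k ≤ N.n → B.vert k ≠ []) ∧ ∀ k, 1 ≤ k → k < N.n → B.edge k ≠ [] := by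
  refine ⟨fun k h1 h2 h => ?_, fun k h1 h2 h => ?_⟩
  · obtain ⟨y, hy, -⟩ := hB.1 k h1 h2
    simp [h] at hy
  · have h3 := N.pos_lt h1 (Nat.lt_succ_self k) h2
    obtain ⟨y, hy, -⟩ := hB.2 k h1 h2 ((N.pos k + N.pos (k + 1)) / 2)
      ⟨by linarith, by linarith⟩
    simp [h] at hy

/-- If the entries belong to the given families and reach all their regrets, then the maxima at the
vertices and on the edges are those of the families. -/
lemma describes_finish {B : Buckets} (hne : (tagsOf fams).Nonempty)
    (hB : B.Within (tagsOf fams)) (hcov : ∀ z ∈ tagsOf fams, B.Covers N μ z) :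
    (finish N μ B N.n).val.Describes N μ (scenariosOf N fams) := by
  obtain ⟨z₀, hz₀⟩ := hne
  obtain ⟨hv, he⟩ := bucket_ne_nil (hcov z₀ hz₀)
  refine ⟨fun k hk hkn => ?_, fun k hk hkn => ?_⟩
  · rw [(finish_val B N.n hk hkn).2]
    obtain ⟨⟨y, hy, h1⟩, h2⟩ := vertexMax_spec (N := N) (μ := μ) k (hv k hk hkn)
    constructor
    · exact ⟨_, ⟨y, hB.2 _ _ hy, rfl⟩, h1.symm⟩
    · rintro _ ⟨_, ⟨z, hz, rfl⟩, rfl⟩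
      obtain ⟨y, hy, h3⟩ := (hcov z hz).1 k hk hkn
      exact h3.trans (h2 y hy)
  · rw [(finish_val B N.n hk hkn.le).1]
    have hE := isEnv_bucketEnv (μ := μ) hk hkn (he k hk hkn)
    refine ⟨hE.ordered, fun x hx => ?_⟩
    obtain ⟨i, hi, hi'⟩ := exists_inPiece hE.len_pos (x - N.pos k)
    rw [hi']
    have hmem : x - N.pos k ∈ Set.Icc (((0 : ℕ) : ℝ) * N.len k) (((1 : ℕ) : ℝ) * N.len k) := by
      rw [N.pos_succ hk] at hx
      simp only [Nat.cast_zero, zero_mul, Nat.cast_one, one_mul]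
      constructor <;> linarith [hx.1, hx.2]
    constructor
    · obtain ⟨z, hz, h1⟩ := List.mem_map.1 (hE.mem i hi.1)
      refine ⟨_, ⟨z, hB.1 _ _ hz, rfl⟩, ?_⟩
      rw [← h1, edgeLine_value hk hkn z hx]
      rfl
    · rintro _ ⟨_, ⟨z, hz, rfl⟩, rfl⟩
      obtain ⟨y, hy, h3⟩ := (hcov z hz).2 k hk hkn x hx
      refine h3.trans ?_
      rw [← edgeLine_value (μ := μ) hk hkn y hx]
      exact hE.max i _ hmem hi _ (List.mem_map_of_mem hy)

/-- The entries for the edges and vertices. -/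
def bucketsOf (N : PathNetwork) (μ : (ℕ → ℝ) → ℝ) (fams : List (Side × ℕ × List ℝ)) : Buckets :=
  (collect N μ fams ⟨fun _ => [], fun _ => []⟩).val

lemma totalEnvelope_val :
    (totalEnvelope N μ fams).val = (finish N μ (bucketsOf N μ fams) N.n).val := by
  simp only [totalEnvelope, val_bind, bucketsOf]

lemma bucketsOf_spec (hadm : Admissible N fams) :
    (bucketsOf N μ fams).Within (tagsOf fams) ∧
      ∀ z ∈ tagsOf fams, (bucketsOf N μ fams).Covers N μ z :=
  (collect_spec (Z := tagsOf fams) fams _ hadm subset_rfl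
    ⟨fun _ _ h => by simp at h, fun _ _ h => by simp at h⟩).2

lemma size_bucketsOf_le (hadm : Admissible N fams) :
    (bucketsOf N μ fams).size N.n ≤ 4 * numTags fams + fams.length * (4 * N.n + 2) := by
  have h := (collect_cost (μ := μ) (numTags fams) fams ⟨fun _ => [], fun _ => []⟩ hadm le_rfl).2
  simpa [Buckets.size, bucketsOf] using h

lemma totalEnvelope_describes (hadm : Admissible N fams) (hne : (tagsOf fams).Nonempty) :
    (totalEnvelope N μ fams).val.Describes N μ (scenariosOf N fams) := by
  rw [totalEnvelope_val]
  obtain ⟨h1, h2⟩ := bucketsOf_spec (μ := μ) hadm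
  exact describes_finish hne h1 h2

lemma totalEnvelope_time (hadm : Admissible N fams) {S : ℕ}
    (hS : 4 * numTags fams + fams.length * (4 * N.n + 2) ≤ S) :
    (totalEnvelope N μ fams).time ≤
      46 * (numTags fams * (Nat.clog 2 S + Nat.clog 2 N.n + 1))
        + fams.length * (6 * N.n + 9) + S * (20 * (Nat.clog 2 S + 1) + 1) + 5 * N.n + 2 := by
  have h1 := (collect_cost (μ := μ) S fams ⟨fun _ => [], fun _ => []⟩ hadm (by omega)).1
  have h2 := size_bucketsOf_le (μ := μ) hadm
  have h3 := finish_time (N := N) (μ := μ) S (bucketsOf N μ fams) N.n (by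
    intro k hk hkn
    have h4 : ((bucketsOf N μ fams).edge k).length + ((bucketsOf N μ fams).vert k).length ≤
        (bucketsOf N μ fams).size N.n :=
      single_le_sum (f := fun k => ((bucketsOf N μ fams).edge k).length
        + ((bucketsOf N μ fams).vert k).length) (fun _ _ => Nat.zero_le _) (mem_Icc.2 ⟨hk, hkn⟩)
    omega)
  rw [← sum_mul] at h3
  have h5 : (bucketsOf N μ fams).size N.n * (20 * (Nat.clog 2 S + 1) + 1) ≤
      S * (20 * (Nat.clog 2 S + 1) + 1) := Nat.mul_le_mul (h2.trans hS) le_rfl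
  simp only [Buckets.size] at h5
  simp only [bucketsOf] at h3 h5
  simp only [totalEnvelope, time_bind]
  omega

end Finish

/-! ### Counting line segments -/

section Segments

variable {N : PathNetwork} {μ : (ℕ → ℝ) → ℝ}

lemma HasSegments.append {f : ℝ → ℝ} {a b c : ℝ} {M M' : ℕ} (h : HasSegments f a b M)
    (h' : HasSegments f b c M') : HasSegments f a c (M + M') := by
  obtain ⟨t, ht, h0, hM, haff⟩ := h
  obtain ⟨t', ht', h0', hM', haff'⟩ := h'
  have e1 : ∀ i, i ≤ M → (if i ≤ M then t i else t' (i - M)) = t i := fun i hi => if_pos hi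
  have e2 : ∀ i, M ≤ i → (if i ≤ M then t i else t' (i - M)) = t' (i - M) := by
    intro i hi
    split_ifs with h
    · obtain rfl : i = M := by omega
      rw [hM, Nat.sub_self, h0']
    · rfl
  refine ⟨fun i => if i ≤ M then t i else t' (i - M), monotone_nat_of_le_succ fun i => ?_, ?_, ?_,
    fun i hi => ?_⟩
  · rcases Nat.lt_or_ge i M with h | h
    · rw [e1 i h.le, e1 (i + 1) h]
      exact ht (Nat.le_succ i)
    · rw [e2 i h, e2 (i + 1) (by omega)]
      exact ht' (by omega)
  · exact (e1 0 (Nat.zero_le M)).trans h0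
  · exact (e2 (M + M') (by omega)).trans (by rw [Nat.add_sub_cancel_left, hM'])
  · simp only
    rcases Nat.lt_or_ge i M with h | h
    · rw [e1 i h.le, e1 (i + 1) h]
      exact haff i h
    · rw [e2 i h, e2 (i + 1) (by omega), show i + 1 - M = i - M + 1 by omega]
      exact haff' (i - M) (by omega)

/-- An envelope of lines is affine on each of its pieces. -/
lemma hasSegments_of_env {f : ℝ → ℝ} {a : ℝ} {p : ℕ → ℝ} {E : Env Line} {A : Set Line}
    (hE : IsEnv Line.value p 1 E A) (h0 : p 0 = 0) (h1 : 0 ≤ p 1)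
    (hf : ∀ x ∈ Set.Ioo a (a + p 1), f x = (E.active (x - a)).value (x - a)) :
    HasSegments f a (a + p 1) E.len := by
  have hlen := hE.len_pos
  have hle : ∀ i < E.len, 0 ≤ (E.cell i).1 ∧ (E.cell i).1 ≤ p 1 := by
    intro i hi
    rcases Nat.eq_zero_or_pos i with rfl | h
    · rw [hE.first, h0]
      exact ⟨le_rfl, h1⟩
    · have := hE.bounds i h hi
      rw [h0] at this
      exact ⟨this.1, this.2.le⟩
  have e1 : ∀ i, i < E.len → (if i < E.len then a + (E.cell i).1 else a + p 1) =
    a + (E.cell i).1 := fun i hi => if_pos hi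
  have e2 : ∀ i, E.len ≤ i → (if i < E.len then a + (E.cell i).1 else a + p 1) =
    a + p 1 := fun i hi => if_neg (by omega)
  refine ⟨fun i => if i < E.len then a + (E.cell i).1 else a + p 1,
    monotone_nat_of_le_succ fun i => ?_, ?_, ?_, fun i hi => ?_⟩
  · rcases Nat.lt_or_ge i E.len with h | h
    · rw [e1 i h]
      rcases Nat.lt_or_ge (i + 1) E.len with h' | h'
      · rw [e1 _ h']
        linarith [hE.ordered.2 i h']
      · rw [e2 _ h']
        linarith [(hle i h).2]
    · rw [e2 i h, e2 (i + 1) (by omega)]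
  · exact (e1 0 hlen).trans (by rw [hE.first, h0, add_zero])
  · exact e2 _ le_rfl
  · refine ⟨(E.cell i).2.slope, (E.cell i).2.icept - (E.cell i).2.slope * a, fun x hx => ?_⟩
    simp only [e1 i hi] at hx
    have hx' : x < a + p 1 ∧ (i + 1 < E.len → x - a ≤ (E.cell (i + 1)).1) := by
      rcases Nat.lt_or_ge (i + 1) E.len with h' | h'
      · rw [e1 _ h'] at hx
        exact ⟨by linarith [hx.2, (hle _ h').2], fun _ => by linarith [hx.2]⟩
      · rw [e2 _ h'] at hx
        exact ⟨hx.2, fun h => by omega⟩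
    have hpiece : InPiece E i (x - a) := ⟨hi, fun _ => by linarith [hx.1], hx'.2⟩
    rw [hf x ⟨by linarith [hx.1, (hle i hi).1], hx'.1⟩, active_eq hE.ordered hpiece, Line.value]
    ring

variable {fams : List (Side × ℕ × List ℝ)}

lemma hasSegments_upperEnvelope (hadm : Admissible N fams) (hne : (tagsOf fams).Nonempty)
    {U : ℝ → ℝ} (hU : N.IsUpperEnvelope μ (scenariosOf N fams) U) (hn : 1 ≤ N.n) :
    ∃ M ≤ 4 * numTags fams + fams.length * (4 * N.n + 2),
      HasSegments U (N.pos 1) (N.pos N.n) M := by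
  obtain ⟨hB, hcov⟩ := bucketsOf_spec (μ := μ) hadm
  obtain ⟨z₀, hz₀⟩ := hne
  have hdesc := describes_finish ⟨z₀, hz₀⟩ hB hcov
  have he := (bucket_ne_nil (hcov z₀ hz₀)).2
  set B := bucketsOf N μ fams
  have key : ∀ m, 1 ≤ m → m ≤ N.n →
      HasSegments U (N.pos 1) (N.pos m) (∑ k ∈ Ico 1 m, (bucketEnv N μ B k).val.len) := by
    intro m hm
    induction m, hm using Nat.le_induction with
    | base =>
      intro _
      exact ⟨fun _ => N.pos 1, monotone_const, rfl, rfl, fun i hi => by simp at hi⟩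
    | succ k hk ih =>
      intro hkn
      rw [sum_Ico_succ_top hk]
      refine (ih (by omega)).append ?_
      have hpos := N.pos_succ hk
      have h1 : ((1 : ℕ) : ℝ) * N.len k = N.len k := by simp
      have hlt : k < N.n := hkn
      rw [hpos, ← h1]
      refine hasSegments_of_env (isEnv_bucketEnv (μ := μ) hk hlt (he k hk hlt)) (by simp)
        (by rw [h1]; exact (N.len_pos k hk hlt).le) fun x hx => ?_
      rw [h1, ← hpos] at hx
      have h2 := (hdesc.2 k hk hlt).2 x hx
      rw [(finish_val B N.n hk hlt.le).1] at h2
      refine (hU x ?_).unique h2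
      exact ⟨(N.pos_le le_rfl hk hlt.le).trans hx.1.le,
        hx.2.le.trans (N.pos_le (by omega) hlt le_rfl)⟩
  refine ⟨_, ?_, key N.n hn le_rfl⟩
  refine le_trans ?_ (size_bucketsOf_le (μ := μ) hadm)
  have h1 : ∀ k, (bucketEnv N μ B k).val.len ≤ (B.edge k).length + (B.vert k).length := by
    intro k
    have h2 : (bucketEnv N μ B k).val.len ≤ (bucketLines N μ B k).length :=
      (upperEnvelope_time Line.slope (bucketLines N μ B k)).1
    rw [bucketLines, List.length_map] at h2
    omega
  refine (sum_le_sum fun k _ => h1 k).trans ?_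
  exact sum_le_sum_of_subset (fun k hk => by rw [mem_Ico] at hk; rw [mem_Icc]; omega)

lemma exists_isUpperEnvelope {A : Set (ℕ → ℝ)} (hA : A.Finite) (hne : A.Nonempty) :
    ∃ U : ℝ → ℝ, N.IsUpperEnvelope μ A U :=
  ⟨fun x => sSup ((fun s => N.regret μ s x) '' A), fun _ _ =>
    (hA.image _).isCompact.isGreatest_sSup (hne.image _)⟩

end Segments

end EvacPath

namespace EvacPath

open Finset PathNetwork

/-! ### The bounds in terms of the size of the path -/

section Bounds

lemma clog_two_le_log {n : ℕ} (hn : 2 ≤ n) : (Nat.clog 2 n : ℝ) ≤ 3 * Real.log n := by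
  have h1 := Nat.pow_pred_clog_lt_self one_lt_two (show 1 < n by omega)
  have h2 : 0 < Nat.clog 2 n := Nat.clog_pos one_lt_two hn
  obtain ⟨L, hL⟩ : ∃ L, Nat.clog 2 n = L + 1 := ⟨_, (Nat.succ_pred_eq_of_pos h2).symm⟩
  rw [hL, Nat.pred_succ] at h1
  have h3 : (L : ℝ) * Real.log 2 ≤ Real.log n := by
    rw [← Real.log_pow]
    apply Real.log_le_log (by positivity)
    exact_mod_cast h1.le
  have h4 : Real.log 2 ≤ Real.log n := Real.log_le_log two_pos (by exact_mod_cast hn)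
  have h5 := Real.log_two_gt_d9
  rw [hL]
  push_cast
  have h6 : (0 : ℝ) ≤ L := Nat.cast_nonneg L
  nlinarith

lemma clog_two_le_of_le {n m a : ℕ} (h : m ≤ 2 ^ a * n ^ 2) :
    Nat.clog 2 m ≤ 2 * Nat.clog 2 n + a := by
  apply Nat.clog_le_of_le_pow
  refine h.trans ?_
  rw [pow_add, mul_comm, pow_mul']
  exact Nat.mul_le_mul (Nat.pow_le_pow_left (Nat.le_pow_clog one_lt_two n) 2) le_rfl

variable {N : PathNetwork} {μ : (ℕ → ℝ) → ℝ} {fams : List (Side × ℕ × List ℝ)}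

lemma totalEnvelope_time_le (hadm : Admissible N fams) (hn : 2 ≤ N.n) (hF1 : 1 ≤ fams.length)
    (hF : fams.length ≤ 2 * N.n) (hm : numTags fams ≤ 4 * N.n ^ 2) :
    ((totalEnvelope N μ fams).time : ℝ) ≤
      4800 * (((numTags fams : ℝ) + fams.length * N.n) * Real.log N.n) := by
  obtain ⟨X, hX⟩ : ∃ X, X = numTags fams + fams.length * N.n := ⟨_, rfl⟩
  have hFn : fams.length ≤ fams.length * N.n := Nat.le_mul_of_pos_right _ (by omega)
  have hnF : N.n ≤ fams.length * N.n := Nat.le_mul_of_pos_left _ (by omega)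
  have hFnn : fams.length * N.n ≤ 2 * N.n ^ 2 := by
    calc fams.length * N.n ≤ 2 * N.n * N.n := Nat.mul_le_mul hF le_rfl
      _ = 2 * N.n ^ 2 := by ring
  have h1 := totalEnvelope_time (μ := μ) hadm (S := 6 * X) (by rw [mul_add]; lia)
  have h2 : Nat.clog 2 (6 * X) ≤ 2 * Nat.clog 2 N.n + 6 := clog_two_le_of_le (by omega)
  have h3 : 1 ≤ Nat.clog 2 N.n := Nat.clog_pos one_lt_two hn
  have h4 := clog_two_le_log hn
  generalize Nat.clog 2 N.n = L at *
  have hXL : X ≤ X * L := Nat.le_mul_of_pos_right _ (by omega)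
  have h5 : numTags fams * (Nat.clog 2 (6 * X) + L + 1) ≤ X * (10 * L) :=
    Nat.mul_le_mul (by omega) (by omega)
  have h6 : 6 * X * (20 * (Nat.clog 2 (6 * X) + 1) + 1) ≤ 6 * X * (181 * L) :=
    Nat.mul_le_mul le_rfl (by omega)
  have h7 : fams.length * (6 * N.n + 9) = 6 * (fams.length * N.n) + 9 * fams.length := by ring
  have h8 : X * (10 * L) = 10 * (X * L) := by ring
  have h9 : 6 * X * (181 * L) = 1086 * (X * L) := by ring
  have h10 : (totalEnvelope N μ fams).time ≤ 1600 * (X * L) := by omega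
  have h11 : ((totalEnvelope N μ fams).time : ℝ) ≤ 1600 * (X * L) := by exact_mod_cast h10
  have h12 : (X : ℝ) = numTags fams + fams.length * N.n := by rw [hX]; push_cast; rfl
  rw [← h12]
  calc ((totalEnvelope N μ fams).time : ℝ) ≤ 1600 * (X * L) := h11
    _ ≤ 1600 * (X * (3 * Real.log N.n)) := by gcongr
    _ = _ := by ring

variable {T : Side} {b : ℕ}

lemma two_le_of_mem_critWeights {w : ℝ} (h : w ∈ N.critWeights T b) : 2 ≤ N.n := by
  obtain ⟨-, -, ⟨k, i, j, h⟩ | ⟨k, i, j, h⟩⟩ := h <;> omega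

lemma two_le_of_starAt_nonempty (h : (N.starAt b).Nonempty) : 2 ≤ N.n := by
  obtain ⟨s, ⟨w, hw, -⟩ | ⟨w, hw, -⟩⟩ := h <;> exact two_le_of_mem_critWeights hw

lemma starAt_finite (N : PathNetwork) (b : ℕ) : (N.starAt b).Finite :=
  ((N.critWeights_finite _ _).image _).union ((N.critWeights_finite _ _).image _)

lemma scenariosOf_eq : scenariosOf N fams =
    {s | ∃ f ∈ fams, ∃ w ∈ f.2.2, N.pseudo f.1 f.2.1 w = s} := by
  ext s
  constructor
  · rintro ⟨⟨T, b, w⟩, ⟨f, hf, h1, h2, h3⟩, rfl⟩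
    simp only at h1 h2 h3
    exact ⟨f, hf, w, h3, by simp only [h1, h2]⟩
  · rintro ⟨f, hf, w, hw, rfl⟩
    exact ⟨(f.1, f.2.1, w), ⟨f, hf, rfl, rfl, hw⟩, rfl⟩

variable {crit : Side → ℕ → List ℝ}

lemma starOf_eq (hcrit : IsListing N crit) (hb : 1 ≤ b) (hbn : b ≤ N.n) (T : Side) :
    N.starOf T b = N.pseudo T b '' {w | w ∈ crit T b} := by
  unfold starOf
  congr 1
  ext w
  exact ((hcrit T b hb hbn).2 w).symm

lemma scenariosOf_singleton (hcrit : IsListing N crit) (hb : 1 ≤ b) (hbn : b ≤ N.n) (T : Side) :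
    scenariosOf N [(T, b, crit T b)] = N.starOf T b := by
  rw [scenariosOf_eq, starOf_eq hcrit hb hbn]
  ext s
  simp

lemma scenariosOf_familiesAt (hcrit : IsListing N crit) (hb : 1 ≤ b) (hbn : b ≤ N.n) :
    scenariosOf N (familiesAt crit b) = N.starAt b := by
  rw [scenariosOf_eq, starAt, starOf_eq hcrit hb hbn, starOf_eq hcrit hb hbn]
  ext s
  simp [familiesAt]

lemma mem_allFamilies {f : Side × ℕ × List ℝ} :
    f ∈ allFamilies N crit ↔ ∃ b, 1 ≤ b ∧ b ≤ N.n ∧ f ∈ familiesAt crit b := by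
  simp only [allFamilies, List.mem_flatMap, List.mem_range]
  constructor
  · rintro ⟨i, hi, hf⟩
    exact ⟨i + 1, by omega, by omega, hf⟩
  · rintro ⟨b, hb, hbn, hf⟩
    exact ⟨b - 1, by omega, by rwa [Nat.sub_add_cancel hb]⟩

lemma scenariosOf_allFamilies (hcrit : IsListing N crit) :
    scenariosOf N (allFamilies N crit) = N.star := by
  ext s
  constructor
  · rw [scenariosOf_eq]
    rintro ⟨f, hf, h⟩
    obtain ⟨b, hb, hbn, hf⟩ := mem_allFamilies.1 hf
    refine ⟨b, hb, hbn, ?_⟩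
    rw [← scenariosOf_familiesAt hcrit hb hbn, scenariosOf_eq]
    exact ⟨f, hf, h⟩
  · rintro ⟨b, hb, hbn, h⟩
    rw [← scenariosOf_familiesAt hcrit hb hbn, scenariosOf_eq] at h
    obtain ⟨f, hf, h⟩ := h
    rw [scenariosOf_eq]
    exact ⟨f, mem_allFamilies.2 ⟨b, hb, hbn, hf⟩, h⟩

lemma crit_nonneg (hcrit : IsListing N crit) (hb : 1 ≤ b) (hbn : b ≤ N.n) :
    ∀ w ∈ crit T b, 0 ≤ w := fun w hw =>
  (N.wlo_pos b hb hbn).le.trans (((hcrit T b hb hbn).2 w).1 hw).1.le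

lemma admissible_familiesAt (hcrit : IsListing N crit) (hb : 1 ≤ b) (hbn : b ≤ N.n) :
    Admissible N (familiesAt crit b) := by
  intro f hf
  simp only [familiesAt, List.mem_cons, List.not_mem_nil, or_false] at hf
  rcases hf with rfl | rfl <;> exact ⟨hb, hbn, crit_nonneg hcrit hb hbn⟩

lemma admissible_allFamilies (hcrit : IsListing N crit) : Admissible N (allFamilies N crit) := by
  intro f hf
  obtain ⟨b, hb, hbn, hf⟩ := mem_allFamilies.1 hf
  exact admissible_familiesAt hcrit hb hbn f hf

lemma tagsOf_nonempty (h : (scenariosOf N fams).Nonempty) : (tagsOf fams).Nonempty :=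
  Set.image_nonempty.1 h

lemma numTags_append (l l' : List (Side × ℕ × List ℝ)) :
    numTags (l ++ l') = numTags l + numTags l' := by
  simp [numTags]

lemma numTags_familiesAt :
    numTags (familiesAt crit b) = (crit Side.L b).length + (crit Side.R b).length := by
  simp [numTags, familiesAt]

lemma numTags_flatMap_familiesAt (m : ℕ) :
    numTags ((List.range m).flatMap fun i => familiesAt crit (i + 1)) =
      ∑ b ∈ Icc 1 m, (crit Side.L b).length + ∑ b ∈ Icc 1 m, (crit Side.R b).length := by
  induction m with
  | zero => simp [numTags]
  | succ m ih =>
    rw [List.range_succ, List.flatMap_append, numTags_append, ih, sum_Icc_succ_top (by omega),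
      sum_Icc_succ_top (by omega), List.flatMap_singleton, numTags_familiesAt]
    ring

lemma numTags_allFamilies_le (hcrit : IsListing N crit) :
    numTags (allFamilies N crit) ≤ 4 * N.n ^ 2 := by
  have h1 := sum_length_crit_le hcrit Side.L
  have h2 := sum_length_crit_le hcrit Side.R
  rw [allFamilies, numTags_flatMap_familiesAt]
  omega

lemma length_allFamilies : (allFamilies N crit).length = 2 * N.n := by
  simp [allFamilies, familiesAt, List.length_flatMap, mul_comm]

lemma length_crit_le (hcrit : IsListing N crit) (hb : 1 ≤ b) (hbn : b ≤ N.n) (T : Side) :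
    (crit T b).length ≤ 2 * N.n ^ 2 :=
  (single_le_sum (f := fun b => (crit T b).length) (fun _ _ => Nat.zero_le _)
    (mem_Icc.2 ⟨hb, hbn⟩)).trans (sum_length_crit_le hcrit T)

lemma numTags_familiesAt_le (hcrit : IsListing N crit) (hb : 1 ≤ b) (hbn : b ≤ N.n) :
    numTags (familiesAt crit b) ≤ 2 * (N.starAt b).ncard := by
  have h1 : (N.starOf Side.L b).ncard ≤ (N.starAt b).ncard :=
    Set.ncard_le_ncard Set.subset_union_left (starAt_finite N b)
  have h2 : (N.starOf Side.R b).ncard ≤ (N.starAt b).ncard :=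
    Set.ncard_le_ncard Set.subset_union_right (starAt_finite N b)
  rw [ncard_starOf hcrit _ hb hbn] at h1 h2
  rw [numTags_familiesAt]
  omega

lemma exists_isListing (N : PathNetwork) : ∃ crit, IsListing N crit :=
  ⟨fun T b => (N.critWeights_finite T b).toFinset.toList, fun _ _ _ _ =>
    ⟨nodup_toList _, fun w => by simp⟩⟩

lemma exists_upperEnvelope_hasSegments (hadm : Admissible N fams)
    (hfin : (scenariosOf N fams).Finite) (hne : (scenariosOf N fams).Nonempty) (hn : 1 ≤ N.n) :
    ∃ U : ℝ → ℝ, N.IsUpperEnvelope μ (scenariosOf N fams) U ∧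
      ∃ M : ℕ, M ≤ 6 * (numTags fams + fams.length * N.n) ∧
        HasSegments U (N.pos 1) (N.pos N.n) M := by
  obtain ⟨U, hU⟩ := exists_isUpperEnvelope (μ := μ) hfin hne
  obtain ⟨M, hM, hseg⟩ := hasSegments_upperEnvelope hadm (tagsOf_nonempty hne) hU hn
  refine ⟨U, hU, M, hM.trans ?_, hseg⟩
  have : fams.length ≤ fams.length * N.n := Nat.le_mul_of_pos_right _ hn
  rw [mul_add fams.length]
  lia

lemma exists_hasSegments_starAt (hb : 1 ≤ b) (hbn : b ≤ N.n) {A : Set (ℕ → ℝ)}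
    (hA : A = N.starAt b ∨ ∃ T, A = N.starOf T b) (hne : A.Nonempty) :
    ∃ U : ℝ → ℝ, N.IsUpperEnvelope μ A U ∧
      ∃ M : ℕ, M ≤ 12 * (A.ncard + N.n) ∧ HasSegments U (N.pos 1) (N.pos N.n) M := by
  obtain ⟨crit, hcrit⟩ := exists_isListing N
  rcases hA with rfl | ⟨T, rfl⟩
  · have hS := scenariosOf_familiesAt hcrit hb hbn
    rw [← hS] at hne
    obtain ⟨U, hU, M, hM, hseg⟩ := exists_upperEnvelope_hasSegments (μ := μ)
      (admissible_familiesAt hcrit hb hbn) (hS ▸ starAt_finite N b) hne (hb.trans hbn)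
    rw [hS] at hU
    refine ⟨U, hU, M, hM.trans ?_, hseg⟩
    have h1 := numTags_familiesAt_le hcrit hb hbn
    have h2 : (familiesAt crit b).length = 2 := rfl
    rw [h2]
    omega
  · have hS := scenariosOf_singleton hcrit hb hbn T
    have hfin : (N.starOf T b).Finite := (N.critWeights_finite T b).image _
    rw [← hS] at hne
    obtain ⟨U, hU, M, hM, hseg⟩ := exists_upperEnvelope_hasSegments (μ := μ)
      (fams := [(T, b, crit T b)])
      (fun f hf => by
        rw [List.mem_singleton] at hf
        subst hf
        exact ⟨hb, hbn, crit_nonneg hcrit hb hbn⟩) (hS ▸ hfin) hne (hb.trans hbn)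
    rw [hS] at hU
    refine ⟨U, hU, M, hM.trans ?_, hseg⟩
    have h1 : numTags [(T, b, crit T b)] = (N.starOf T b).ncard := by
      rw [ncard_starOf hcrit T hb hbn]
      simp [numTags]
    rw [h1, List.length_singleton]
    omega

lemma exists_hasSegments_star (hne : N.star.Nonempty) :
    ∃ U : ℝ → ℝ, N.IsUpperEnvelope μ N.star U ∧
      ∃ M : ℕ, M ≤ 36 * N.n ^ 2 ∧ HasSegments U (N.pos 1) (N.pos N.n) M := by
  obtain ⟨crit, hcrit⟩ := exists_isListing N
  have hn : 1 ≤ N.n := by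
    obtain ⟨s, b, hb, hbn, -⟩ := hne
    exact hb.trans hbn
  have hS := scenariosOf_allFamilies hcrit
  rw [← hS] at hne
  obtain ⟨U, hU, M, hM, hseg⟩ := exists_upperEnvelope_hasSegments (μ := μ)
    (admissible_allFamilies hcrit) (hS ▸ N.star_finite) hne hn
  rw [hS] at hU
  refine ⟨U, hU, M, hM.trans ?_, hseg⟩
  have h1 := numTags_allFamilies_le hcrit
  rw [length_allFamilies, mul_assoc, ← pow_two]
  omega

lemma algorithmThree_time_le (hcrit : IsListing N crit) (hb : 1 ≤ b) (hbn : b ≤ N.n)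
    (hne : (N.starOf T b).Nonempty) :
    ((algorithmThree N μ T b (crit T b)).time : ℝ) ≤
      735 * (((N.starOf T b).ncard : ℝ) * Real.log N.n) := by
  have hn : 2 ≤ N.n := by
    obtain ⟨s, w, hw, -⟩ := hne
    exact two_le_of_mem_critWeights hw
  have h1 := algorithmThree_time (μ := μ) (T := T) (ws := crit T b) hbn
  have h2 := length_crit_le hcrit hb hbn T
  have h3 : Nat.clog 2 (crit T b).length ≤ 2 * Nat.clog 2 N.n + 1 := clog_two_le_of_le (by omega)
  have h4 : 1 ≤ Nat.clog 2 N.n := Nat.clog_pos one_lt_two hn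
  have h5 := clog_two_le_log hn
  have h6 : 1 ≤ (N.starOf T b).ncard :=
    (Set.ncard_pos ((N.critWeights_finite T b).image _)).2 hne
  rw [← ncard_starOf hcrit T hb hbn] at h1 h3
  generalize (N.starOf T b).ncard = m at *
  generalize Nat.clog 2 N.n = L at *
  have h7 : m * (Nat.clog 2 m + L + 1) ≤ m * (6 * L) := Nat.mul_le_mul le_rfl (by omega)
  have h8 : m * (6 * L) = 6 * (m * L) := by ring
  have h9 : 1 ≤ m * L := Nat.mul_pos h6 h4
  have h10 : (algorithmThree N μ T b (crit T b)).time ≤ 245 * (m * L) := by omega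
  calc ((algorithmThree N μ T b (crit T b)).time : ℝ) ≤ 245 * (m * L) := by exact_mod_cast h10
    _ ≤ 245 * (m * (3 * Real.log N.n)) := by gcongr
    _ = _ := by ring

lemma totalEnvelope_familiesAt_time_le (hcrit : IsListing N crit) (hb : 1 ≤ b) (hbn : b ≤ N.n)
    (hne : (N.starAt b).Nonempty) :
    ((totalEnvelope N μ (familiesAt crit b)).time : ℝ) ≤
      9600 * ((((N.starAt b).ncard : ℝ) + N.n) * Real.log N.n) := by
  have hn := two_le_of_starAt_nonempty hne
  have h1 := numTags_familiesAt_le hcrit hb hbn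
  have h2 := length_crit_le hcrit hb hbn Side.L
  have h3 := length_crit_le hcrit hb hbn Side.R
  have h4 : (familiesAt crit b).length = 2 := rfl
  have h5 := totalEnvelope_time_le (μ := μ) (admissible_familiesAt hcrit hb hbn) hn
    (by omega) (by omega) (by rw [numTags_familiesAt]; omega)
  have h6 : 0 ≤ Real.log N.n := Real.log_natCast_nonneg _
  rw [h4] at h5
  have h7 : (numTags (familiesAt crit b) : ℝ) ≤ 2 * (N.starAt b).ncard := by exact_mod_cast h1
  calc _ ≤ _ := h5
    _ ≤ 4800 * ((2 * (N.starAt b).ncard + (2 : ℕ) * N.n) * Real.log N.n) := by gcongr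
    _ = _ := by push_cast; ring

lemma totalEnvelope_allFamilies_time_le (hcrit : IsListing N crit) (hne : N.star.Nonempty) :
    ((totalEnvelope N μ (allFamilies N crit)).time : ℝ) ≤
      28800 * ((N.n : ℝ) ^ 2 * Real.log N.n) := by
  have hn : 2 ≤ N.n := by
    obtain ⟨s, b, -, -, h⟩ := hne
    exact two_le_of_starAt_nonempty ⟨s, h⟩
  have h1 := numTags_allFamilies_le hcrit
  have h4 : (allFamilies N crit).length = 2 * N.n := length_allFamilies
  have h5 := totalEnvelope_time_le (μ := μ) (admissible_allFamilies hcrit) hn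
    (by omega) (by omega) h1
  have h6 : 0 ≤ Real.log N.n := Real.log_natCast_nonneg _
  rw [h4] at h5
  have h7 : (numTags (allFamilies N crit) : ℝ) ≤ 4 * (N.n : ℝ) ^ 2 := by exact_mod_cast h1
  calc _ ≤ _ := h5
    _ ≤ 4800 * ((4 * (N.n : ℝ) ^ 2 + (2 * N.n : ℕ) * N.n) * Real.log N.n) := by gcongr
    _ = _ := by push_cast; ring

end Bounds

end EvacPath

end

theorem mainTheorem5 :
    ∃ C : ℝ, ∀ N : PathNetwork, N.star.Finite ∧
      ∀ μ : (ℕ → ℝ) → ℝ, (∀ s ∈ N.star, N.IsSink s (μ s)) →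
        -- number of segments, for one boundary vertex (both kinds together, or one kind)
        (∀ b, 1 ≤ b → b ≤ N.n →
          ∀ A : Set (ℕ → ℝ), (A = N.starAt b ∨ ∃ T, A = N.starOf T b) → A.Nonempty →
            ∃ U : ℝ → ℝ, N.IsUpperEnvelope μ A U ∧
              ∃ M : ℕ, (M : ℝ) ≤ C * ((A.ncard : ℝ) + N.n) ∧
                HasSegments U (N.pos 1) (N.pos N.n) M) ∧
        -- number of segments, for all critical scenarios
        (N.star.Nonempty →
          ∃ U : ℝ → ℝ, N.IsUpperEnvelope μ N.star U ∧
            ∃ M : ℕ, (M : ℝ) ≤ C * (N.n : ℝ) ^ 2 ∧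
              HasSegments U (N.pos 1) (N.pos N.n) M) ∧
        ∀ crit : Side → ℕ → List ℝ, IsListing N crit →
          -- correctness and running time for one boundary vertex and one kind
          (∀ b, 1 ≤ b → b ≤ N.n → ∀ T, (N.starOf T b).Nonempty →
            (algorithmThree N μ T b (crit T b)).val.1.Ordered ∧
            (algorithmThree N μ T b (crit T b)).val.2.Ordered ∧
            N.IsUpperEnvelope μ (N.starOf T b)
              (twoSided N μ T b (algorithmThree N μ T b (crit T b)).val) ∧
            ((algorithmThree N μ T b (crit T b)).time : ℝ)
              ≤ C * (((N.starOf T b).ncard : ℝ) * Real.log N.n)) ∧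
          -- one boundary vertex, both kinds together, all segments written out
          (∀ b, 1 ≤ b → b ≤ N.n → (N.starAt b).Nonempty →
            (totalEnvelope N μ (familiesAt crit b)).val.Describes N μ (N.starAt b) ∧
            ((totalEnvelope N μ (familiesAt crit b)).time : ℝ)
              ≤ C * ((((N.starAt b).ncard : ℝ) + N.n) * Real.log N.n)) ∧
          -- all critical scenarios
          (N.star.Nonempty →
            (totalEnvelope N μ (allFamilies N crit)).val.Describes N μ N.star ∧
            ((totalEnvelope N μ (allFamilies N crit)).time : ℝ)
              ≤ C * ((N.n : ℝ) ^ 2 * Real.log N.n)) := by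
  -- one constant for all bounds
  have hC : ∀ {a c y : ℝ}, a ≤ c * y → 0 ≤ y → c ≤ 30000 → a ≤ 30000 * y :=
    fun h hy hc => h.trans (mul_le_mul_of_nonneg_right hc hy)
  refine ⟨30000, fun N => ⟨N.star_finite, fun μ _ => ⟨fun b hb hbn A hA hne => ?_, fun hne => ?_,
    fun crit hcrit => ⟨fun b hb hbn T hne => ?_, fun b hb hbn hne => ?_, fun hne => ?_⟩⟩⟩⟩
  · obtain ⟨U, hU, M, hM, hseg⟩ := exists_hasSegments_starAt (μ := μ) hb hbn hA hne
    refine ⟨U, hU, M, hC (c := 12) ?_ (by positivity) (by norm_num), hseg⟩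
    exact_mod_cast hM
  · obtain ⟨U, hU, M, hM, hseg⟩ := exists_hasSegments_star (μ := μ) hne
    refine ⟨U, hU, M, hC (c := 36) ?_ (by positivity) (by norm_num), hseg⟩
    exact_mod_cast hM
  · have hws := crit_nonneg (T := T) hcrit hb hbn
    have hS := starOf_eq hcrit hb hbn T
    have hnil : crit T b ≠ [] := by
      intro h
      rw [hS, h] at hne
      simp at hne
    rw [algorithmThree_val]
    refine ⟨(isEnv_halfEnvelope hb hbn hws hnil _).ordered,
      (isEnv_halfEnvelope hb hbn hws hnil _).ordered, ?_, ?_⟩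
    · rw [hS, ← algorithmThree_val]
      exact isUpperEnvelope_twoSided hb hbn hws hnil
    · exact hC (algorithmThree_time_le hcrit hb hbn hne)
        (mul_nonneg (Nat.cast_nonneg _) (Real.log_natCast_nonneg _)) (by norm_num)
  · have hS := scenariosOf_familiesAt hcrit hb hbn
    refine ⟨?_, hC (totalEnvelope_familiesAt_time_le hcrit hb hbn hne)
      (mul_nonneg (by positivity) (Real.log_natCast_nonneg _)) (by norm_num)⟩
    rw [← hS] at hne ⊢
    exact totalEnvelope_describes (admissible_familiesAt hcrit hb hbn) (tagsOf_nonempty hne)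
  · have hS := scenariosOf_allFamilies hcrit
    refine ⟨?_, hC (totalEnvelope_allFamilies_time_le hcrit hne)
      (mul_nonneg (by positivity) (Real.log_natCast_nonneg _)) (by norm_num)⟩
    rw [← hS] at hne ⊢
    exact totalEnvelope_describes (admissible_allFamilies hcrit) (tagsOf_nonempty hne)
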